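/- **Setting.** Work in $L^2(\mathbb R^3;\mathbb C^4)$ with norm $\|\cdot\|$, and let $\sigma_1,\sigma_2,\sigma_3$ be the Pauli matrices, $$\alpha_j=\begin{pmatrix}0&\sigma_j\\ \sigma_j&0\end{pmatrix},\qquad \beta=\begin{pmatrix}\mathbb I_2&0\\0&-\mathbb I_2\end{pmatrix},\qquad S_j=\frac12\begin{pmatrix}\sigma_j&0\\0&\sigma_j\end{pmatrix}\qquad(j=1,2,3).$$ Let $m\ge 0$ and let $A:\mathbb R^3\to\mathbb R^3$ be in $L^2_{\rm loc}$. Put $\partial^A_j=\partial_j-iA_j$ (weak derivatives), $\nabla_A=(\partial_1^A,\partial_2^A,\partial_3^A)$, $\|\nabla_A\psi\|^2=\sum_j\|\partial_j^A\psi\|^2$, and for a matrix-valued function $V:\mathbb R^3\to\mathbb C^{4\times4}$ $$H_m(A,V)=-i\boldsymbol\alpha\cdot\nabla_A+m\beta+V ,$$ acting on the $\psi\in H^1(\mathbb R^3;\mathbb C^4)$ with $-i\boldsymbol\alpha\cdot\nabla_A\psi+m\beta\psi+V\psi\in L^2(\mathbb R^3;\mathbb C^4)$. Assume that $H_m(A,0)$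 is self-adjoint with domain $H^1(\mathbb R^3;\mathbb C^4)$. Let the magnetic field $B:\mathbb R^3\to\mathbb R^3$ be $B=\nabla\times A$ in the sense of distributions (the statement is also claimed for the opposite orientation convention $B=-\nabla\times A$), and assume that $B\in L^2_{\rm loc}$ and that the distributional Jacobian $\nabla B$ is a locally integrable function. Here $|B|$ and $|\nabla\phi|$ are Euclidean norms, and $|\nabla B|$ is the operator norm of the $3\times 3$ Jacobian matrix. **Theorem (anomalous magnetic potential, $d=3$).** Let $\phi\in L^2_{\rm loc}(\mathbb R^3;\mathbb R)$ be $C^\infty$ on $\mathbb R^3\setminus\{0\}$ and bounded outside any ball containing the origin, and set $$V^{3d}_{\rm am}(x)=i\beta\,(\boldsymbol\alpha\cdot\nabla)\phi(x)-2\beta\,\boldsymbol S\cdot B(x).$$ Suppose that there are constants $\varepsilon_1,\dots,\varepsilon_5\ge0$ with $$6\varepsilon_1+16\varepsilon_2^2+16\varepsilon_4^2+32\,\varepsilon_2\varepsilon_4+32\,m\,\varepsilon_1+32\varepsilon_2+48\varepsilon_4+8\varepsilon_3+16\varepsilon_5<2$$ such that $$\sup_{x\neq 0}|x||\nabla\phi(x)|\le\varepsilon_2,\qquad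 \operatorname*{ess\,sup}_{x\in\mathbb R^3}|x||B(x)|\le\varepsilon_4,$$ and, for every $\psi\in H^1(\mathbb R^3;\mathbb C^4)$, $$\int_{\mathbb R^3}|x|^2|B|^2|\psi|^2\,dx\le\varepsilon_1^2\|\nabla_A\psi\|^2,\qquad \int_{\mathbb R^3}|x|^2|\Delta\phi|^2|\psi|^2\,dx\le\varepsilon_3^2\|\nabla_A\psi\|^2,\qquad \int_{\mathbb R^3}|x|^2|\nabla B|^2|\psi|^2\,dx\le\varepsilon_5^2\|\nabla_A\psi\|^2.$$ Then $H_m(A,V^{3d}_{\rm am})$ has no eigenvalues, i.e. $\sigma_p\big(H_m(A,V^{3d}_{\rm am})\big)=\varnothing$. -/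

import Mathlib

open MeasureTheory
open scoped ContDiff

namespace MagneticDirac

noncomputable section

/-! ### Dirac matrices and spin operator in dimension three -/

/-- The physical space `ℝ³` with its Euclidean norm. -/
abbrev R3 : Type := EuclideanSpace ℝ (Fin 3)

/-- The spinor space `ℂ⁴ = ℂ² ⊕ ℂ²` with its Hermitian norm. -/
abbrev Spinor : Type := EuclideanSpace ℂ (Fin 2 ⊕ Fin 2)

/-- Complex `4 × 4` matrices, in `2 × 2` blocks. -/
abbrev Mat4 : Type := Matrix (Fin 2 ⊕ Fin 2) (Fin 2 ⊕ Fin 2) ℂ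

/-- The Pauli matrices `σ₁, σ₂, σ₃`. -/
def pauli : Fin 3 → Matrix (Fin 2) (Fin 2) ℂ :=
  ![!![0, 1; 1, 0], !![0, -Complex.I; Complex.I, 0], !![1, 0; 0, -1]]

/-- The Dirac matrices `α₁, α₂, α₃` (standard representation). -/
def alpha (j : Fin 3) : Mat4 := Matrix.fromBlocks 0 (pauli j) (pauli j) 0

/-- The Dirac matrix `β`. -/
def beta : Mat4 := Matrix.fromBlocks 1 0 0 (-1)

/-- The components of the spin operator, `S_j = (1/2) diag(σ_j, σ_j)`. -/
def spin (j : Fin 3) : Mat4 := (1 / 2 : ℂ) • Matrix.fromBlocks (pauli j) 0 0 (pauli j)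

/-- The action of a matrix on a spinor. -/
def act (M : Mat4) : Spinor →L[ℂ] Spinor := Matrix.toEuclideanCLM (𝕜 := ℂ) M

/-! ### Weak derivatives and function spaces on `ℝ³` -/

/-- The `j`-th classical partial derivative. -/
def partialD (j : Fin 3) (η : R3 → ℝ) (x : R3) : ℝ :=
  fderiv ℝ η x (EuclideanSpace.single j (1 : ℝ))

/-- Smooth real-valued functions with compact support. -/
def IsTest (η : R3 → ℝ) : Prop := ContDiff ℝ ∞ η ∧ HasCompactSupport η

/-- The distributional derivative `∂_j f` of the locally integrable function `f`
is the locally integrable function `g`. -/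
def HasWeakPartial {F : Type*} [NormedAddCommGroup F] [NormedSpace ℝ F]
    (j : Fin 3) (f g : R3 → F) : Prop :=
  LocallyIntegrable f ∧ LocallyIntegrable g ∧
    ∀ η : R3 → ℝ, IsTest η → ∫ x, partialD j η x • f x = -∫ x, η x • g x

/-- Local square integrability. -/
def L2Loc {F : Type*} [NormedAddCommGroup F] (f : R3 → F) : Prop :=
  ∀ K : Set R3, IsCompact K → MemLp f 2 (volume.restrict K)

/-- `B = ∇ × A` in the sense of distributions; in components (indices modulo 3)
`B_j = ∂_{j+1} A_{j+2} - ∂_{j+2} A_{j+1}`. -/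
def IsWeakCurl (A B : R3 → R3) : Prop :=
  ∀ η : R3 → ℝ, IsTest η → ∀ j : Fin 3,
    ∫ x, η x * B x j =
      ∫ x, (A x (j + 1) * partialD (j + 2) η x - A x (j + 2) * partialD (j + 1) η x)

/-- `DB` is the distributional Jacobian of the vector field `B`: its `j`-th column
`DB x e_j` is the weak partial derivative `∂_j B`. -/
def IsWeakJacobian (B : R3 → R3) (DB : R3 → R3 →L[ℝ] R3) : Prop :=
  ∀ j : Fin 3, HasWeakPartial j B (fun x => DB x (EuclideanSpace.single j (1 : ℝ)))

/-- The Hilbert space `L²(ℝ³; ℂ⁴)`. -/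
abbrev L2 : Type := Lp Spinor 2 (volume : Measure R3)

lemma L2.locInt (f : L2) : LocallyIntegrable (f : R3 → Spinor) :=
  (Lp.memLp f).locallyIntegrable (by norm_num)

lemma IsTest.partialD_cont {η : R3 → ℝ} (h : IsTest η) (j : Fin 3) :
    Continuous (partialD j η) :=
  (h.1.continuous_fderiv (by simp)).clm_apply continuous_const

lemma IsTest.partialD_supp {η : R3 → ℝ} (h : IsTest η) (j : Fin 3) :
    HasCompactSupport (partialD j η) :=
  h.2.fderiv_apply (𝕜 := ℝ) _

lemma HasWeakPartial.congr {j : Fin 3} {f f' g g' : R3 → Spinor}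
    (h : HasWeakPartial j f g) (hf : f =ᵐ[volume] f') (hg : g =ᵐ[volume] g') :
    HasWeakPartial j f' g' := by
  refine ⟨h.1.congr hf, h.2.1.congr hg, fun η hη => ?_⟩
  have h1 : ∫ x, partialD j η x • f' x = ∫ x, partialD j η x • f x :=
    integral_congr_ae (hf.mono fun x hx => by simp only [hx])
  have h2 : ∫ x, η x • g' x = ∫ x, η x • g x :=
    integral_congr_ae (hg.mono fun x hx => by simp only [hx])
  rw [h1, h2, h.2.2 η hη]

lemma HasWeakPartial.add {j : Fin 3} {f f' g g' : R3 → Spinor}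
    (h : HasWeakPartial j f g) (h' : HasWeakPartial j f' g') :
    HasWeakPartial j (f + f') (g + g') := by
  refine ⟨h.1.add h'.1, h.2.1.add h'.2.1, fun η hη => ?_⟩
  have c := hη.1.continuous
  have cd := hη.partialD_cont j
  have s := hη.2
  have sd := hη.partialD_supp j
  simp only [Pi.add_apply, smul_add]
  rw [integral_add (h.1.integrable_smul_left_of_hasCompactSupport cd sd)
      (h'.1.integrable_smul_left_of_hasCompactSupport cd sd),
    integral_add (h.2.1.integrable_smul_left_of_hasCompactSupport c s)
      (h'.2.1.integrable_smul_left_of_hasCompactSupport c s),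
    h.2.2 η hη, h'.2.2 η hη, neg_add]

lemma HasWeakPartial.const_smul {j : Fin 3} {f g : R3 → Spinor} (c : ℂ)
    (h : HasWeakPartial j f g) : HasWeakPartial j (c • f) (c • g) := by
  refine ⟨h.1.smul c, h.2.1.smul c, fun η hη => ?_⟩
  simp only [Pi.smul_apply, smul_comm _ c]
  rw [integral_smul, integral_smul, h.2.2 η hη, smul_neg]

lemma HasWeakPartial.unique {j : Fin 3} {f g g' : R3 → Spinor}
    (h : HasWeakPartial j f g) (h' : HasWeakPartial j f g') : g =ᵐ[volume] g' :=
  ae_eq_of_integral_contDiff_smul_eq h.2.1 h'.2.1 fun η h1 h2 => by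
    have e := h.2.2 η ⟨h1, h2⟩
    rw [h'.2.2 η ⟨h1, h2⟩] at e
    exact (neg_injective e).symm

/-- The Sobolev space `H¹(ℝ³; ℂ⁴)`: square integrable spinors whose distributional first
derivatives are square integrable. -/
def H1 : Submodule ℂ L2 where
  carrier := {ψ | ∀ j : Fin 3, ∃ g : L2, HasWeakPartial j (ψ : R3 → Spinor) (g : R3 → Spinor)}
  add_mem' {a b} ha hb j := by
    obtain ⟨g, hg⟩ := ha j
    obtain ⟨g', hg'⟩ := hb j
    exact ⟨g + g', (hg.add hg').congr (Lp.coeFn_add a b).symm (Lp.coeFn_add g g').symm⟩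
  zero_mem' j := by
    refine ⟨0, L2.locInt 0, L2.locInt 0, fun η _ => ?_⟩
    have h0 : ∀ u : R3 → ℝ, ∫ x, u x • ((0 : L2) : R3 → Spinor) x = 0 := fun u => by
      have : (fun x => u x • ((0 : L2) : R3 → Spinor) x) =ᵐ[volume] 0 :=
        (Lp.coeFn_zero Spinor 2 (volume : Measure R3)).mono fun x _ => by simp
      rw [integral_congr_ae this]
      simp
    rw [h0, h0, neg_zero]
  smul_mem' c a ha j := by
    obtain ⟨g, hg⟩ := ha j
    exact ⟨c • g, (hg.const_smul c).congr (Lp.coeFn_smul c a).symm (Lp.coeFn_smul c g).symm⟩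

open Classical in
/-- The weak partial derivative `∂_j ψ ∈ L²` of `ψ ∈ H¹` (and `0` for `ψ ∉ H¹`). -/
def weakPartial (j : Fin 3) (ψ : L2) : L2 :=
  if h : ψ ∈ H1 then (h j).choose else 0

lemma weakPartial_spec (j : Fin 3) {ψ : L2} (h : ψ ∈ H1) :
    HasWeakPartial j (ψ : R3 → Spinor) (weakPartial j ψ : R3 → Spinor) := by
  rw [weakPartial, dif_pos h]
  exact (h j).choose_spec

lemma weakPartial_add (j : Fin 3) {a b : L2} (ha : a ∈ H1) (hb : b ∈ H1) :
    weakPartial j (a + b) = weakPartial j a + weakPartial j b := by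
  refine Lp.ext ((weakPartial_spec j (H1.add_mem ha hb)).unique
    (((weakPartial_spec j ha).add (weakPartial_spec j hb)).congr
      (Lp.coeFn_add a b).symm (Lp.coeFn_add _ _).symm))

lemma weakPartial_smul (j : Fin 3) (c : ℂ) {a : L2} (ha : a ∈ H1) :
    weakPartial j (c • a) = c • weakPartial j a := by
  refine Lp.ext ((weakPartial_spec j (H1.smul_mem c ha)).unique
    (((weakPartial_spec j ha).const_smul c).congr
      (Lp.coeFn_smul c a).symm (Lp.coeFn_smul _ _).symm))

/-! ### Magnetic gradient and Dirac operator -/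

/-- The magnetic derivative `∂_j^A ψ = ∂_j ψ - i A_j ψ`. -/
def magPartial (A : R3 → R3) (j : Fin 3) (ψ : L2) (x : R3) : Spinor :=
  weakPartial j ψ x - (Complex.I * (A x j : ℂ)) • ψ x

/-- `‖∇_A ψ‖² = ∑_j ∫ |∂_j^A ψ|²`, as an extended nonnegative number. -/
def magGradSq (A : R3 → R3) (ψ : L2) : ENNReal :=
  ∑ j : Fin 3, ∫⁻ x, ‖magPartial A j ψ x‖ₑ ^ 2

/-- The function `-i α·∇_A ψ + m β ψ + V ψ`. -/
def diracFun (m : ℝ) (A : R3 → R3) (V : R3 → Mat4) (ψ : L2) (x : R3) : Spinor :=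
  (-Complex.I) • ∑ j : Fin 3, act (alpha j) (magPartial A j ψ x)
    + (m : ℂ) • act beta (ψ x) + act (V x) (ψ x)

lemma magPartial_add (A : R3 → R3) (j : Fin 3) {a b : L2} (ha : a ∈ H1) (hb : b ∈ H1) :
    magPartial A j (a + b) =ᵐ[volume] magPartial A j a + magPartial A j b := by
  filter_upwards [Lp.coeFn_add a b, Lp.coeFn_add (weakPartial j a) (weakPartial j b)]
    with x h1 h2
  simp only [magPartial, Pi.add_apply, weakPartial_add j ha hb] at h1 h2 ⊢
  rw [h1, h2, smul_add]
  abel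

lemma magPartial_smul (A : R3 → R3) (j : Fin 3) (c : ℂ) {a : L2} (ha : a ∈ H1) :
    magPartial A j (c • a) =ᵐ[volume] c • magPartial A j a := by
  filter_upwards [Lp.coeFn_smul c a, Lp.coeFn_smul c (weakPartial j a)] with x h1 h2
  simp only [magPartial, Pi.smul_apply, weakPartial_smul j c ha] at h1 h2 ⊢
  rw [h1, h2, smul_sub, smul_comm c]

lemma diracFun_add (m : ℝ) (A : R3 → R3) (V : R3 → Mat4) {a b : L2}
    (ha : a ∈ H1) (hb : b ∈ H1) :
    diracFun m A V (a + b) =ᵐ[volume] diracFun m A V a + diracFun m A V b := by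
  have h := fun j => magPartial_add A j ha hb
  filter_upwards [Lp.coeFn_add a b, ae_all_iff.2 h] with x h1 h2
  simp only [diracFun, Pi.add_apply] at h1 h2 ⊢
  simp only [h1, h2, map_add, Finset.sum_add_distrib, smul_add]
  abel

lemma diracFun_smul (m : ℝ) (A : R3 → R3) (V : R3 → Mat4) (c : ℂ) {a : L2} (ha : a ∈ H1) :
    diracFun m A V (c • a) =ᵐ[volume] c • diracFun m A V a := by
  have h := fun j => magPartial_smul A j c ha
  filter_upwards [Lp.coeFn_smul c a, ae_all_iff.2 h] with x h1 h2
  simp only [diracFun, Pi.smul_apply] at h1 h2 ⊢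
  simp only [h1, h2, map_smul, ← Finset.smul_sum, smul_add, smul_comm c]

/-- The domain of `H_m(A, V)`: the spinors of `H¹` whose image is square integrable. -/
def diracDomain (m : ℝ) (A : R3 → R3) (V : R3 → Mat4) : Submodule ℂ L2 where
  carrier := {ψ | ψ ∈ H1 ∧ MemLp (diracFun m A V ψ) 2 volume}
  add_mem' := fun {_ _} ha hb =>
    ⟨H1.add_mem ha.1 hb.1, (ha.2.add hb.2).ae_eq (diracFun_add m A V ha.1 hb.1).symm⟩
  zero_mem' := by
    refine ⟨H1.zero_mem, ?_⟩
    have h := diracFun_smul m A V 0 (a := 0) H1.zero_mem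
    rw [zero_smul, zero_smul] at h
    exact MemLp.zero.ae_eq h.symm
  smul_mem' := fun c _ ha =>
    ⟨H1.smul_mem c ha.1, (ha.2.const_smul c).ae_eq (diracFun_smul m A V c ha.1).symm⟩

/-- The image `-i α·∇_A ψ + m β ψ + V ψ` as an element of `L²`. -/
def diracImage (m : ℝ) (A : R3 → R3) (V : R3 → Mat4) (ψ : diracDomain m A V) : L2 :=
  MemLp.toLp (diracFun m A V ψ) ψ.2.2

lemma diracImage_coe (m : ℝ) (A : R3 → R3) (V : R3 → Mat4) (ψ : diracDomain m A V) :
    diracImage m A V ψ =ᵐ[volume] diracFun m A V ψ :=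
  MemLp.coeFn_toLp ψ.2.2

lemma diracImage_add (m : ℝ) (A : R3 → R3) (V : R3 → Mat4) (a b : diracDomain m A V) :
    diracImage m A V (a + b) = diracImage m A V a + diracImage m A V b := by
  refine Lp.ext ?_
  filter_upwards [diracImage_coe m A V (a + b), diracImage_coe m A V a, diracImage_coe m A V b,
    diracFun_add m A V a.2.1 b.2.1,
    Lp.coeFn_add (diracImage m A V a) (diracImage m A V b)] with x h1 h2 h3 h4 h5
  rw [h1, h5, Pi.add_apply, h2, h3]
  exact h4

lemma diracImage_smul (m : ℝ) (A : R3 → R3) (V : R3 → Mat4) (c : ℂ) (a : diracDomain m A V) :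
    diracImage m A V (c • a) = c • diracImage m A V a := by
  refine Lp.ext ?_
  filter_upwards [diracImage_coe m A V (c • a), diracImage_coe m A V a,
    diracFun_smul m A V c a.2.1, Lp.coeFn_smul c (diracImage m A V a)] with x h1 h2 h3 h4
  rw [h1, h4, Pi.smul_apply, h2]
  exact h3

/-- The electromagnetic Dirac operator `H_m(A, V) = -i α·∇_A + m β + V` in `L²(ℝ³; ℂ⁴)`. -/
def diracOp (m : ℝ) (A : R3 → R3) (V : R3 → Mat4) : L2 →ₗ.[ℂ] L2 where
  domain := diracDomain m A V
  toFun :=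
    { toFun := diracImage m A V
      map_add' := diracImage_add m A V
      map_smul' := diracImage_smul m A V }

/-- The point spectrum (set of eigenvalues) of a partially defined operator. -/
def pointSpectrum (T : L2 →ₗ.[ℂ] L2) : Set ℂ :=
  {μ | ∃ ψ : T.domain, (ψ : L2) ≠ 0 ∧ T ψ = μ • (ψ : L2)}

/-- The anomalous magnetic potential `i β (α·∇)φ - 2 β S·B`. -/
def anomalousPotential (φ : R3 → ℝ) (B : R3 → R3) (x : R3) : Mat4 :=
  Complex.I • (beta * ∑ j : Fin 3, (partialD j φ x : ℂ) • alpha j)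
    - (2 : ℂ) • (beta * ∑ j : Fin 3, (B x j : ℂ) • spin j)

end

end MagneticDirac

open MeasureTheory Filter Topology
open scoped ContDiff ENNReal InnerProductSpace

namespace MagneticDirac

noncomputable section

/-! ### Calculus of weak derivatives. -/

section Weak

variable {F G : Type*} [NormedAddCommGroup F] [NormedSpace ℝ F]
  [NormedAddCommGroup G] [NormedSpace ℝ G]

/-! Let `u` be an eigenfunction for `μ`, write `D = -iα·∇_A`, and put `f = D u = (μ - mβ - V) u`.
The proof plays two inequalities between `N = ‖∇_A u‖` and `n = ‖f‖` against each other. Every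
smallness assumption is invariant under dilations once weighed with the magnetic Hardy inequality
`‖u/|x|‖ ≤ 2N` (`hardy`), and Hardy also shows that `N = 0` forces `u = 0`.

Lower bound for `n`: expanding `‖α·∇_A u‖²` gives `N²` plus a term in the magnetic field, since
magnetic derivatives commute up to the field (`inner_magD_magD`). Hardy and the assumption on `B`
bound this term by `2ε₁N²`, so `N² ≤ n² + 2ε₁N²` (`gradSq_le`).

Upper bound for `n`: differentiating the first order equation once more gives `D f = κ u + error`,
where `κ = μ² - m²` is real because `V` is Hermitian (`eigenvalue_im_eq_zero`). The Clifford
relations keep the error of lower order: second derivatives of `φ` enter only through the Laplacian,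
those of `B` only through its curl because `div B = 0` (`ae_trace_eq_zero`), and the mass interacts
with `B` alone (`norm_squared_equation_le`). Pair this equation with `G u`, where `G = x·∇_A + 3/2`
generates dilations. As `G` is skew-adjoint and `[D, G]` equals `D` up to a magnetic term, formally
`n² = Re ⟨D f - κ u, G u⟩ + Re ⟨f, α·(x × F) u⟩`, with `F = ∇ × A = ±B`. The real part of `κ⟨u, G
u⟩` is zero, which is why the eigenvalue leaves no trace in the final condition. Writing `K N` for a
bound on the norm of `|x|` times the error, this yields `n² ≤ 4K N² + ε₁ n N`
(`norm_diracL_sq_le_integral`, `integral_virialMain_le`). The two bounds are incompatible with `N >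
0` when `3ε₁ + 4K < 1` (`eq_zero_of_virial_inequalities`), and this is implied by the assumed
smallness.

Two difficulties make the formal argument long. First, `A` is only known to multiply `H¹` into `L²`,
a fact extracted from the domain of `H_m(A,0)` (`admissible_of_domain`). Integrations by parts are
proved for smooth functions and extended by density; the continuity needed for the limit comes from
the closed graph theorem (`continuous_mulGraph`). Second, `f` need not lie in `H¹` near the origin,
where the potential may be as singular as `1/|x|`. The virial identity is therefore applied to a
localization of `f` to an annulus, where the coefficients are multipliers of `H¹`
(`EigenData.exists_localized`). A pointwise inequality between the integrands
(`virialDensity_radial_le`) isolates the terms carrying the gradient of the cutoff, which vanish as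
the annulus exhausts the space because `|x||∇ζ|` stays bounded. -/

lemma IsTest.mul_contDiff {η a : R3 → ℝ} (h : IsTest η) (ha : ContDiff ℝ ∞ a) :
    IsTest (fun x => η x * a x) :=
  ⟨h.1.mul ha, h.2.mul_right⟩

lemma contDiff_partialD {a : R3 → ℝ} (ha : ContDiff ℝ ∞ a) (j : Fin 3) :
    ContDiff ℝ ∞ (partialD j a) :=
  (ha.fderiv_right (by simp)).clm_apply contDiff_const

lemma IsTest.partialD {a : R3 → ℝ} (ha : IsTest a) (j : Fin 3) : IsTest (partialD j a) :=
  ⟨contDiff_partialD ha.1 j, ha.partialD_supp j⟩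

lemma partialD_mul {a b : R3 → ℝ} (j : Fin 3) (x : R3) (ha : DifferentiableAt ℝ a x)
    (hb : DifferentiableAt ℝ b x) :
    partialD j (fun y => a y * b y) x = partialD j a x * b x + a x * partialD j b x := by
  have : fderiv ℝ (fun y => a y * b y) x = a x • fderiv ℝ b x + b x • fderiv ℝ a x :=
    fderiv_mul ha hb
  simp only [partialD, this, FunLike.coe_add, FunLike.coe_smul, Pi.add_apply, Pi.smul_apply,
    smul_eq_mul]
  ring

lemma partialD_comm {a : R3 → ℝ} {x : R3} (ha : ContDiffAt ℝ 2 a x) (j k : Fin 3) :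
    partialD j (partialD k a) x = partialD k (partialD j a) x := by
  have hd : DifferentiableAt ℝ (fderiv ℝ a) x :=
    (ha.fderiv_right (m := 1) (by norm_num)).differentiableAt (by norm_num)
  have key : ∀ i l : Fin 3, MagneticDirac.partialD i (MagneticDirac.partialD l a) x
      = fderiv ℝ (fderiv ℝ a) x (EuclideanSpace.single i 1) (EuclideanSpace.single l 1) := by
    intro i l
    have : fderiv ℝ (fun y => fderiv ℝ a y (EuclideanSpace.single l (1 : ℝ))) x
        = (fderiv ℝ (fderiv ℝ a) x).flip (EuclideanSpace.single l 1) := by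
      rw [fderiv_clm_apply hd (differentiableAt_const _)]
      simp
    show fderiv ℝ (fun y => fderiv ℝ a y (EuclideanSpace.single l (1 : ℝ))) x _ = _
    rw [this]; rfl
  rw [key, key]
  exact (ha.isSymmSndFDerivAt (by simp)).eq _ _

lemma HasWeakPartial.smul_contDiff {j : Fin 3} {f g : R3 → F} (h : HasWeakPartial j f g)
    {a : R3 → ℝ} (ha : ContDiff ℝ ∞ a) :
    HasWeakPartial j (fun x => a x • f x) (fun x => partialD j a x • f x + a x • g x) := by
  have ca := ha.continuous
  have cd := (contDiff_partialD ha j).continuous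
  have l1 : LocallyIntegrable (fun x => a x • f x) := h.1.continuous_smul ca
  have l2 : LocallyIntegrable (fun x => partialD j a x • f x) := h.1.continuous_smul cd
  have l3 : LocallyIntegrable (fun x => a x • g x) := h.2.1.continuous_smul ca
  refine ⟨l1, l2.add l3, fun η hη => ?_⟩
  have e := h.2.2 _ (hη.mul_contDiff ha)
  have p : ∀ x, partialD j (fun y => η y * a y) x • f x
      = partialD j η x • (a x • f x) + η x • (partialD j a x • f x) := by
    intro x
    rw [partialD_mul j x (hη.1.differentiable (by simp) x) (ha.differentiable (by simp) x)]
    simp only [add_smul, mul_smul]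
  simp only [p, mul_smul] at e
  rw [integral_add (l1.integrable_smul_left_of_hasCompactSupport (hη.partialD_cont j)
      (hη.partialD_supp j))
    (l2.integrable_smul_left_of_hasCompactSupport hη.1.continuous hη.2)] at e
  simp only [smul_add]
  rw [integral_add (l2.integrable_smul_left_of_hasCompactSupport hη.1.continuous hη.2)
    (l3.integrable_smul_left_of_hasCompactSupport hη.1.continuous hη.2), neg_add, ← e]
  abel

lemma HasWeakPartial.clm [CompleteSpace F] [CompleteSpace G] {j : Fin 3} {f g : R3 → F}
    (h : HasWeakPartial j f g) (T : F →L[ℝ] G) :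
    HasWeakPartial j (fun x => T (f x)) (fun x => T (g x)) := by
  have hl : ∀ {f : R3 → F}, LocallyIntegrable f → LocallyIntegrable (fun x => T (f x)) := by
    intro f hf x
    obtain ⟨s, hs, hi⟩ := hf x
    exact ⟨s, hs, T.integrable_comp hi⟩
  refine ⟨hl h.1, hl h.2.1, fun η hη => ?_⟩
  have e := congrArg T (h.2.2 η hη)
  rw [map_neg, ← T.integral_comp_comm (h.1.integrable_smul_left_of_hasCompactSupport
      (hη.partialD_cont j) (hη.partialD_supp j)),
    ← T.integral_comp_comm (h.2.1.integrable_smul_left_of_hasCompactSupport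
      hη.1.continuous hη.2)] at e
  simpa only [map_smul] using e

/-- The `j`-th classical partial derivative of a vector valued function. -/
def dirDeriv (j : Fin 3) (f : R3 → F) (x : R3) : F :=
  fderiv ℝ f x (EuclideanSpace.single j (1 : ℝ))

lemma contDiff_dirDeriv {f : R3 → F} (hf : ContDiff ℝ ∞ f) (j : Fin 3) :
    ContDiff ℝ ∞ (dirDeriv j f) :=
  (hf.fderiv_right (by simp)).clm_apply contDiff_const

lemma hasCompactSupport_dirDeriv {f : R3 → F} (hf : HasCompactSupport f) (j : Fin 3) :
    HasCompactSupport (dirDeriv j f) :=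
  hf.fderiv_apply (𝕜 := ℝ) _

lemma hasWeakPartial_of_contDiff [CompleteSpace F] {f : R3 → F} (hf : ContDiff ℝ ∞ f)
    (j : Fin 3) : HasWeakPartial j f (dirDeriv j f) := by
  have cf := hf.continuous
  have cd := (contDiff_dirDeriv hf j).continuous
  refine ⟨cf.locallyIntegrable, cd.locallyIntegrable, fun η hη => ?_⟩
  have := integral_smul_fderiv_eq_neg_fderiv_smul_of_integrable (𝕜 := ℝ) (μ := volume)
    (f := η) (g := f) (v := EuclideanSpace.single j (1 : ℝ))
    (cf.locallyIntegrable.integrable_smul_left_of_hasCompactSupport (hη.partialD_cont j)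
      (hη.partialD_supp j))
    (cd.locallyIntegrable.integrable_smul_left_of_hasCompactSupport hη.1.continuous hη.2)
    (cf.locallyIntegrable.integrable_smul_left_of_hasCompactSupport hη.1.continuous hη.2)
    (fun x _ => hη.1.differentiable (by simp) x) (fun x _ => hf.differentiable (by simp) x)
  rw [eq_comm, neg_eq_iff_eq_neg]
  exact this

end Weak

/-! ### Mollification in `L²`. -/

section Mollify

variable {F : Type*} [NormedAddCommGroup F]

lemma eLpNorm_two_sq {α : Type*} [MeasurableSpace α] {μ : Measure α} (f : α → F) :
    eLpNorm f 2 μ ^ 2 = ∫⁻ x, ‖f x‖ₑ ^ 2 ∂μ := by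
  have := eLpNorm_nnreal_pow_eq_lintegral (μ := μ) (f := f) (p := 2) (by norm_num)
  simpa using this

lemma eLpNorm_two_le_iff {α : Type*} [MeasurableSpace α] {μ : Measure α} {f : α → F}
    {c : ℝ≥0∞} : eLpNorm f 2 μ ≤ c ↔ ∫⁻ x, ‖f x‖ₑ ^ 2 ∂μ ≤ c ^ 2 := by
  rw [← eLpNorm_two_sq, ENNReal.pow_le_pow_left_iff two_ne_zero]

lemma tendsto_eLpNorm_two_zero_iff {α ι : Type*} [MeasurableSpace α] {μ : Measure α}
    {l : Filter ι} {f : ι → α → F} :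
    Tendsto (fun n => eLpNorm (f n) 2 μ) l (𝓝 0) ↔
      Tendsto (fun n => ∫⁻ x, ‖f n x‖ₑ ^ 2 ∂μ) l (𝓝 0) := by
  simp only [← eLpNorm_two_sq]
  constructor
  · intro h
    simpa using ENNReal.Tendsto.pow (n := 2) h
  · intro h
    have := h.ennrpow_const (1 / 2 : ℝ)
    simp only [one_div] at this
    have h0 : (0 : ℝ≥0∞) ^ (2⁻¹ : ℝ) = 0 := by simp
    rw [h0] at this
    refine this.congr fun n => ?_
    rw [← ENNReal.rpow_natCast, ← ENNReal.rpow_mul]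
    norm_num

variable [NormedSpace ℝ F]

/-- Dominated convergence for bounded multipliers on `L²`. -/
lemma tendsto_eLpNorm_smul_zero {a : ℕ → R3 → ℝ} {f : R3 → F} (ha : ∀ n, Continuous (a n))
    (hf : MemLp f 2) {C : ℝ} (hC : ∀ n x, |a n x| ≤ C)
    (h0 : ∀ᵐ x, Tendsto (fun n => a n x) atTop (𝓝 0)) :
    Tendsto (fun n => eLpNorm (fun x => a n x • f x) 2 volume) atTop (𝓝 0) := by
  rw [tendsto_eLpNorm_two_zero_iff]
  have := tendsto_lintegral_of_dominated_convergence' (μ := (volume : Measure R3))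
    (F := fun n x => ‖a n x • f x‖ₑ ^ 2) (f := fun _ => 0)
    (fun x => ENNReal.ofReal C ^ 2 * ‖f x‖ₑ ^ 2)
    (fun n => (((ha n).aestronglyMeasurable.smul hf.1).enorm).pow_const 2)
    (fun n => .of_forall fun x => ?_) ?_ ?_
  · simpa using this
  · simp only [enorm_smul, mul_pow]
    gcongr
    rw [← ofReal_norm]
    exact ENNReal.ofReal_le_ofReal (hC n x)
  · rw [lintegral_const_mul'' _ (hf.1.enorm.pow_const 2), ← eLpNorm_two_sq]
    exact ENNReal.mul_ne_top (by simp) (ENNReal.pow_ne_top hf.2.ne)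
  · filter_upwards [h0] with x hx
    have h1 : Tendsto (fun n => a n x • f x) atTop (𝓝 0) := by simpa using hx.smul_const (f x)
    have h2 := (continuous_enorm.tendsto _).comp h1
    simpa using ENNReal.Tendsto.pow (n := 2) h2

/-- Convolution of a vector valued function with a real bump function. -/
def mollify (ρ : ContDiffBump (0 : R3)) (f : R3 → F) : R3 → F :=
  convolution (ρ.normed volume) f (ContinuousLinearMap.lsmul ℝ ℝ) volume

lemma mollify_eq (ρ : ContDiffBump (0 : R3)) (f : R3 → F) (x : R3) :
    mollify ρ f x = ∫ t, ρ.normed volume t • f (x - t) := convolution_lsmul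

lemma mollify_eq_swap (ρ : ContDiffBump (0 : R3)) (f : R3 → F) (x : R3) :
    mollify ρ f x = ∫ t, ρ.normed volume (x - t) • f t := convolution_lsmul_swap

lemma lintegral_normed (ρ : ContDiffBump (0 : R3)) :
    ∫⁻ t, ‖ρ.normed volume t‖ₑ = 1 := by
  have h := ofReal_integral_eq_lintegral_ofReal (μ := (volume : Measure R3))
    (ρ.integrable_normed) (.of_forall fun x => ρ.nonneg_normed x)
  rw [ρ.integral_normed, ENNReal.ofReal_one] at h
  rw [h]
  refine lintegral_congr fun x => ?_
  rw [Real.enorm_of_nonneg (ρ.nonneg_normed x)]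

/-- Young's inequality for a kernel of mass one. Splitting the kernel into two square roots and
applying Cauchy–Schwarz bounds the squared modulus of the average by the average of the squared
modulus; Tonelli and translation invariance finish. -/
lemma eLpNorm_mollify_le (ρ : ContDiffBump (0 : R3)) {f : R3 → F} (hf : StronglyMeasurable f) :
    eLpNorm (mollify ρ f) 2 volume ≤ eLpNorm f 2 volume := by
  set r : R3 → ℝ≥0∞ := fun t => ‖ρ.normed volume t‖ₑ with hr
  have hrm : Measurable r := ρ.continuous_normed.enorm.measurable
  have hr1 : ∫⁻ t, r t = 1 := lintegral_normed ρ
  have hfm : Measurable fun x => ‖f x‖ₑ := hf.enorm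
  rw [eLpNorm_two_le_iff, eLpNorm_two_sq]
  have pt : ∀ x, ‖mollify ρ f x‖ₑ ^ 2 ≤ ∫⁻ t, r t * ‖f (x - t)‖ₑ ^ 2 := by
    intro x
    have hm : Measurable fun t => ‖f (x - t)‖ₑ := hfm.comp (measurable_const.sub measurable_id)
    have h1 : ‖mollify ρ f x‖ₑ ≤ ∫⁻ t, r t ^ (1 / 2 : ℝ) * (r t ^ (1 / 2 : ℝ) * ‖f (x - t)‖ₑ) := by
      rw [mollify_eq]
      refine (enorm_integral_le_lintegral_enorm _).trans (lintegral_mono fun t => ?_)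
      rw [enorm_smul, ← mul_assoc, ← ENNReal.rpow_add_of_nonneg _ _ (by norm_num) (by norm_num)]
      norm_num
      exact le_rfl
    have h2 := ENNReal.lintegral_mul_le_Lp_mul_Lq volume Real.HolderConjugate.two_two
      (hrm.pow_const (1 / 2 : ℝ)).aemeasurable
      ((hrm.pow_const (1 / 2 : ℝ)).mul hm).aemeasurable
    have h3 := h1.trans h2
    have e1 : ∀ t, (r t ^ (1 / 2 : ℝ)) ^ (2 : ℝ) = r t := fun t => by
      rw [← ENNReal.rpow_mul]; norm_num
    have e2 : ∀ t, (r t ^ (1 / 2 : ℝ) * ‖f (x - t)‖ₑ) ^ (2 : ℝ) = r t * ‖f (x - t)‖ₑ ^ 2 := by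
      intro t
      rw [ENNReal.mul_rpow_of_nonneg _ _ (by norm_num), e1]
      norm_num
    simp only [e1, e2, hr1, Pi.mul_apply, ENNReal.one_rpow, one_mul] at h3
    refine (pow_le_pow_left' h3 2).trans_eq ?_
    rw [← ENNReal.rpow_natCast, ← ENNReal.rpow_mul]
    norm_num
  calc ∫⁻ x, ‖mollify ρ f x‖ₑ ^ 2 ≤ ∫⁻ x, ∫⁻ t, r t * ‖f (x - t)‖ₑ ^ 2 := lintegral_mono pt
    _ = ∫⁻ t, ∫⁻ x, r t * ‖f (x - t)‖ₑ ^ 2 := by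
        refine lintegral_lintegral_swap (Measurable.aemeasurable ?_)
        exact (hrm.comp measurable_snd).mul
          ((hfm.comp (measurable_fst.sub measurable_snd)).pow_const 2)
    _ = ∫⁻ t, r t * ∫⁻ x, ‖f x‖ₑ ^ 2 := by
        refine lintegral_congr fun t => ?_
        have hft : Measurable fun x => ‖f (x - t)‖ₑ ^ 2 :=
          (hfm.comp (measurable_id.sub_const t)).pow_const 2
        rw [lintegral_const_mul _ hft,
          lintegral_sub_right_eq_self (fun x => ‖f x‖ₑ ^ 2)]
    _ = ∫⁻ x, ‖f x‖ₑ ^ 2 := by rw [lintegral_mul_const _ hrm, hr1, one_mul]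

lemma contDiff_mollify (ρ : ContDiffBump (0 : R3)) {f : R3 → F} (hf : LocallyIntegrable f) :
    ContDiff ℝ ∞ (mollify ρ f) :=
  ρ.hasCompactSupport_normed.contDiff_convolution_left _ (ρ.contDiff_normed) hf

lemma hasCompactSupport_mollify (ρ : ContDiffBump (0 : R3)) {f : R3 → F}
    (hf : HasCompactSupport f) : HasCompactSupport (mollify ρ f) :=
  ρ.hasCompactSupport_normed.convolution _ hf

/-- The derivative falls on the kernel, and `t ↦ κ (x - t)` is itself a test function. The sign from
reflecting the variable cancels the sign in the definition of the weak derivative. -/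
lemma dirDeriv_mollify [CompleteSpace F] (ρ : ContDiffBump (0 : R3)) {j : Fin 3} {f g : R3 → F}
    (h : HasWeakPartial j f g) : dirDeriv j (mollify ρ f) = mollify ρ g := by
  ext x
  set κ : R3 → ℝ := ρ.normed volume with hκ
  have hκs : ContDiff ℝ ∞ κ := ρ.contDiff_normed
  have hκc : HasCompactSupport κ := ρ.hasCompactSupport_normed
  have hd := hκc.hasFDerivAt_convolution_left (ContinuousLinearMap.lsmul ℝ ℝ)
    (hκs.of_le (by simp)) h.1 x
  have hη : IsTest fun t => κ (x - t) := by
    refine ⟨hκs.comp (contDiff_const.sub contDiff_id), ?_⟩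
    exact hκc.comp_homeomorph (Homeomorph.subLeft x)
  have hpd : ∀ t, partialD j (fun t => κ (x - t)) t
      = - fderiv ℝ κ (x - t) (EuclideanSpace.single j (1 : ℝ)) := by
    intro t
    have : HasFDerivAt (fun t => κ (x - t))
        ((fderiv ℝ κ (x - t)).comp (-ContinuousLinearMap.id ℝ R3)) t :=
      (hκs.differentiable (by simp) (x - t)).hasFDerivAt.comp t
        ((hasFDerivAt_id t).const_sub x)
    rw [partialD, this.fderiv]
    simp
  show fderiv ℝ (mollify ρ f) x _ = _
  rw [mollify, hd.fderiv, mollify_eq_swap]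
  have hex := (hκc.fderiv (𝕜 := ℝ)).convolutionExists_left
    ((ContinuousLinearMap.lsmul ℝ ℝ).precompL R3) (hκs.continuous_fderiv (by simp)) h.1 x
  have e1 : (convolution (fderiv ℝ κ) f
        ((ContinuousLinearMap.lsmul ℝ ℝ : ℝ →L[ℝ] F →L[ℝ] F).precompL R3) volume x)
        (EuclideanSpace.single j (1 : ℝ))
      = ∫ t, fderiv ℝ κ t (EuclideanSpace.single j (1 : ℝ)) • f (x - t) := by
    rw [convolution, ContinuousLinearMap.integral_apply hex]
    rfl
  rw [e1, ← integral_sub_left_eq_self (fun t => fderiv ℝ κ t _ • f (x - t)) volume x]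
  have e2 := h.2.2 _ hη
  simp only [hpd, neg_smul, integral_neg, neg_inj] at e2
  simpa using e2

/-- Bump functions concentrating at the origin. -/
def bumpSeq (n : ℕ) : ContDiffBump (0 : R3) :=
  ⟨1 / (2 * ((n : ℝ) + 1)), 1 / ((n : ℝ) + 1), by positivity, by
    apply one_div_lt_one_div_of_lt <;> [positivity; nlinarith [(n.cast_nonneg : (0 : ℝ) ≤ n)]]⟩

/-- Uniform continuity gives uniform convergence, and all the mollifications are supported in one
compact neighbourhood of the support, so the convergence is also in `L²`. -/
lemma tendsto_mollify_of_contDiff [CompleteSpace F] {h : R3 → F} (hs : ContDiff ℝ ∞ h)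
    (hc : HasCompactSupport h) :
    Tendsto (fun n => eLpNorm (mollify (bumpSeq n) h - h) 2 volume) atTop (𝓝 0) := by
  have huc : UniformContinuous h := hc.uniformContinuous_of_continuous hs.continuous
  set K := Metric.cthickening 1 (tsupport h)
  have hKc : IsCompact K := hc.isCompact.cthickening
  have hK : volume K ≠ ⊤ := hKc.measure_lt_top.ne
  set c : ℝ≥0∞ := volume K ^ (1 / (2 : ℝ≥0∞).toReal)
  have hct : c ≠ ⊤ := ENNReal.rpow_ne_top_of_nonneg (by norm_num) hK
  have hsm : ∀ n x, h x ≠ 0 ∨ mollify (bumpSeq n) h x ≠ 0 → x ∈ K := by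
    intro n x hx
    rcases hx with hx | hx
    · exact Metric.self_subset_cthickening _ (subset_tsupport _ hx)
    · have h1 := support_convolution_subset (ContinuousLinearMap.lsmul ℝ ℝ) (μ := volume)
        (f := (bumpSeq n).normed volume) (g := h) hx
      obtain ⟨a, ha, b, hb, rfl⟩ := h1
      rw [ContDiffBump.support_normed_eq] at ha
      refine Metric.mem_cthickening_of_dist_le _ b _ _ (subset_tsupport _ hb) ?_
      have h2 : ‖a‖ < 1 / ((n : ℝ) + 1) := by simpa [bumpSeq] using ha
      have h3 : 1 / ((n : ℝ) + 1) ≤ 1 := by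
        rw [div_le_one (by positivity)]; linarith [(n.cast_nonneg : (0 : ℝ) ≤ n)]
      simpa [dist_eq_norm] using (h2.le.trans h3)
  rw [ENNReal.tendsto_nhds_zero]
  intro ε hε
  obtain ⟨δ, hδ, hδε⟩ : ∃ δ : ℝ, 0 < δ ∧ ENNReal.ofReal δ * c ≤ ε := by
    have ht : Tendsto (fun d : ℝ => ENNReal.ofReal d * c) (𝓝[>] 0) (𝓝 0) := by
      have : Tendsto (fun d : ℝ => ENNReal.ofReal d * c) (𝓝 0) (𝓝 (ENNReal.ofReal 0 * c)) :=
        ENNReal.Tendsto.mul_const (ENNReal.continuous_ofReal.tendsto 0) (Or.inr hct)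
      simp only [ENNReal.ofReal_zero, zero_mul] at this
      exact this.mono_left nhdsWithin_le_nhds
    obtain ⟨d, hd1, hd2⟩ := ((ENNReal.tendsto_nhds_zero.1 ht ε hε).and
      self_mem_nhdsWithin).exists
    exact ⟨d, hd2, hd1⟩
  obtain ⟨r, hr, hrδ⟩ := Metric.uniformContinuous_iff.1 huc δ hδ
  have hlim : Tendsto (fun n : ℕ => 1 / ((n : ℝ) + 1)) atTop (𝓝 0) :=
    tendsto_one_div_add_atTop_nhds_zero_nat
  filter_upwards [hlim.eventually (gt_mem_nhds hr)] with n hn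
  refine le_trans ?_ hδε
  refine eLpNorm_sub_le_of_dist_bdd volume (by norm_num) hKc.measurableSet hδ.le ?_
    (fun x hx => hsm n x (Or.inr hx)) (fun x hx => hsm n x (Or.inl hx))
  intro x
  refine ContDiffBump.dist_normed_convolution_le hs.continuous.aestronglyMeasurable ?_
  intro y hy
  exact (hrδ (lt_trans (by simpa [bumpSeq] using hy) hn)).le

/-- A three-epsilon argument: approximate by a smooth compactly supported function and use that
mollification does not increase the `L²` norm. -/
lemma tendsto_mollify [CompleteSpace F] {f : R3 → F} (hm : StronglyMeasurable f) (hf : MemLp f 2) :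
    Tendsto (fun n => eLpNorm (mollify (bumpSeq n) f - f) 2 volume) atTop (𝓝 0) := by
  rw [ENNReal.tendsto_nhds_zero]
  intro ε hε
  obtain ⟨δ, hδ, hδε⟩ : ∃ δ : ℝ, 0 < δ ∧ ENNReal.ofReal δ ≤ ε / 3 := by
    have h3 : 0 < ε / 3 := ENNReal.div_pos hε.ne' (by norm_num)
    have ht : Tendsto (fun d : ℝ => ENNReal.ofReal d) (𝓝[>] 0) (𝓝 0) := by
      have := ENNReal.continuous_ofReal.tendsto 0
      simp only [ENNReal.ofReal_zero] at this
      exact this.mono_left nhdsWithin_le_nhds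
    obtain ⟨d, hd1, hd2⟩ := ((ENNReal.tendsto_nhds_zero.1 ht _ h3).and
      self_mem_nhdsWithin).exists
    exact ⟨d, hd2, hd1⟩
  obtain ⟨h, hc, hs, hfh⟩ := hf.exist_eLpNorm_sub_le (by norm_num) (by norm_num) hδ
  have hfh' := hfh.trans hδε
  have h3 : 0 < ε / 3 := ENNReal.div_pos hε.ne' (by norm_num)
  filter_upwards [ENNReal.tendsto_nhds_zero.1 (tendsto_mollify_of_contDiff hs hc) _ h3] with n hn
  have hhm : StronglyMeasurable h := hs.continuous.stronglyMeasurable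
  have hlf : LocallyIntegrable f := hf.locallyIntegrable (by norm_num)
  have hlh : LocallyIntegrable h := hs.continuous.locallyIntegrable
  have hκ := (bumpSeq n).hasCompactSupport_normed (μ := (volume : Measure R3))
  have hκ' := (bumpSeq n).continuous_normed (μ := (volume : Measure R3))
  have hsub : mollify (bumpSeq n) (f - h) = mollify (bumpSeq n) f - mollify (bumpSeq n) h := by
    ext x
    have i1 := hκ.convolutionExists_left (ContinuousLinearMap.lsmul ℝ ℝ) hκ' hlf x
    have i2 := hκ.convolutionExists_left (ContinuousLinearMap.lsmul ℝ ℝ) hκ' hlh x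
    simp only [Pi.sub_apply, mollify_eq, smul_sub]
    exact integral_sub i1 i2
  have cm : ∀ {k : R3 → F}, LocallyIntegrable k →
      AEStronglyMeasurable (mollify (bumpSeq n) k) volume := fun hk =>
    (contDiff_mollify _ hk).continuous.aestronglyMeasurable
  have dec : mollify (bumpSeq n) f - f
      = mollify (bumpSeq n) (f - h) + ((mollify (bumpSeq n) h - h) + (h - f)) := by
    rw [hsub]; abel
  rw [dec]
  have b1 : eLpNorm (mollify (bumpSeq n) (f - h)) 2 volume ≤ ε / 3 :=
    (eLpNorm_mollify_le _ (hm.sub hhm)).trans hfh'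
  have b3 : eLpNorm (h - f) 2 volume ≤ ε / 3 := by rw [eLpNorm_sub_comm]; exact hfh'
  have mh := cm hlh
  refine (eLpNorm_add_le (cm (hlf.sub hlh)) ((mh.sub hhm.aestronglyMeasurable).add
    (hhm.sub hm).aestronglyMeasurable) (by norm_num)).trans ?_
  refine (add_le_add b1 ((eLpNorm_add_le (mh.sub hhm.aestronglyMeasurable)
    (hhm.sub hm).aestronglyMeasurable (by norm_num)).trans (add_le_add hn b3))).trans_eq ?_
  rw [← add_assoc, ENNReal.add_thirds]

end Mollify

/-! ### Dilated cutoffs. -/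

/-- A fixed smooth cutoff, equal to `1` on the unit ball, supported in the ball of radius `2`. -/
def cutoffBump : ContDiffBump (0 : R3) := ⟨1, 2, one_pos, one_lt_two⟩

/-- The rescaled cutoff `θ(r x)`. -/
def cutoff (r : ℝ) (x : R3) : ℝ := cutoffBump (r • x)

lemma contDiff_cutoff (r : ℝ) : ContDiff ℝ ∞ (cutoff r) :=
  (cutoffBump.contDiff).comp (contDiff_const_smul r)

lemma cutoff_eq_one {r : ℝ} {x : R3} (h : |r| * ‖x‖ ≤ 1) : cutoff r x = 1 := by
  refine cutoffBump.one_of_mem_closedBall ?_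
  simpa [norm_smul, cutoffBump] using h

lemma cutoff_eq_zero {r : ℝ} {x : R3} (h : 2 ≤ |r| * ‖x‖) : cutoff r x = 0 := by
  refine cutoffBump.zero_of_le_dist ?_
  simpa [norm_smul, cutoffBump] using h

lemma cutoff_nonneg (r : ℝ) (x : R3) : 0 ≤ cutoff r x := cutoffBump.nonneg

lemma cutoff_le_one (r : ℝ) (x : R3) : cutoff r x ≤ 1 := cutoffBump.le_one

lemma hasCompactSupport_cutoff {r : ℝ} (hr : r ≠ 0) : HasCompactSupport (cutoff r) :=
  cutoffBump.hasCompactSupport.comp_homeomorph (Homeomorph.smulOfNeZero r hr)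

lemma isTest_cutoff {r : ℝ} (hr : r ≠ 0) : IsTest (cutoff r) :=
  ⟨contDiff_cutoff r, hasCompactSupport_cutoff hr⟩

lemma partialD_cutoff (j : Fin 3) (r : ℝ) (x : R3) :
    partialD j (cutoff r) x = r * partialD j cutoffBump (r • x) := by
  have h : HasFDerivAt (cutoff r) ((fderiv ℝ cutoffBump (r • x)).comp
      (r • ContinuousLinearMap.id ℝ R3)) x :=
    ((cutoffBump.contDiff (n := 1)).differentiable (by simp) (r • x)).hasFDerivAt.comp x
      ((hasFDerivAt_id x).const_smul r)
  rw [partialD, h.fderiv]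
  simp [partialD]

lemma isTest_cutoffBump : IsTest cutoffBump := ⟨cutoffBump.contDiff, cutoffBump.hasCompactSupport⟩

lemma exists_partialD_cutoffBump_bound : ∃ C : ℝ, ∀ j x, |partialD j cutoffBump x| ≤ C := by
  have : ∀ j, ∃ C : ℝ, ∀ x, |partialD j cutoffBump x| ≤ C := fun j =>
    (isTest_cutoffBump.partialD_supp j).exists_bound_of_continuous
      (isTest_cutoffBump.partialD_cont j)
  choose C hC using this
  exact ⟨∑ j, |C j|, fun j x => ((hC j x).trans (le_abs_self _)).trans
    (Finset.single_le_sum (f := fun j => |C j|) (fun _ _ => abs_nonneg _) (Finset.mem_univ j))⟩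

/-! ### Density of smooth functions in `H¹`. -/

section Density

variable {F : Type*} [NormedAddCommGroup F] [NormedSpace ℝ F] [CompleteSpace F]

/-- Smooth compactly supported functions are dense in `H¹`. -/
lemma exists_contDiff_approx {f : R3 → F} {g : Fin 3 → R3 → F} (hfm : StronglyMeasurable f)
    (hf : MemLp f 2) (hgm : ∀ j, StronglyMeasurable (g j)) (hg : ∀ j, MemLp (g j) 2)
    (h : ∀ j, HasWeakPartial j f (g j)) {ε : ℝ≥0∞} (hε : 0 < ε) :
    ∃ χ : R3 → F, ContDiff ℝ ∞ χ ∧ HasCompactSupport χ ∧ eLpNorm (χ - f) 2 volume ≤ ε ∧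
      ∀ j, eLpNorm (dirDeriv j χ - g j) 2 volume ≤ ε := by
  have hε2 : 0 < ε / 2 := ENNReal.half_pos hε.ne'
  have hε4 : 0 < ε / 2 / 2 := ENNReal.half_pos hε2.ne'
  obtain ⟨C, hC⟩ := exists_partialD_cutoffBump_bound
  set r : ℕ → ℝ := fun n => 1 / ((n : ℝ) + 1)
  have hr0 : ∀ n, 0 < r n := fun n => by positivity
  have hr1 : ∀ n, r n ≤ 1 := fun n => by
    rw [div_le_one (by positivity)]; linarith [(n.cast_nonneg : (0 : ℝ) ≤ n)]
  have hrlim : Tendsto r atTop (𝓝 0) := tendsto_one_div_add_atTop_nhds_zero_nat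
  have hone : ∀ x : R3, ∀ᶠ n in atTop, cutoff (r n) x = 1 := by
    intro x
    have : Tendsto (fun n => |r n| * ‖x‖) atTop (𝓝 0) := by simpa using hrlim.abs.mul_const ‖x‖
    filter_upwards [this.eventually (gt_mem_nhds one_pos)] with n hn
    exact cutoff_eq_one hn.le
  have hC0 : 0 ≤ C := (abs_nonneg _).trans (hC 0 0)
  have bd : ∀ n j x, |partialD j (cutoff (r n)) x| ≤ r n * C := fun n j x => by
    rw [partialD_cutoff, abs_mul, abs_of_pos (hr0 n)]
    exact mul_le_mul_of_nonneg_left (hC _ _) (hr0 n).le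
  have c1 : ∀ {k : R3 → F}, MemLp k 2 →
      Tendsto (fun n => eLpNorm (fun x => (cutoff (r n) x - 1) • k x) 2 volume) atTop (𝓝 0) := by
    intro k hk
    refine tendsto_eLpNorm_smul_zero (fun n => (contDiff_cutoff _).continuous.sub continuous_const)
      hk (C := 1) (fun n x => ?_) (.of_forall fun x => ?_)
    · rw [abs_le]; constructor <;> linarith [cutoff_nonneg (r n) x, cutoff_le_one (r n) x]
    · refine tendsto_const_nhds.congr' ?_
      filter_upwards [hone x] with n hn
      rw [hn, sub_self]
  have c2 : ∀ j, Tendsto (fun n => eLpNorm (fun x => partialD j (cutoff (r n)) x • f x) 2 volume)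
      atTop (𝓝 0) := by
    intro j
    refine tendsto_eLpNorm_smul_zero
      (fun n => ((isTest_cutoff (hr0 n).ne').partialD_cont j)) hf (C := C)
      (fun n x => (bd n j x).trans (mul_le_of_le_one_left hC0 (hr1 n))) (.of_forall fun x => ?_)
    refine squeeze_zero_norm (fun n => bd n j x) ?_
    simpa using hrlim.mul_const C
  -- Truncation may cost `ε/2` and mollification the other `ε/2`. The derivative of the truncated
  -- function has two error terms, from the cutoff and from its gradient, hence `ε/4` for each.
  obtain ⟨n, hn1, hn2, hn3⟩ := ((ENNReal.tendsto_nhds_zero.1 (c1 hf) _ hε2).and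
    ((eventually_all.2 fun j => ENNReal.tendsto_nhds_zero.1 (c2 j) _ hε4).and
    (eventually_all.2 fun j => ENNReal.tendsto_nhds_zero.1 (c1 (hg j)) _ hε4))).exists
  set θ := cutoff (r n)
  have hθ : IsTest θ := isTest_cutoff (hr0 n).ne'
  have hθm : StronglyMeasurable θ := hθ.1.continuous.stronglyMeasurable
  set f' : R3 → F := fun x => θ x • f x with hf'
  set g' : Fin 3 → R3 → F := fun j x => partialD j θ x • f x + θ x • g j x with hg'
  have hw : ∀ j, HasWeakPartial j f' (g' j) := fun j => (h j).smul_contDiff hθ.1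
  have sf' : StronglyMeasurable f' := hθm.smul hfm
  have s2 : ∀ j, StronglyMeasurable fun x => partialD j θ x • f x := fun j =>
    ((hθ.partialD_cont j).stronglyMeasurable).smul hfm
  have s3 : ∀ j, StronglyMeasurable fun x => (θ x - 1) • g j x := fun j =>
    (hθm.sub stronglyMeasurable_const).smul (hgm j)
  have sg' : ∀ j, StronglyMeasurable (g' j) := fun j => (s2 j).add (hθm.smul (hgm j))
  have d1 : eLpNorm (f' - f) 2 volume ≤ ε / 2 := by
    convert hn1 using 2
    ext x; simp [hf', sub_smul]
  have d2 : ∀ j, eLpNorm (g' j - g j) 2 volume ≤ ε / 2 := fun j => by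
    have e : g' j - g j = (fun x => partialD j θ x • f x) + fun x => (θ x - 1) • g j x := by
      ext x; simp [hg', sub_smul]; abel
    rw [e, ← ENNReal.add_halves (ε / 2)]
    exact (eLpNorm_add_le (s2 j).aestronglyMeasurable (s3 j).aestronglyMeasurable
      (by norm_num)).trans (add_le_add (hn2 j) (hn3 j))
  have mf' : MemLp f' 2 := by
    have : f' = (f' - f) + f := by abel
    rw [this]
    refine MemLp.add ⟨(sf'.sub hfm).aestronglyMeasurable, ?_⟩ hf
    have hn1' : eLpNorm (f' - f) 2 volume ≤ eLpNorm f 2 volume := by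
      refine eLpNorm_mono fun x => ?_
      have : (f' - f) x = (θ x - 1) • f x := by simp [hf', sub_smul]
      rw [this, norm_smul]
      refine mul_le_of_le_one_left (norm_nonneg _) ?_
      rw [Real.norm_eq_abs, abs_le]
      constructor <;> linarith [cutoff_nonneg (r n) x, cutoff_le_one (r n) x]
    exact hn1'.trans_lt hf.2
  have mg' : ∀ j, MemLp (g' j) 2 := fun j => by
    have b1 : MemLp (fun x => partialD j θ x • f x) 2 := by
      refine MemLp.of_le_mul (c := C) hf (s2 j).aestronglyMeasurable (.of_forall fun x => ?_)
      rw [norm_smul]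
      exact mul_le_mul_of_nonneg_right
        ((bd n j x).trans (mul_le_of_le_one_left hC0 (hr1 n))) (norm_nonneg _)
    have b2 : MemLp (fun x => θ x • g j x) 2 := by
      refine MemLp.of_le_mul (c := 1) (hg j) (hθm.smul (hgm j)).aestronglyMeasurable
        (.of_forall fun x => ?_)
      rw [norm_smul]
      refine mul_le_mul_of_nonneg_right ?_ (norm_nonneg _)
      rw [Real.norm_eq_abs, abs_le]
      constructor <;> linarith [cutoff_nonneg (r n) x, cutoff_le_one (r n) x]
    exact b1.add b2
  obtain ⟨m, hm1, hm2⟩ := ((ENNReal.tendsto_nhds_zero.1 (tendsto_mollify sf' mf') _ hε2).and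
    (eventually_all.2 fun j =>
      ENNReal.tendsto_nhds_zero.1 (tendsto_mollify (sg' j) (mg' j)) _ hε2)).exists
  have lf' : LocallyIntegrable f' := (hw 0).1
  have fin : ∀ {k k' : R3 → F}, StronglyMeasurable k → StronglyMeasurable k' →
      LocallyIntegrable k' →
      eLpNorm (mollify (bumpSeq m) k' - k') 2 volume ≤ ε / 2 →
      eLpNorm (k' - k) 2 volume ≤ ε / 2 → eLpNorm (mollify (bumpSeq m) k' - k) 2 volume ≤ ε := by
    intro k k' hk hk' hl e1 e2
    have e : mollify (bumpSeq m) k' - k = (mollify (bumpSeq m) k' - k') + (k' - k) := by abel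
    rw [e, ← ENNReal.add_halves ε]
    exact (eLpNorm_add_le ((contDiff_mollify _ hl).continuous.aestronglyMeasurable.sub
      hk'.aestronglyMeasurable) (hk'.sub hk).aestronglyMeasurable (by norm_num)).trans
      (add_le_add e1 e2)
  refine ⟨mollify (bumpSeq m) f', contDiff_mollify _ lf', hasCompactSupport_mollify _
    hθ.2.smul_right, fin hfm sf' lf' hm1 d1, fun j => ?_⟩
  rw [dirDeriv_mollify _ (hw j)]
  exact fin (hgm j) (sg' j) (hw j).2.1 (hm2 j) (d2 j)

end Density

/-! ### Convergence in `H¹` -/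

lemma mem_H1 {ψ : L2} {g : Fin 3 → R3 → Spinor} (hg : ∀ j, MemLp (g j) 2)
    (h : ∀ j, HasWeakPartial j (ψ : R3 → Spinor) (g j)) : ψ ∈ H1 := fun j =>
  ⟨(hg j).toLp, (h j).congr (ae_eq_refl _) (hg j).coeFn_toLp.symm⟩

lemma weakPartial_ae {ψ : L2} (hψ : ψ ∈ H1) {j : Fin 3} {g : R3 → Spinor}
    (h : HasWeakPartial j (ψ : R3 → Spinor) g) : weakPartial j ψ =ᵐ[volume] g :=
  (weakPartial_spec j hψ).unique h

/-- The class of a smooth compactly supported spinor. -/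
def IsSmooth (ψ : L2) : Prop :=
  ∃ χ : R3 → Spinor, ContDiff ℝ ∞ χ ∧ HasCompactSupport χ ∧ ψ =ᵐ[volume] χ

lemma hasWeakPartial_smooth {ψ : L2} {χ : R3 → Spinor} (hχ : ContDiff ℝ ∞ χ)
    (h : ψ =ᵐ[volume] χ) (j : Fin 3) : HasWeakPartial j (ψ : R3 → Spinor) (dirDeriv j χ) :=
  (hasWeakPartial_of_contDiff hχ j).congr h.symm (ae_eq_refl _)

lemma memLp_of_smooth {χ : R3 → Spinor} (hχ : ContDiff ℝ ∞ χ) (hc : HasCompactSupport χ) :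
    MemLp χ 2 := hχ.continuous.memLp_of_hasCompactSupport hc

lemma IsSmooth.mem_H1 {ψ : L2} (h : IsSmooth ψ) : ψ ∈ H1 := by
  obtain ⟨χ, h1, h2, h3⟩ := h
  exact MagneticDirac.mem_H1 (fun j => memLp_of_smooth (contDiff_dirDeriv h1 j)
    (hasCompactSupport_dirDeriv h2 j)) (hasWeakPartial_smooth h1 h3)

/-- Convergence of sequences in `H¹`. -/
structure H1Tendsto (c : ℕ → L2) (ψ : L2) : Prop where
  mem : ∀ n, c n ∈ H1
  lim_mem : ψ ∈ H1
  tendsto : Tendsto c atTop (𝓝 ψ)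
  tendsto_partial : ∀ j, Tendsto (fun n => weakPartial j (c n)) atTop (𝓝 (weakPartial j ψ))

theorem exists_smooth_tendsto {ψ : L2} (hψ : ψ ∈ H1) :
    ∃ c : ℕ → L2, (∀ n, IsSmooth (c n)) ∧ H1Tendsto c ψ := by
  have key := fun n : ℕ => exists_contDiff_approx (Lp.stronglyMeasurable ψ) (Lp.memLp ψ)
    (fun j => Lp.stronglyMeasurable (weakPartial j ψ)) (fun j => Lp.memLp (weakPartial j ψ))
    (fun j => weakPartial_spec j hψ) (ε := ((n : ℝ≥0∞) + 1)⁻¹) (by simp)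
  choose χ hs hc h1 h2 using key
  set c : ℕ → L2 := fun n => (memLp_of_smooth (hs n) (hc n)).toLp
  have hcn : ∀ n, c n =ᵐ[volume] χ n := fun n => MemLp.coeFn_toLp _
  have hsm : ∀ n, IsSmooth (c n) := fun n => ⟨χ n, hs n, hc n, hcn n⟩
  have hlim : Tendsto (fun n : ℕ => ((n : ℝ≥0∞) + 1)⁻¹) atTop (𝓝 0) := by
    have := (tendsto_add_atTop_iff_nat 1).2 ENNReal.tendsto_inv_nat_nhds_zero
    simpa using this
  refine ⟨c, hsm, fun n => (hsm n).mem_H1, hψ, ?_, fun j => ?_⟩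
  · rw [Lp.tendsto_Lp_iff_tendsto_eLpNorm']
    refine tendsto_of_tendsto_of_tendsto_of_le_of_le tendsto_const_nhds hlim
      (fun _ => zero_le) fun n => ?_
    exact (eLpNorm_congr_ae ((hcn n).sub (ae_eq_refl _))).trans_le (h1 n)
  · rw [Lp.tendsto_Lp_iff_tendsto_eLpNorm']
    refine tendsto_of_tendsto_of_tendsto_of_le_of_le tendsto_const_nhds hlim
      (fun _ => zero_le) fun n => ?_
    exact (eLpNorm_congr_ae ((weakPartial_ae (hsm n).mem_H1
      (hasWeakPartial_smooth (hs n) (hcn n) j)).sub (ae_eq_refl _))).trans_le (h2 n j)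

lemma tendsto_integral_smul {c : ℕ → L2} {ψ : L2} (h : Tendsto c atTop (𝓝 ψ)) {η : R3 → ℝ}
    (hη : Continuous η) (hc : HasCompactSupport η) :
    Tendsto (fun n => ∫ x, η x • c n x) atTop (𝓝 (∫ x, η x • ψ x)) := by
  refine tendsto_integral_of_L1 (fun x => η x • ψ x)
    (((L2.locInt ψ).integrable_smul_left_of_hasCompactSupport hη hc).aestronglyMeasurable)
    (.of_forall fun n => (L2.locInt (c n)).integrable_smul_left_of_hasCompactSupport hη hc) ?_
  have hη2 : MemLp η 2 := hη.memLp_of_hasCompactSupport hc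
  rw [Lp.tendsto_Lp_iff_tendsto_eLpNorm'] at h
  have hm : Tendsto (fun n => eLpNorm η 2 volume * eLpNorm (⇑(c n) - ⇑ψ) 2 volume) atTop (𝓝 0) := by
    simpa using ENNReal.Tendsto.const_mul h (Or.inr hη2.2.ne)
  refine tendsto_of_tendsto_of_tendsto_of_le_of_le tendsto_const_nhds hm
    (fun _ => zero_le) fun n => ?_
  have := eLpNorm_smul_le_mul_eLpNorm (p := 2) (q := 2) (r := 1) (μ := (volume : Measure R3))
    ((Lp.aestronglyMeasurable (c n)).sub (Lp.aestronglyMeasurable ψ)) hη.aestronglyMeasurable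
  rw [eLpNorm_one_eq_lintegral_enorm] at this
  simpa [smul_sub] using this

/-- For a fixed test function both sides of the defining identity are `L²`-continuous, so the weak
derivative is a closed operator. -/
lemma hasWeakPartial_of_tendsto {j : Fin 3} {c d : ℕ → L2} {ψ g : L2}
    (hc : Tendsto c atTop (𝓝 ψ)) (hd : Tendsto d atTop (𝓝 g))
    (h : ∀ n, HasWeakPartial j (c n : R3 → Spinor) (d n)) :
    HasWeakPartial j (ψ : R3 → Spinor) g := by
  refine ⟨L2.locInt ψ, L2.locInt g, fun η hη => ?_⟩
  have h1 := tendsto_integral_smul hc (hη.partialD_cont j) (hη.partialD_supp j)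
  have h2 := (tendsto_integral_smul hd hη.1.continuous hη.2).neg
  refine tendsto_nhds_unique h1 (h2.congr fun n => ?_)
  exact ((h n).2.2 η hη).symm

/-! ### Multiplication operators -/

open Classical in
/-- Multiplication of `ψ ∈ L²` by a real function, when the product is square integrable. -/
def mulL (a : R3 → ℝ) (ψ : L2) : L2 :=
  if h : MemLp (fun x => a x • ψ x) 2 volume then h.toLp else 0

lemma mulL_coe {a : R3 → ℝ} {ψ : L2} (h : MemLp (fun x => a x • ψ x) 2 volume) :
    mulL a ψ =ᵐ[volume] fun x => a x • ψ x := by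
  rw [mulL, dif_pos h]
  exact h.coeFn_toLp

lemma mulL_add {a : R3 → ℝ} {ψ χ : L2} (h : MemLp (fun x => a x • ψ x) 2 volume)
    (h' : MemLp (fun x => a x • χ x) 2 volume) : mulL a (ψ + χ) = mulL a ψ + mulL a χ := by
  have e : (fun x => a x • (ψ + χ : L2) x) =ᵐ[volume] fun x => a x • ψ x + a x • χ x := by
    filter_upwards [Lp.coeFn_add ψ χ] with x hx
    rw [hx, Pi.add_apply, smul_add]
  refine Lp.ext ?_
  filter_upwards [mulL_coe ((h.add h').ae_eq e.symm), mulL_coe h, mulL_coe h', e,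
    Lp.coeFn_add (mulL a ψ) (mulL a χ)] with x h1 h2 h3 h4 h5
  rw [h1, h4, h5, Pi.add_apply, h2, h3]

lemma mulL_smul {a : R3 → ℝ} (c : ℂ) {ψ : L2} (h : MemLp (fun x => a x • ψ x) 2 volume) :
    mulL a (c • ψ) = c • mulL a ψ := by
  have e : (fun x => a x • (c • ψ : L2) x) =ᵐ[volume] fun x => c • (a x • ψ x) := by
    filter_upwards [Lp.coeFn_smul c ψ] with x hx
    rw [hx, Pi.smul_apply, smul_comm]
  refine Lp.ext ?_
  filter_upwards [mulL_coe ((h.const_smul c).ae_eq e.symm), mulL_coe h, e,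
    Lp.coeFn_smul c (mulL a ψ)] with x h1 h2 h3 h4
  rw [h1, h3, h4, Pi.smul_apply, h2]

/-- The graph of the gradient on `H¹`. -/
def gradGraph : Submodule ℂ (L2 × (Fin 3 → L2)) where
  carrier := {p | p.1 ∈ H1 ∧ ∀ j, p.2 j = weakPartial j p.1}
  add_mem' {p q} hp hq := ⟨H1.add_mem hp.1 hq.1, fun j => by
    rw [Prod.snd_add, Pi.add_apply, hp.2, hq.2, Prod.fst_add, weakPartial_add j hp.1 hq.1]⟩
  zero_mem' := ⟨H1.zero_mem, fun j => by
    have := weakPartial_smul j 0 (a := 0) H1.zero_mem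
    simp only [zero_smul] at this
    simp [this]⟩
  smul_mem' c p hp := ⟨H1.smul_mem c hp.1, fun j => by
    rw [Prod.smul_snd, Pi.smul_apply, hp.2, Prod.smul_fst, weakPartial_smul j c hp.1]⟩

/-- Closedness makes the graph, a stand-in for `H¹` with its graph norm, a Banach space, as the
closed graph theorem requires. -/
lemma isClosed_gradGraph : IsClosed (gradGraph : Set (L2 × (Fin 3 → L2))) := by
  refine IsSeqClosed.isClosed fun p q hp hq => ?_
  have h1 : Tendsto (fun n => (p n).1) atTop (𝓝 q.1) := (continuous_fst.tendsto _).comp hq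
  have h2 : ∀ j, Tendsto (fun n => (p n).2 j) atTop (𝓝 (q.2 j)) := fun j =>
    (((continuous_apply j).comp continuous_snd).tendsto _).comp hq
  have h3 : ∀ j, HasWeakPartial j (q.1 : R3 → Spinor) (q.2 j) := fun j =>
    hasWeakPartial_of_tendsto h1 (h2 j) fun n => by
      rw [(hp n).2 j]; exact weakPartial_spec j (hp n).1
  have hq1 : q.1 ∈ H1 := fun j => ⟨q.2 j, h3 j⟩
  exact ⟨hq1, fun j => Lp.ext (weakPartial_ae hq1 (h3 j)).symm⟩

instance : CompleteSpace gradGraph := isClosed_gradGraph.completeSpace_coe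

/-- Multiplication by a real function mapping `H¹` into `L²`, as a linear map. -/
def mulGraph (a : R3 → ℝ) (ha : ∀ ψ ∈ H1, MemLp (fun x => a x • (ψ : L2) x) 2 volume) :
    gradGraph →ₗ[ℂ] L2 where
  toFun p := mulL a p.1.1
  map_add' p q := mulL_add (ha _ p.2.1) (ha _ q.2.1)
  map_smul' z p := mulL_smul z (ha _ p.2.1)

/-- Multiplication by a fixed function is closed: along a common subsequence both limits hold almost
everywhere, where the multiplier is just a number. -/
lemma mulL_eq_of_tendsto {a : R3 → ℝ} {c : ℕ → L2} {ψ y : L2}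
    (hc : ∀ n, MemLp (fun x => a x • c n x) 2 volume)
    (hψ : MemLp (fun x => a x • ψ x) 2 volume) (h : Tendsto c atTop (𝓝 ψ))
    (hy : Tendsto (fun n => mulL a (c n)) atTop (𝓝 y)) : y = mulL a ψ := by
  obtain ⟨ns, hns, hae⟩ := (tendstoInMeasure_of_tendsto_Lp h).exists_seq_tendsto_ae
  have hy' : Tendsto (fun n => mulL a (c (ns n))) atTop (𝓝 y) := hy.comp hns.tendsto_atTop
  obtain ⟨ms, hms, hae'⟩ := (tendstoInMeasure_of_tendsto_Lp hy').exists_seq_tendsto_ae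
  refine Lp.ext ?_
  filter_upwards [hae, hae', ae_all_iff.2 fun n => mulL_coe (hc n), mulL_coe hψ]
    with z h1 h2 h3 h4
  rw [h4]
  refine tendsto_nhds_unique h2 ?_
  have h5 := ((h1.comp hms.tendsto_atTop).const_smul (a z))
  exact h5.congr fun i => (h3 (ns (ms i))).symm

/-- Closed graph theorem. Mapping `H¹` into `L²` is a purely qualitative assumption, yet it is
enough to pass to limits in every identity involving `A` or `F`. -/
lemma continuous_mulGraph (a : R3 → ℝ)
    (ha : ∀ ψ ∈ H1, MemLp (fun x => a x • (ψ : L2) x) 2 volume) : Continuous (mulGraph a ha) := by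
  refine (mulGraph a ha).continuous_of_seq_closed_graph fun u x y hu hTu => ?_
  exact mulL_eq_of_tendsto (fun n => ha _ (u n).2.1) (ha _ x.2.1)
    (((continuous_fst.comp continuous_subtype_val).tendsto _).comp hu) hTu

lemma mulGraph_apply (a : R3 → ℝ)
    (ha : ∀ ψ ∈ H1, MemLp (fun x => a x • (ψ : L2) x) 2 volume) (p : gradGraph) :
    mulGraph a ha p = mulL a p.1.1 := rfl

lemma H1Tendsto.tendsto_gradGraph {c : ℕ → L2} {ψ : L2} (h : H1Tendsto c ψ) :
    ∃ (P : ℕ → gradGraph) (Q : gradGraph), Tendsto P atTop (𝓝 Q) ∧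
      (∀ n, (P n).1.1 = c n) ∧ Q.1.1 = ψ := by
  refine ⟨fun n => ⟨(c n, fun j => weakPartial j (c n)), h.mem n, fun _ => rfl⟩,
    ⟨(ψ, fun j => weakPartial j ψ), h.lim_mem, fun _ => rfl⟩, ?_, fun _ => rfl, rfl⟩
  rw [tendsto_subtype_rng]
  exact h.tendsto.prodMk_nhds (tendsto_pi_nhds.2 h.tendsto_partial)

/-- A real function mapping `H¹` into `L²` does so continuously. -/
theorem H1Tendsto.mulL {a : R3 → ℝ} (ha : ∀ ψ ∈ H1, MemLp (fun x => a x • (ψ : L2) x) 2 volume)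
    {c : ℕ → L2} {ψ : L2} (h : H1Tendsto c ψ) :
    Tendsto (fun n => MagneticDirac.mulL a (c n)) atTop (𝓝 (MagneticDirac.mulL a ψ)) := by
  obtain ⟨P, Q, hPQ, hP, hQ⟩ := h.tendsto_gradGraph
  have := ((continuous_mulGraph a ha).tendsto Q).comp hPQ
  simp only [Function.comp_def, mulGraph_apply, hP, hQ] at this
  exact this

/-! ### Constant matrices acting on `L²` -/

lemma act_mul (M N : Mat4) (u : Spinor) : act (M * N) u = act M (act N u) := by
  simp [act, map_mul]

lemma act_one (u : Spinor) : act 1 u = u := by simp [act]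

lemma act_add (M N : Mat4) (u : Spinor) : act (M + N) u = act M u + act N u := by
  simp [act, map_add]

lemma act_smul (c : ℂ) (M : Mat4) (u : Spinor) : act (c • M) u = c • act M u := by
  simp [act, map_smul]

lemma act_neg (M : Mat4) (u : Spinor) : act (-M) u = -act M u := by
  simp [act, map_neg]

lemma act_sub (M N : Mat4) (u : Spinor) : act (M - N) u = act M u - act N u := by
  simp [act, map_sub]

lemma act_zero (u : Spinor) : act 0 u = 0 := by simp [act]

lemma act_sum {ι : Type*} (s : Finset ι) (M : ι → Mat4) (u : Spinor) :
    act (∑ i ∈ s, M i) u = ∑ i ∈ s, act (M i) u := by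
  simp [act, map_sum]

lemma inner_act_left (M : Mat4) (u v : Spinor) :
    ⟪act M u, v⟫_ℂ = ⟪u, act M.conjTranspose v⟫_ℂ := by
  have : act M.conjTranspose = ContinuousLinearMap.adjoint (act M) := by
    rw [act, act, ← Matrix.star_eq_conjTranspose, map_star]
    rfl
  rw [this, ContinuousLinearMap.adjoint_inner_right]

/-- A constant matrix acting on `L²`. -/
def actL (M : Mat4) : L2 →L[ℂ] L2 := (act M).compLpL 2 volume

lemma actL_coe (M : Mat4) (u : L2) : actL M u =ᵐ[volume] fun x => act M (u x) :=
  (act M).coeFn_compLpL u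

lemma actL_mul (M N : Mat4) (u : L2) : actL (M * N) u = actL M (actL N u) := by
  refine Lp.ext ?_
  filter_upwards [actL_coe (M * N) u, actL_coe M (actL N u), actL_coe N u] with x h1 h2 h3
  rw [h1, h2, h3, act_mul]

lemma actL_one (u : L2) : actL 1 u = u := by
  refine Lp.ext ?_
  filter_upwards [actL_coe 1 u] with x h1
  rw [h1, act_one]

lemma actL_neg (M : Mat4) (u : L2) : actL (-M) u = -actL M u := by
  refine Lp.ext ?_
  filter_upwards [actL_coe (-M) u, actL_coe M u, Lp.coeFn_neg (actL M u)] with x h1 h2 h3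
  rw [h1, h3, Pi.neg_apply, h2, act_neg]

lemma inner_actL_left (M : Mat4) (u v : L2) :
    ⟪actL M u, v⟫_ℂ = ⟪u, actL M.conjTranspose v⟫_ℂ := by
  rw [L2.inner_def, L2.inner_def]
  refine integral_congr_ae ?_
  filter_upwards [actL_coe M u, actL_coe M.conjTranspose v] with x h1 h2
  rw [h1, h2, inner_act_left]

lemma actL_mem_H1 (M : Mat4) {ψ : L2} (h : ψ ∈ H1) : actL M ψ ∈ H1 := fun j =>
  ⟨actL M (weakPartial j ψ), ((weakPartial_spec j h).clm
    ((act M).restrictScalars ℝ)).congr (actL_coe M ψ).symm (actL_coe M _).symm⟩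

lemma weakPartial_actL (M : Mat4) {ψ : L2} (h : ψ ∈ H1) (j : Fin 3) :
    weakPartial j (actL M ψ) = actL M (weakPartial j ψ) :=
  Lp.ext <| weakPartial_ae (actL_mem_H1 M h) (((weakPartial_spec j h).clm
    ((act M).restrictScalars ℝ)).congr (actL_coe M ψ).symm (actL_coe M _).symm)

/-! ### Bounded weights -/

/-- Bounded continuous real functions. -/
structure BddCont (a : R3 → ℝ) : Prop where
  cont : Continuous a
  bdd : ∃ C : ℝ, ∀ x, |a x| ≤ C

/-- Smooth bounded real functions with bounded first derivatives. -/
structure Weight (a : R3 → ℝ) : Prop where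
  smooth : ContDiff ℝ ∞ a
  bdd : ∃ C : ℝ, ∀ x, |a x| ≤ C
  bdd_partial : ∀ j, ∃ C : ℝ, ∀ x, |partialD j a x| ≤ C

lemma Weight.bddCont {a : R3 → ℝ} (h : Weight a) : BddCont a := ⟨h.smooth.continuous, h.bdd⟩

lemma Weight.partial_bddCont {a : R3 → ℝ} (h : Weight a) (j : Fin 3) : BddCont (partialD j a) :=
  ⟨(contDiff_partialD h.smooth j).continuous, h.bdd_partial j⟩

lemma IsTest.bddCont {a : R3 → ℝ} (h : IsTest a) : BddCont a :=
  ⟨h.1.continuous, h.2.exists_bound_of_continuous h.1.continuous⟩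

lemma IsTest.weight {a : R3 → ℝ} (h : IsTest a) : Weight a :=
  ⟨h.1, h.bddCont.bdd, fun j => (h.partialD j).bddCont.bdd⟩

lemma BddCont.memLp {a : R3 → ℝ} (h : BddCont a) {f : R3 → Spinor} (hf : MemLp f 2) :
    MemLp (fun x => a x • f x) 2 := by
  obtain ⟨C, hC⟩ := h.bdd
  refine MemLp.of_le_mul (c := C) hf (h.cont.aestronglyMeasurable.smul hf.1)
    (.of_forall fun x => ?_)
  rw [norm_smul]
  exact mul_le_mul_of_nonneg_right (hC x) (norm_nonneg _)

lemma BddCont.coe {a : R3 → ℝ} (h : BddCont a) (ψ : L2) : mulL a ψ =ᵐ[volume] fun x => a x • ψ x :=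
  mulL_coe (h.memLp (Lp.memLp ψ))

lemma BddCont.mulL_add {a : R3 → ℝ} (h : BddCont a) (ψ χ : L2) :
    mulL a (ψ + χ) = mulL a ψ + mulL a χ :=
  MagneticDirac.mulL_add (h.memLp (Lp.memLp ψ)) (h.memLp (Lp.memLp χ))

lemma BddCont.mulL_smul {a : R3 → ℝ} (h : BddCont a) (c : ℂ) (ψ : L2) :
    mulL a (c • ψ) = c • mulL a ψ :=
  MagneticDirac.mulL_smul c (h.memLp (Lp.memLp ψ))

lemma BddCont.mulL_sub {a : R3 → ℝ} (h : BddCont a) (ψ χ : L2) :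
    mulL a (ψ - χ) = mulL a ψ - mulL a χ := by
  have e : ψ - χ = ψ + (-1 : ℂ) • χ := by simp [sub_eq_add_neg]
  rw [e, h.mulL_add, h.mulL_smul]
  simp [sub_eq_add_neg]

lemma BddCont.mulL_sum {ι : Type*} {a : R3 → ℝ} (h : BddCont a) (s : Finset ι) (ψ : ι → L2) :
    mulL a (∑ i ∈ s, ψ i) = ∑ i ∈ s, mulL a (ψ i) := by
  have h0 : mulL a 0 = 0 := by simpa using h.mulL_smul 0 0
  classical
  induction s using Finset.induction_on with
  | empty => simpa using h0
  | insert i s hi ih => rw [Finset.sum_insert hi, Finset.sum_insert hi, h.mulL_add, ih]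

lemma memLp_mulL_comm {a b : R3 → ℝ} (h : BddCont a) {ψ : L2}
    (hb : MemLp (fun x => b x • ψ x) 2) : MemLp (fun x => b x • mulL a ψ x) 2 := by
  refine (h.memLp hb).ae_eq ?_
  filter_upwards [h.coe ψ] with x hx
  rw [hx, smul_comm]

lemma mulL_mulL_comm {a b : R3 → ℝ} (h : BddCont a) {ψ : L2}
    (hb : MemLp (fun x => b x • ψ x) 2) : mulL b (mulL a ψ) = mulL a (mulL b ψ) := by
  refine Lp.ext ?_
  filter_upwards [mulL_coe (memLp_mulL_comm h hb), h.coe (mulL b ψ), h.coe ψ, mulL_coe hb]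
    with x h1 h2 h3 h4
  rw [h1, h2, h3, h4, smul_comm]

lemma memLp_act {f : R3 → Spinor} (hf : MemLp f 2) (M : Mat4) :
    MemLp (fun x => act M (f x)) 2 := (act M).comp_memLp' hf

lemma memLp_actL {b : R3 → ℝ} (M : Mat4) {ψ : L2} (hb : MemLp (fun x => b x • ψ x) 2) :
    MemLp (fun x => b x • actL M ψ x) 2 := by
  refine (memLp_act hb M).ae_eq ?_
  filter_upwards [actL_coe M ψ] with x hx
  rw [hx]
  exact ((act M).restrictScalars ℝ).map_smul (b x) (ψ x)

lemma mulL_actL {b : R3 → ℝ} (M : Mat4) {ψ : L2} (hb : MemLp (fun x => b x • ψ x) 2) :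
    mulL b (actL M ψ) = actL M (mulL b ψ) := by
  refine Lp.ext ?_
  filter_upwards [mulL_coe (memLp_actL M hb), actL_coe M (mulL b ψ), actL_coe M ψ, mulL_coe hb]
    with x h1 h2 h3 h4
  rw [h1, h2, h3, h4]
  exact (((act M).restrictScalars ℝ).map_smul (b x) (ψ x)).symm

lemma BddCont.mulL_actL {b : R3 → ℝ} (hb : BddCont b) (M : Mat4) (ψ : L2) :
    mulL b (actL M ψ) = actL M (mulL b ψ) := MagneticDirac.mulL_actL M (hb.memLp (Lp.memLp ψ))

lemma inner_real_smul_left (r : ℝ) (u v : Spinor) : ⟪r • u, v⟫_ℂ = r * ⟪u, v⟫_ℂ := by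
  rw [inner_smul_left_eq_smul]; simp

lemma inner_real_smul_right (r : ℝ) (u v : Spinor) : ⟪u, r • v⟫_ℂ = r * ⟪u, v⟫_ℂ := by
  rw [inner_smul_right_eq_smul]; simp

lemma inner_mulL_left {a : R3 → ℝ} {v u : L2} (hv : MemLp (fun x => a x • v x) 2)
    (hu : MemLp (fun x => a x • u x) 2) : ⟪mulL a v, u⟫_ℂ = ⟪v, mulL a u⟫_ℂ := by
  rw [L2.inner_def, L2.inner_def]
  refine integral_congr_ae ?_
  filter_upwards [mulL_coe hv, mulL_coe hu] with x h1 h2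
  rw [h1, h2, inner_real_smul_left, inner_real_smul_right]

lemma BddCont.inner_left {a : R3 → ℝ} (h : BddCont a) (v u : L2) :
    ⟪mulL a v, u⟫_ℂ = ⟪v, mulL a u⟫_ℂ :=
  inner_mulL_left (h.memLp (Lp.memLp v)) (h.memLp (Lp.memLp u))

lemma Weight.hasWeakPartial {a : R3 → ℝ} (ha : Weight a) {ψ : L2} (h : ψ ∈ H1) (j : Fin 3) :
    HasWeakPartial j (mulL a ψ : R3 → Spinor)
      (mulL a (weakPartial j ψ) + mulL (partialD j a) ψ : L2) := by
  refine ((weakPartial_spec j h).smul_contDiff ha.smooth).congr (ha.bddCont.coe ψ).symm ?_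
  filter_upwards [Lp.coeFn_add (mulL a (weakPartial j ψ)) (mulL (partialD j a) ψ),
    ha.bddCont.coe (weakPartial j ψ), (ha.partial_bddCont j).coe ψ] with x h1 h2 h3
  rw [h1, Pi.add_apply, h2, h3, add_comm]

lemma Weight.mulL_mem_H1 {a : R3 → ℝ} (ha : Weight a) {ψ : L2} (h : ψ ∈ H1) : mulL a ψ ∈ H1 :=
  fun j => ⟨_, ha.hasWeakPartial h j⟩

lemma Weight.weakPartial_mulL {a : R3 → ℝ} (ha : Weight a) {ψ : L2} (h : ψ ∈ H1) (j : Fin 3) :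
    weakPartial j (mulL a ψ) = mulL a (weakPartial j ψ) + mulL (partialD j a) ψ :=
  Lp.ext (weakPartial_ae (ha.mulL_mem_H1 h) (ha.hasWeakPartial h j))

/-! ### The magnetic derivative on `H¹` -/

/-- `A_j` maps `H¹` into `L²` for every `j`. -/
def Admissible (A : R3 → R3) : Prop :=
  ∀ j : Fin 3, ∀ ψ ∈ H1, MemLp (fun x => A x j • (ψ : L2) x) 2 volume

/-- The magnetic derivative `∂_j ψ - i A_j ψ` as an element of `L²`. -/
def magD (A : R3 → R3) (j : Fin 3) (ψ : L2) : L2 :=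
  weakPartial j ψ - Complex.I • mulL (fun x => A x j) ψ

section Mag

variable {A : R3 → R3} (hA : Admissible A)

include hA

lemma magD_coe (j : Fin 3) {ψ : L2} (h : ψ ∈ H1) : magD A j ψ =ᵐ[volume] magPartial A j ψ := by
  filter_upwards [Lp.coeFn_sub (weakPartial j ψ) (Complex.I • mulL (fun x => A x j) ψ),
    Lp.coeFn_smul Complex.I (mulL (fun x => A x j) ψ), mulL_coe (hA j ψ h)] with x h1 h2 h3
  rw [magD, h1, Pi.sub_apply, h2, Pi.smul_apply, h3, magPartial, mul_smul]
  rfl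

lemma magD_add (j : Fin 3) {ψ χ : L2} (h : ψ ∈ H1) (h' : χ ∈ H1) :
    magD A j (ψ + χ) = magD A j ψ + magD A j χ := by
  rw [magD, weakPartial_add j h h', mulL_add (hA j ψ h) (hA j χ h'), smul_add, magD, magD]
  abel

lemma magD_smul (j : Fin 3) (c : ℂ) {ψ : L2} (h : ψ ∈ H1) :
    magD A j (c • ψ) = c • magD A j ψ := by
  rw [magD, weakPartial_smul j c h, mulL_smul c (hA j ψ h), magD, smul_sub, smul_comm]

lemma magD_actL (j : Fin 3) (M : Mat4) {ψ : L2} (h : ψ ∈ H1) :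
    magD A j (actL M ψ) = actL M (magD A j ψ) := by
  rw [magD, weakPartial_actL M h, mulL_actL M (hA j ψ h), magD, map_sub, map_smul]

lemma magD_mulL {a : R3 → ℝ} (ha : Weight a) (j : Fin 3) {ψ : L2} (h : ψ ∈ H1) :
    magD A j (mulL a ψ) = mulL a (magD A j ψ) + mulL (partialD j a) ψ := by
  rw [magD, ha.weakPartial_mulL h, mulL_mulL_comm ha.bddCont (hA j ψ h), magD,
    ha.bddCont.mulL_sub, ha.bddCont.mulL_smul]
  abel

lemma magD_tendsto (j : Fin 3) {c : ℕ → L2} {ψ : L2} (h : H1Tendsto c ψ) :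
    Tendsto (fun n => magD A j (c n)) atTop (𝓝 (magD A j ψ)) :=
  (h.tendsto_partial j).sub ((h.mulL (hA j)).const_smul _)

end Mag

/-! ### Integration by parts -/

lemma integral_dirDeriv_eq_zero {h : R3 → ℂ} (hs : ContDiff ℝ ∞ h) (hc : HasCompactSupport h)
    (j : Fin 3) : ∫ x, dirDeriv j h x = 0 := by
  have cd := (contDiff_dirDeriv hs j).continuous
  have := integral_mul_fderiv_eq_neg_fderiv_mul_of_integrable (𝕜 := ℂ) (μ := (volume : Measure R3))
    (f := fun _ => (1 : ℂ)) (g := h) (v := EuclideanSpace.single j (1 : ℝ)) (by simp)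
    (by simpa [dirDeriv] using! cd.integrable_of_hasCompactSupport (hasCompactSupport_dirDeriv hc j))
    (by simpa using hs.continuous.integrable_of_hasCompactSupport hc)
    (fun x _ => by fun_prop) (fun x _ => hs.differentiable (by simp) x)
  simpa [dirDeriv] using this

lemma dirDeriv_inner {v u : R3 → Spinor} (hv : ContDiff ℝ ∞ v) (hu : ContDiff ℝ ∞ u) (j : Fin 3)
    (x : R3) : dirDeriv j (fun y => ⟪v y, u y⟫_ℂ) x
      = ⟪v x, dirDeriv j u x⟫_ℂ + ⟪dirDeriv j v x, u x⟫_ℂ :=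
  fderiv_inner_apply ℂ (hv.differentiable (by simp) x) (hu.differentiable (by simp) x) _

lemma hasCompactSupport_inner {v u : R3 → Spinor} (hu : HasCompactSupport u) :
    HasCompactSupport fun y => ⟪v y, u y⟫_ℂ :=
  hu.mono fun x hx hux => hx (by simp [hux])

lemma integral_inner_dirDeriv {v u : R3 → Spinor} (hv : ContDiff ℝ ∞ v) (hu : ContDiff ℝ ∞ u)
    (hc : HasCompactSupport u) (j : Fin 3) :
    ∫ x, ⟪dirDeriv j v x, u x⟫_ℂ = -∫ x, ⟪v x, dirDeriv j u x⟫_ℂ := by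
  have h0 := integral_dirDeriv_eq_zero (hv.inner ℂ hu) (hasCompactSupport_inner hc) j
  simp only [dirDeriv_inner hv hu] at h0
  rw [integral_add] at h0
  · exact eq_neg_of_add_eq_zero_right h0
  · exact (hv.continuous.inner (contDiff_dirDeriv hu j).continuous).integrable_of_hasCompactSupport
      (hasCompactSupport_inner (hasCompactSupport_dirDeriv hc j))
  · exact ((contDiff_dirDeriv hv j).continuous.inner hu.continuous).integrable_of_hasCompactSupport
      (hasCompactSupport_inner hc)

lemma inner_weakPartial_of_smooth {v u : L2} (hv : IsSmooth v) (hu : IsSmooth u) (j : Fin 3) :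
    ⟪weakPartial j v, u⟫_ℂ = -⟪v, weakPartial j u⟫_ℂ := by
  have hv1 := hv.mem_H1
  have hu1 := hu.mem_H1
  obtain ⟨v', v1, v2, v3⟩ := hv
  obtain ⟨u', u1, u2, u3⟩ := hu
  have := integral_inner_dirDeriv v1 u1 u2 j
  rw [L2.inner_def, L2.inner_def]
  convert this using 1
  · refine integral_congr_ae ?_
    filter_upwards [weakPartial_ae hv1 (hasWeakPartial_smooth v1 v3 j), u3] with x h1 h2
    rw [h1, h2]
  · congr 1
    refine integral_congr_ae ?_
    filter_upwards [weakPartial_ae hu1 (hasWeakPartial_smooth u1 u3 j), v3] with x h1 h2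
    rw [h1, h2]

/-- Both sides are continuous in the `H¹` norm, so the smooth compactly supported case suffices. -/
lemma inner_weakPartial {v u : L2} (hv : v ∈ H1) (hu : u ∈ H1) (j : Fin 3) :
    ⟪weakPartial j v, u⟫_ℂ = -⟪v, weakPartial j u⟫_ℂ := by
  obtain ⟨c, c1, c2⟩ := exists_smooth_tendsto hv
  obtain ⟨d, d1, d2⟩ := exists_smooth_tendsto hu
  have l1 := (c2.tendsto_partial j).inner (𝕜 := ℂ) d2.tendsto
  have l2 := (c2.tendsto.inner (𝕜 := ℂ) (d2.tendsto_partial j)).neg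
  exact tendsto_nhds_unique l1
    (l2.congr fun n => (inner_weakPartial_of_smooth (c1 n) (d1 n) j).symm)

/-- Since `A_j` is real, `-i A_j` is skew-adjoint, like the derivative that it corrects. -/
lemma inner_magD {A : R3 → R3} (hA : Admissible A) {v u : L2} (hv : v ∈ H1) (hu : u ∈ H1)
    (j : Fin 3) : ⟪magD A j v, u⟫_ℂ = -⟪v, magD A j u⟫_ℂ := by
  rw [magD, magD, inner_sub_left, inner_sub_right, inner_weakPartial hv hu, inner_smul_left,
    inner_smul_right, inner_mulL_left (hA j v hv) (hA j u hu), Complex.conj_I]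
  ring

/-! ### The magnetic Hardy inequality -/

/-- The squared norm of the magnetic gradient. -/
def gradSq (A : R3 → R3) (ψ : L2) : ℝ := ∑ j, ‖magD A j ψ‖ ^ 2

lemma gradSq_nonneg (A : R3 → R3) (ψ : L2) : 0 ≤ gradSq A ψ :=
  Finset.sum_nonneg fun _ _ => sq_nonneg _

lemma norm_sq_eq_integral (u : L2) : ‖u‖ ^ 2 = ∫ x, ‖u x‖ ^ 2 := by
  have h : ((‖u‖ ^ 2 : ℝ) : ℂ) = ⟪u, u⟫_ℂ := by
    rw [inner_self_eq_norm_sq_to_K]; norm_cast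
  rw [L2.inner_def] at h
  have h2 : ∫ x, ⟪u x, u x⟫_ℂ = ((∫ x, ‖u x‖ ^ 2 : ℝ) : ℂ) := by
    rw [← integral_complex_ofReal]
    refine integral_congr_ae (.of_forall fun x => ?_)
    simp only [inner_self_eq_norm_sq_to_K]
    norm_cast
  rw [h2] at h
  exact_mod_cast h

lemma lintegral_norm_sq (u : L2) : ∫⁻ x, ‖u x‖ₑ ^ 2 = ENNReal.ofReal (‖u‖ ^ 2) := by
  rw [← eLpNorm_two_sq, Lp.norm_def, ← ENNReal.toReal_pow,
    ENNReal.ofReal_toReal (ENNReal.pow_ne_top (Lp.memLp u).2.ne)]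

lemma integrable_norm_sq (u : L2) : Integrable fun x => ‖u x‖ ^ 2 :=
  (Lp.memLp u).integrable_norm_pow two_ne_zero

/-- The regularized square `|x|² + δ`. -/
def hardyDen (δ : ℝ) (x : R3) : ℝ := ‖x‖ ^ 2 + δ

lemma hardyDen_pos {δ : ℝ} (hδ : 0 < δ) (x : R3) : 0 < hardyDen δ x := by
  unfold hardyDen; positivity

lemma contDiff_hardyDen (δ : ℝ) : ContDiff ℝ ∞ (hardyDen δ) :=
  (contDiff_norm_sq ℝ).add contDiff_const

lemma hasFDerivAt_hardyDen (δ : ℝ) (x : R3) :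
    HasFDerivAt (hardyDen δ) (2 • innerSL ℝ x) x :=
  (hasStrictFDerivAt_norm_sq x).hasFDerivAt.add_const δ

lemma contDiff_coord (j : Fin 3) : ContDiff ℝ ∞ fun x : R3 => x j :=
  (EuclideanSpace.proj (𝕜 := ℝ) j : R3 →L[ℝ] ℝ).contDiff

lemma hasFDerivAt_coord (j : Fin 3) (x : R3) :
    HasFDerivAt (fun x : R3 => x j) (EuclideanSpace.proj (𝕜 := ℝ) j : R3 →L[ℝ] ℝ) x :=
  (EuclideanSpace.proj (𝕜 := ℝ) j : R3 →L[ℝ] ℝ).hasFDerivAt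

lemma partialD_coord (j k : Fin 3) (x : R3) :
    partialD j (fun x : R3 => x k) x = if k = j then 1 else 0 := by
  rw [partialD, (hasFDerivAt_coord k x).fderiv]
  simp

lemma abs_coord_le (x : R3) (j : Fin 3) : |x j| ≤ ‖x‖ := PiLp.norm_apply_le x j

lemma sum_coord_sq (x : R3) : ∑ j, x j ^ 2 = ‖x‖ ^ 2 := by
  rw [EuclideanSpace.norm_sq_eq]; simp

/-- The regularized Hardy vector field `x_j / (|x|² + δ)`. -/
def hardyField (δ : ℝ) (j : Fin 3) (x : R3) : ℝ := x j / hardyDen δ x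

lemma partialD_hardyField {δ : ℝ} (hδ : 0 < δ) (j k : Fin 3) (x : R3) :
    partialD j (hardyField δ k) x
      = (if k = j then 1 else 0) / hardyDen δ x - 2 * x j * x k / hardyDen δ x ^ 2 := by
  have hd := hardyDen_pos hδ x
  have h := (hasFDerivAt_coord k x).mul
    ((hasDerivAt_inv hd.ne').comp_hasFDerivAt x (hasFDerivAt_hardyDen δ x))
  have e : hardyField δ k = fun x => x k * ((fun y => y⁻¹) ∘ hardyDen δ) x := by
    ext y; simp [hardyField, div_eq_mul_inv]
  rw [partialD, e]
  erw [h.fderiv]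
  have hs : ⟪x, EuclideanSpace.single j (1 : ℝ)⟫_ℝ = x j := by
    rw [EuclideanSpace.inner_single_right]; simp
  simp [hs]
  split_ifs <;> field_simp <;> ring

lemma weight_hardyField {δ : ℝ} (hδ : 0 < δ) (k : Fin 3) : Weight (hardyField δ k) := by
  refine ⟨(contDiff_coord k).div (contDiff_hardyDen δ) fun x => (hardyDen_pos hδ x).ne',
    ⟨1 + 1 / δ, fun x => ?_⟩, fun j => ⟨3 / δ, fun x => ?_⟩⟩
  · have hd := hardyDen_pos hδ x
    rw [hardyField, abs_div, abs_of_pos hd, div_le_iff₀ hd]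
    have h1 : |x k| ≤ 1 + ‖x‖ ^ 2 := by nlinarith [abs_coord_le x k, sq_nonneg (‖x‖ - 1)]
    have h2 : (1 + 1 / δ) * hardyDen δ x = ‖x‖ ^ 2 + δ + ‖x‖ ^ 2 / δ + 1 := by
      unfold hardyDen; field_simp; ring
    have : 0 ≤ ‖x‖ ^ 2 / δ := by positivity
    linarith
  · have hd := hardyDen_pos hδ x
    have hdδ : δ ≤ hardyDen δ x := by unfold hardyDen; nlinarith [sq_nonneg ‖x‖]
    rw [partialD_hardyField hδ]
    have b1 : |(if k = j then 1 else 0) / hardyDen δ x| ≤ 1 / hardyDen δ x := by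
      rw [abs_div, abs_of_pos hd]
      gcongr
      split_ifs <;> simp
    have b2 : |2 * x j * x k / hardyDen δ x ^ 2| ≤ 2 / hardyDen δ x := by
      rw [abs_div, abs_of_pos (pow_pos hd 2), abs_mul, abs_mul, abs_two, div_le_div_iff₀
        (pow_pos hd 2) hd]
      have : |x j| * |x k| ≤ hardyDen δ x := by
        unfold hardyDen
        nlinarith [abs_coord_le x k, abs_coord_le x j, abs_nonneg (x j), abs_nonneg (x k),
          norm_nonneg x]
      nlinarith
    calc _ ≤ 1 / hardyDen δ x + 2 / hardyDen δ x := (abs_sub _ _).trans (add_le_add b1 b2)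
      _ = 3 / hardyDen δ x := by ring
      _ ≤ 3 / δ := by gcongr

/-- In dimension three `x/|x|²` has divergence `1/|x|²`. The regularization adds `2δ/(|x|² + δ)²`,
which has the favourable sign. -/
lemma sum_partialD_hardyField {δ : ℝ} (hδ : 0 < δ) (x : R3) :
    1 / hardyDen δ x ≤ ∑ j, partialD j (hardyField δ j) x := by
  have hd := hardyDen_pos hδ x
  have e : ∑ j, partialD j (hardyField δ j) x
      = 3 / hardyDen δ x - 2 * ‖x‖ ^ 2 / hardyDen δ x ^ 2 := by
    simp only [partialD_hardyField hδ, if_true, ← sum_coord_sq, Fin.sum_univ_three]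
    ring
  have e2 : 3 / hardyDen δ x - 2 * ‖x‖ ^ 2 / hardyDen δ x ^ 2
      = 1 / hardyDen δ x + 2 * δ / hardyDen δ x ^ 2 := by
    have : ‖x‖ ^ 2 = hardyDen δ x - δ := by simp [hardyDen]
    rw [this]; field_simp; ring
  rw [e, e2]
  have : 0 ≤ 2 * δ / hardyDen δ x ^ 2 := by positivity
  linarith

lemma sum_hardyField_sq_le {δ : ℝ} (hδ : 0 < δ) (x : R3) :
    ∑ j, hardyField δ j x ^ 2 ≤ 1 / hardyDen δ x := by
  have hd := hardyDen_pos hδ x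
  have e : ∑ j, hardyField δ j x ^ 2 = ‖x‖ ^ 2 / hardyDen δ x ^ 2 := by
    simp only [hardyField, div_pow, ← Finset.sum_div, sum_coord_sq]
  rw [e, div_le_div_iff₀ (pow_pos hd 2) hd, one_mul, sq (hardyDen δ x)]
  gcongr
  simp [hardyDen, hδ.le]

lemma BddCont.integrable_mul_norm_sq {a : R3 → ℝ} (h : BddCont a) (u : L2) :
    Integrable fun x => a x * ‖u x‖ ^ 2 := by
  obtain ⟨C, hC⟩ := h.bdd
  exact (integrable_norm_sq u).bdd_mul h.cont.aestronglyMeasurable (.of_forall hC)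

lemma BddCont.inner_self_mulL {a : R3 → ℝ} (h : BddCont a) (u : L2) :
    ⟪u, mulL a u⟫_ℂ = ((∫ x, a x * ‖u x‖ ^ 2 : ℝ) : ℂ) := by
  rw [L2.inner_def, ← integral_complex_ofReal]
  refine integral_congr_ae ?_
  filter_upwards [h.coe u] with x hx
  simp only [hx, inner_real_smul_right, inner_self_eq_norm_sq_to_K]
  norm_cast
  rw [Complex.ofReal_mul]
  rfl

lemma BddCont.norm_mulL_sq {a : R3 → ℝ} (h : BddCont a) (u : L2) :
    ‖mulL a u‖ ^ 2 = ∫ x, a x ^ 2 * ‖u x‖ ^ 2 := by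
  rw [norm_sq_eq_integral]
  refine integral_congr_ae ?_
  filter_upwards [h.coe u] with x hx
  rw [hx, norm_smul, mul_pow, Real.norm_eq_abs, sq_abs]

lemma BddCont.sq {a : R3 → ℝ} (h : BddCont a) : BddCont fun x => a x ^ 2 := by
  obtain ⟨C, hC⟩ := h.bdd
  refine ⟨h.cont.pow 2, C ^ 2, fun x => ?_⟩
  rw [abs_pow]
  exact pow_le_pow_left₀ (abs_nonneg _) (hC x) 2

/-- `2 Re ⟨a ψ, ∂_j^A ψ⟩ = -∫ (∂_j a) |ψ|²`. -/
lemma re_inner_mulL_magD {A : R3 → R3} (hA : Admissible A) {a : R3 → ℝ} (ha : Weight a)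
    {ψ : L2} (hψ : ψ ∈ H1) (j : Fin 3) :
    2 * (⟪mulL a ψ, magD A j ψ⟫_ℂ).re = -∫ x, partialD j a x * ‖ψ x‖ ^ 2 := by
  have h1 := inner_magD hA hψ (ha.mulL_mem_H1 hψ) j
  rw [magD_mulL hA ha j hψ, inner_add_right, (ha.partial_bddCont j).inner_self_mulL,
    ← ha.bddCont.inner_left ψ (magD A j ψ)] at h1
  have h2 := congrArg Complex.re h1
  have h3 : (⟪magD A j ψ, mulL a ψ⟫_ℂ).re = (⟪mulL a ψ, magD A j ψ⟫_ℂ).re := by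
    rw [← inner_conj_symm, Complex.conj_re]
  rw [h3, Complex.neg_re, Complex.add_re, Complex.ofReal_re] at h2
  linarith

lemma bddCont_hardyDen_inv {δ : ℝ} (hδ : 0 < δ) : BddCont fun x => 1 / hardyDen δ x := by
  refine ⟨continuous_const.div (contDiff_hardyDen δ).continuous fun x => (hardyDen_pos hδ x).ne',
    1 / δ, fun x => ?_⟩
  have hd := hardyDen_pos hδ x
  rw [abs_of_pos (by positivity)]
  refine one_div_le_one_div_of_le hδ ?_
  simp [hardyDen]

/-- Integrate the divergence of the field against `|ψ|²` by parts and split the product as `2ab ≤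
a²/2 + 2b²`. The field has squared length at most `1/(|x|² + δ)`, so the first half is absorbed on
the left, leaving the constant `4`. -/
lemma hardy_regularized {A : R3 → R3} (hA : Admissible A) {ψ : L2} (hψ : ψ ∈ H1) {δ : ℝ}
    (hδ : 0 < δ) : ∫ x, 1 / hardyDen δ x * ‖ψ x‖ ^ 2 ≤ 4 * gradSq A ψ := by
  set I := ∫ x, 1 / hardyDen δ x * ‖ψ x‖ ^ 2 with hI
  have hw := fun j => weight_hardyField hδ j
  have hb := bddCont_hardyDen_inv hδ
  have I0 : 0 ≤ I := integral_nonneg fun x => by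
    have := hardyDen_pos hδ x
    positivity
  have h1 : I ≤ ∑ j, ∫ x, partialD j (hardyField δ j) x * ‖ψ x‖ ^ 2 := by
    rw [← integral_finsetSum _ fun j _ => ((hw j).partial_bddCont j).integrable_mul_norm_sq ψ]
    refine integral_mono (hb.integrable_mul_norm_sq ψ) (integrable_finsetSum _ fun j _ =>
      ((hw j).partial_bddCont j).integrable_mul_norm_sq ψ) fun x => ?_
    simp only [← Finset.sum_mul]
    exact mul_le_mul_of_nonneg_right (sum_partialD_hardyField hδ x) (sq_nonneg _)
  have h2 : ∑ j, ‖mulL (hardyField δ j) ψ‖ ^ 2 ≤ I := by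
    simp only [(hw _).bddCont.norm_mulL_sq]
    rw [← integral_finsetSum _ fun j _ => (hw j).bddCont.sq.integrable_mul_norm_sq ψ]
    refine integral_mono (integrable_finsetSum _ fun j _ =>
      (hw j).bddCont.sq.integrable_mul_norm_sq ψ) (hb.integrable_mul_norm_sq ψ) fun x => ?_
    simp only [← Finset.sum_mul]
    exact mul_le_mul_of_nonneg_right (sum_hardyField_sq_le hδ x) (sq_nonneg _)
  have h3 : ∀ j, ∫ x, partialD j (hardyField δ j) x * ‖ψ x‖ ^ 2
      ≤ 1 / 2 * ‖mulL (hardyField δ j) ψ‖ ^ 2 + 2 * ‖magD A j ψ‖ ^ 2 := by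
    intro j
    have e := re_inner_mulL_magD hA (hw j) hψ j
    have b : |(⟪mulL (hardyField δ j) ψ, magD A j ψ⟫_ℂ).re|
        ≤ ‖mulL (hardyField δ j) ψ‖ * ‖magD A j ψ‖ :=
      (Complex.abs_re_le_norm _).trans (norm_inner_le_norm _ _)
    have b' := neg_abs_le (⟪mulL (hardyField δ j) ψ, magD A j ψ⟫_ℂ).re
    nlinarith [sq_nonneg (‖mulL (hardyField δ j) ψ‖ - 2 * ‖magD A j ψ‖)]
  have h4 := Finset.sum_le_sum fun j (_ : j ∈ Finset.univ) => h3 j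
  rw [Finset.sum_add_distrib, ← Finset.mul_sum, ← Finset.mul_sum] at h4
  unfold gradSq
  linarith

/-- Fatou's lemma removes the regularization. Working with the lower integral means that square
integrability of `ψ/|x|` is a conclusion and need not be assumed. -/
lemma hardy_lintegral {A : R3 → R3} (hA : Admissible A) {ψ : L2} (hψ : ψ ∈ H1) :
    ∫⁻ x, ‖‖x‖⁻¹ • ψ x‖ₑ ^ 2 ≤ ENNReal.ofReal (4 * gradSq A ψ) := by
  set δ : ℕ → ℝ := fun n => 1 / ((n : ℝ) + 1)
  have hδ : ∀ n, 0 < δ n := fun n => by positivity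
  have hδlim : Tendsto δ atTop (𝓝 0) := tendsto_one_div_add_atTop_nhds_zero_nat
  have hm : ∀ n, AEMeasurable (fun x => ENNReal.ofReal (1 / hardyDen (δ n) x * ‖ψ x‖ ^ 2)) volume :=
    fun n => ((bddCont_hardyDen_inv (hδ n)).integrable_mul_norm_sq ψ).1.aemeasurable.ennreal_ofReal
  have hae : ∀ᵐ x : R3, x ≠ 0 := by simp [ae_iff]
  have step : ∀ n, ∫⁻ x, ENNReal.ofReal (1 / hardyDen (δ n) x * ‖ψ x‖ ^ 2)
      ≤ ENNReal.ofReal (4 * gradSq A ψ) := fun n => by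
    rw [← ofReal_integral_eq_lintegral_ofReal
      ((bddCont_hardyDen_inv (hδ n)).integrable_mul_norm_sq ψ) (.of_forall fun x => by
        have := hardyDen_pos (hδ n) x
        positivity)]
    exact ENNReal.ofReal_le_ofReal (hardy_regularized hA hψ (hδ n))
  calc ∫⁻ x, ‖‖x‖⁻¹ • ψ x‖ₑ ^ 2
      = ∫⁻ x, liminf (fun n => ENNReal.ofReal (1 / hardyDen (δ n) x * ‖ψ x‖ ^ 2)) atTop := by
        refine lintegral_congr_ae ?_
        filter_upwards [hae] with x hx
        have hx' : 0 < ‖x‖ := norm_pos_iff.2 hx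
        have e : ‖‖x‖⁻¹ • ψ x‖ₑ ^ 2 = ENNReal.ofReal (1 / hardyDen 0 x * ‖ψ x‖ ^ 2) := by
          rw [← ofReal_norm, ← ENNReal.ofReal_pow (norm_nonneg _), norm_smul, mul_pow,
            norm_inv, norm_norm, hardyDen, add_zero, one_div, inv_pow]
        rw [e]
        refine (Tendsto.liminf_eq ?_).symm
        refine (ENNReal.continuous_ofReal.tendsto _).comp ?_
        refine Tendsto.mul_const _ (tendsto_const_nhds.div (tendsto_const_nhds.add hδlim) ?_)
        simpa [hardyDen] using hx
    _ ≤ liminf (fun n => ∫⁻ x, ENNReal.ofReal (1 / hardyDen (δ n) x * ‖ψ x‖ ^ 2)) atTop :=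
        lintegral_liminf_le' hm
    _ ≤ ENNReal.ofReal (4 * gradSq A ψ) := by
        refine liminf_le_of_le (by isBoundedDefault) fun b hb => ?_
        obtain ⟨n, hn⟩ := hb.exists
        exact hn.trans (step n)

lemma hardy_memLp {A : R3 → R3} (hA : Admissible A) {ψ : L2} (hψ : ψ ∈ H1) :
    MemLp (fun x => ‖x‖⁻¹ • ψ x) 2 := by
  refine ⟨?_, ?_⟩
  · exact (measurable_norm.inv.aestronglyMeasurable).smul (Lp.aestronglyMeasurable ψ)
  · have h := hardy_lintegral hA hψ
    rw [← eLpNorm_two_sq] at h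
    by_contra hc
    rw [not_lt, top_le_iff] at hc
    rw [hc, ENNReal.top_pow two_ne_zero, top_le_iff] at h
    exact ENNReal.ofReal_ne_top h

lemma norm_mulL_le_of_lintegral {a : R3 → ℝ} {ψ : L2} (h : MemLp (fun x => a x • ψ x) 2) {c : ℝ}
    (hc : 0 ≤ c) (hle : ∫⁻ x, ‖a x • ψ x‖ₑ ^ 2 ≤ ENNReal.ofReal c) : ‖mulL a ψ‖ ^ 2 ≤ c := by
  have e : ∫⁻ x, ‖a x • ψ x‖ₑ ^ 2 = ENNReal.ofReal (‖mulL a ψ‖ ^ 2) := by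
    rw [← lintegral_norm_sq]
    refine lintegral_congr_ae ?_
    filter_upwards [mulL_coe h] with x hx
    rw [hx]
  rw [e] at hle
  exact (ENNReal.ofReal_le_ofReal_iff hc).1 hle

/-- The magnetic Hardy inequality. -/
theorem hardy {A : R3 → R3} (hA : Admissible A) {ψ : L2} (hψ : ψ ∈ H1) :
    ‖mulL (fun x => ‖x‖⁻¹) ψ‖ ^ 2 ≤ 4 * gradSq A ψ :=
  norm_mulL_le_of_lintegral (hardy_memLp hA hψ) (mul_nonneg (by norm_num) (gradSq_nonneg A ψ))
    (hardy_lintegral hA hψ)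

/-! ### Algebra of the Dirac matrices -/

lemma pauli_conjTranspose (j : Fin 3) : (pauli j).conjTranspose = pauli j := by
  fin_cases j <;> ext a b <;> fin_cases a <;> fin_cases b <;>
    simp [pauli, Matrix.conjTranspose_apply]

lemma pauli_sq (j : Fin 3) : pauli j * pauli j = 1 := by
  fin_cases j <;> ext a b <;> fin_cases a <;> fin_cases b <;>
    simp [pauli, Matrix.mul_apply]

lemma pauli_anticomm {j k : Fin 3} (h : j ≠ k) : pauli j * pauli k = -(pauli k * pauli j) := by
  fin_cases j <;> fin_cases k <;> first | exact absurd rfl h | skip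
  all_goals
    ext a b
    fin_cases a <;> fin_cases b <;> simp [pauli, Matrix.mul_apply]

lemma pauli_cyclic (i : Fin 3) : pauli (i + 1) * pauli (i + 2) = Complex.I • pauli i := by
  fin_cases i <;> ext a b <;> fin_cases a <;> fin_cases b <;>
    simp [pauli, Matrix.mul_apply]

lemma alpha_conjTranspose (j : Fin 3) : (alpha j).conjTranspose = alpha j := by
  simp [alpha, Matrix.fromBlocks_conjTranspose, pauli_conjTranspose]

lemma beta_conjTranspose : beta.conjTranspose = beta := by
  simp [beta, Matrix.fromBlocks_conjTranspose]

lemma alpha_sq (j : Fin 3) : alpha j * alpha j = 1 := by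
  simp [alpha, Matrix.fromBlocks_multiply, pauli_sq, Matrix.fromBlocks_one]

lemma alpha_anticomm {j k : Fin 3} (h : j ≠ k) : alpha j * alpha k = -(alpha k * alpha j) := by
  simp [alpha, Matrix.fromBlocks_multiply, pauli_anticomm h, Matrix.fromBlocks_neg]

lemma beta_sq : beta * beta = 1 := by
  simp [beta, Matrix.fromBlocks_multiply, Matrix.fromBlocks_one]

lemma alpha_beta (j : Fin 3) : alpha j * beta = -(beta * alpha j) := by
  simp [alpha, beta, Matrix.fromBlocks_multiply, Matrix.fromBlocks_neg]

lemma spin_beta (j : Fin 3) : spin j * beta = beta * spin j := by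
  simp [spin, beta, Matrix.fromBlocks_multiply, Matrix.fromBlocks_smul]

/-! ### The curvature identity -/

/-- The magnetic field `F = ∇ × A` together with the multiplier bounds needed to integrate it
against products of `H¹` functions. -/
structure CurvData (A F : R3 → R3) : Prop where
  adm : Admissible A
  curl : IsWeakCurl A F
  locA : ∀ j, LocallyIntegrable fun x => A x j
  locF : ∀ j, LocallyIntegrable fun x => F x j
  mult : ∀ j : Fin 3, ∀ ψ ∈ H1, MemLp (fun x => (‖x‖ * F x j) • (ψ : L2) x) 2 volume

/-- The form `∫ F_i ⟨v, u⟩`. -/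
def curvForm (F : R3 → R3) (i : Fin 3) (v u : L2) : ℂ := ∫ x, (F x i : ℂ) * ⟪v x, u x⟫_ℂ

lemma ae_ne_zero : ∀ᵐ x : R3, x ≠ 0 := by simp [ae_iff]

lemma LocallyIntegrable.integrable_ofReal_mul {a : R3 → ℝ} (ha : LocallyIntegrable a) {h : R3 → ℂ}
    (hh : Continuous h) (hc : HasCompactSupport h) : Integrable fun x => (a x : ℂ) * h x := by
  have := ha.integrable_smul_right_of_hasCompactSupport hh hc
  simpa using this

/-- The distributional curl is tested against real functions only; composing `h` with the real and
imaginary part functionals transfers it to complex test functions such as `⟪v, u⟫`. -/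
lemma IsWeakCurl.complex {A F : R3 → R3} (hcurl : IsWeakCurl A F)
    (hA : ∀ j, LocallyIntegrable fun x => A x j) (hF : ∀ j, LocallyIntegrable fun x => F x j)
    (i : Fin 3) {h : R3 → ℂ} (hh : ContDiff ℝ ∞ h) (hc : HasCompactSupport h) :
    ∫ x, (F x i : ℂ) * h x = (∫ x, (A x (i + 1) : ℂ) * dirDeriv (i + 2) h x)
      - ∫ x, (A x (i + 2) : ℂ) * dirDeriv (i + 1) h x := by
  have cd := fun j => (contDiff_dirDeriv hh j).continuous
  have sd := fun j => hasCompactSupport_dirDeriv hc j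
  have i1 := LocallyIntegrable.integrable_ofReal_mul (hF i) hh.continuous hc
  have i2 := LocallyIntegrable.integrable_ofReal_mul (hA (i + 1)) (cd (i + 2)) (sd (i + 2))
  have i3 := LocallyIntegrable.integrable_ofReal_mul (hA (i + 2)) (cd (i + 1)) (sd (i + 1))
  rw [← integral_sub i2 i3]
  have key : ∀ T : ℂ →L[ℝ] ℝ, T (∫ x, (F x i : ℂ) * h x)
      = T (∫ x, ((A x (i + 1) : ℂ) * dirDeriv (i + 2) h x
        - (A x (i + 2) : ℂ) * dirDeriv (i + 1) h x)) := by
    intro T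
    have hT : ∀ (r : ℝ) (z : ℂ), T ((r : ℂ) * z) = r * T z := fun r z => by
      have := T.map_smul r z
      simpa using this
    have hη : IsTest fun x => T (h x) :=
      ⟨T.contDiff.comp hh, hc.comp_left (g := T) (map_zero T)⟩
    have hd : ∀ j x, partialD j (fun x => T (h x)) x = T (dirDeriv j h x) := by
      intro j x
      have := T.hasFDerivAt.comp x (hh.differentiable (by simp) x).hasFDerivAt
      rw [partialD]
      erw [this.fderiv]
      rfl
    have e := hcurl _ hη i
    have i4 : Integrable fun x => (A x (i + 1) : ℂ) * dirDeriv (i + 2) h x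
        - (A x (i + 2) : ℂ) * dirDeriv (i + 1) h x := i2.sub i3
    rw [← T.integral_comp_comm i1, ← T.integral_comp_comm i4]
    simp only [hd] at e
    simp only [map_sub, hT]
    rw [← e]
    exact integral_congr_ae (.of_forall fun x => mul_comm _ _)
  exact Complex.ext (key Complex.reCLM) (key Complex.imCLM)

lemma integrable_inner (v u : L2) : Integrable fun x => ⟪v x, u x⟫_ℂ := L2.integrable_inner v u

lemma inner_mulL_dirDeriv {A : R3 → R3} (hA : Admissible A) {v u : L2} {v' u' : R3 → Spinor}
    (v1 : ContDiff ℝ ∞ v') (v2 : HasCompactSupport v') (v3 : v =ᵐ[volume] v')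
    (u1 : ContDiff ℝ ∞ u') (u2 : HasCompactSupport u') (u3 : u =ᵐ[volume] u') (j k : Fin 3) :
    ∫ x, (A x j : ℂ) * dirDeriv k (fun y => ⟪v' y, u' y⟫_ℂ) x
      = ⟪mulL (fun x => A x j) v, weakPartial k u⟫_ℂ
        + ⟪weakPartial k v, mulL (fun x => A x j) u⟫_ℂ := by
  have hv : v ∈ H1 := IsSmooth.mem_H1 ⟨v', v1, v2, v3⟩
  have hu : u ∈ H1 := IsSmooth.mem_H1 ⟨u', u1, u2, u3⟩
  rw [L2.inner_def, L2.inner_def, ← integral_add (integrable_inner _ _) (integrable_inner _ _)]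
  refine integral_congr_ae ?_
  filter_upwards [v3, u3, weakPartial_ae hv (hasWeakPartial_smooth v1 v3 k),
    weakPartial_ae hu (hasWeakPartial_smooth u1 u3 k), mulL_coe (hA j v hv),
    mulL_coe (hA j u hu)] with x h1 h2 h3 h4 h5 h6
  rw [dirDeriv_inner v1 u1, h3, h4, h5, h6, h1, h2, inner_real_smul_left, inner_real_smul_right,
    mul_add]

lemma inner_weakPartial_comm {v u : L2} (hv : IsSmooth v) (hu : IsSmooth u) (j k : Fin 3) :
    ⟪weakPartial j v, weakPartial k u⟫_ℂ = ⟪weakPartial k v, weakPartial j u⟫_ℂ := by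
  have hv1 := hv.mem_H1
  have hu1 := hu.mem_H1
  obtain ⟨v', v1, v2, v3⟩ := hv
  obtain ⟨u', u1, u2, u3⟩ := hu
  have key : ∀ j k, ⟪weakPartial j v, weakPartial k u⟫_ℂ
      = -∫ x, ⟪v' x, dirDeriv j (dirDeriv k u') x⟫_ℂ := by
    intro j k
    rw [← integral_inner_dirDeriv v1 (contDiff_dirDeriv u1 k) (hasCompactSupport_dirDeriv u2 k),
      L2.inner_def]
    refine integral_congr_ae ?_
    filter_upwards [weakPartial_ae hv1 (hasWeakPartial_smooth v1 v3 j),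
      weakPartial_ae hu1 (hasWeakPartial_smooth u1 u3 k)] with x h1 h2
    rw [h1, h2]
  have hsymm : ∀ x, dirDeriv j (dirDeriv k u') x = dirDeriv k (dirDeriv j u') x := by
    intro x
    have hd : DifferentiableAt ℝ (fderiv ℝ u') x :=
      (u1.fderiv_right (m := 1) (by norm_cast)).differentiable (by norm_num) x
    have key : ∀ i l : Fin 3, dirDeriv i (dirDeriv l u') x
        = fderiv ℝ (fderiv ℝ u') x (EuclideanSpace.single i 1) (EuclideanSpace.single l 1) := by
      intro i l
      show fderiv ℝ (fun y => fderiv ℝ u' y (EuclideanSpace.single l (1 : ℝ))) x _ = _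
      rw [fderiv_clm_apply hd (differentiableAt_const _)]
      simp
    rw [key, key]
    exact (u1.contDiffAt.isSymmSndFDerivAt (by simp; norm_cast)).eq _ _
  rw [key, key]
  simp only [hsymm]

variable {A F : R3 → R3}

/-- The weight is split as `1/|x|` times `|x| F_i`: Hardy controls the first factor and the
multiplier assumption the second. This makes the form continuous on `H¹`. -/
lemma curvForm_eq (h : CurvData A F) (i : Fin 3) {v u : L2} (hv : v ∈ H1) (hu : u ∈ H1) :
    curvForm F i v u = ⟪mulL (fun x => ‖x‖⁻¹) v, mulL (fun x => ‖x‖ * F x i) u⟫_ℂ := by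
  rw [curvForm, L2.inner_def]
  refine integral_congr_ae ?_
  filter_upwards [mulL_coe (hardy_memLp h.adm hv), mulL_coe (h.mult i u hu), ae_ne_zero]
    with x h1 h2 h3
  rw [h1, h2, inner_real_smul_left, inner_real_smul_right, ← mul_assoc, ← Complex.ofReal_mul,
    inv_mul_cancel_left₀ (norm_ne_zero_iff.2 h3)]

lemma integrable_curvForm (h : CurvData A F) (i : Fin 3) {v u : L2} (hv : v ∈ H1) (hu : u ∈ H1) :
    Integrable fun x => (F x i : ℂ) * ⟪v x, u x⟫_ℂ := by
  refine (integrable_inner (mulL (fun x => ‖x‖⁻¹) v) (mulL (fun x => ‖x‖ * F x i) u)).congr ?_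
  filter_upwards [mulL_coe (hardy_memLp h.adm hv), mulL_coe (h.mult i u hu), ae_ne_zero]
    with x h1 h2 h3
  rw [h1, h2, inner_real_smul_left, inner_real_smul_right, ← mul_assoc, ← Complex.ofReal_mul,
    inv_mul_cancel_left₀ (norm_ne_zero_iff.2 h3)]

/-- Expanding both products, the terms with two derivatives cancel by symmetry of second derivatives
and those with two potentials cancel pointwise. The mixed terms assemble into `A` paired with
derivatives of the scalar `⟪v, u⟫`, to which the definition of the curl applies. -/
lemma inner_magD_magD_of_smooth (h : CurvData A F) (i : Fin 3) {v u : L2} (hv : IsSmooth v)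
    (hu : IsSmooth u) :
    ⟪magD A (i + 1) v, magD A (i + 2) u⟫_ℂ - ⟪magD A (i + 2) v, magD A (i + 1) u⟫_ℂ
      = Complex.I * curvForm F i v u := by
  have hv1 := hv.mem_H1
  have hu1 := hu.mem_H1
  have hT1 := inner_weakPartial_comm hv hu (i + 1) (i + 2)
  obtain ⟨v', v1, v2, v3⟩ := hv
  obtain ⟨u', u1, u2, u3⟩ := hu
  have hT4 : ⟪mulL (fun x => A x (i + 1)) v, mulL (fun x => A x (i + 2)) u⟫_ℂ
      = ⟪mulL (fun x => A x (i + 2)) v, mulL (fun x => A x (i + 1)) u⟫_ℂ := by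
    rw [L2.inner_def, L2.inner_def]
    refine integral_congr_ae ?_
    filter_upwards [mulL_coe (h.adm (i + 1) v hv1), mulL_coe (h.adm (i + 2) v hv1),
      mulL_coe (h.adm (i + 1) u hu1), mulL_coe (h.adm (i + 2) u hu1)] with x a b c d
    rw [a, b, c, d]
    simp only [inner_real_smul_left, inner_real_smul_right]
    ring
  have hc : curvForm F i v u = ∫ x, (F x i : ℂ) * ⟪v' x, u' x⟫_ℂ := by
    refine integral_congr_ae ?_
    filter_upwards [v3, u3] with x a b
    rw [a, b]
  rw [hc, h.curl.complex h.locA h.locF i (v1.inner ℂ u1) (hasCompactSupport_inner u2),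
    inner_mulL_dirDeriv h.adm v1 v2 v3 u1 u2 u3, inner_mulL_dirDeriv h.adm v1 v2 v3 u1 u2 u3]
  simp only [magD, inner_sub_left, inner_sub_right, inner_smul_left, inner_smul_right,
    Complex.conj_I]
  rw [hT1, hT4]
  ring

/-- The commutator of two magnetic derivatives is the magnetic field. -/
theorem inner_magD_magD (h : CurvData A F) (i : Fin 3) {v u : L2} (hv : v ∈ H1) (hu : u ∈ H1) :
    ⟪magD A (i + 1) v, magD A (i + 2) u⟫_ℂ - ⟪magD A (i + 2) v, magD A (i + 1) u⟫_ℂ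
      = Complex.I * curvForm F i v u := by
  obtain ⟨c, c1, c2⟩ := exists_smooth_tendsto hv
  obtain ⟨d, d1, d2⟩ := exists_smooth_tendsto hu
  have cl := fun j => magD_tendsto h.adm j c2
  have dl := fun j => magD_tendsto h.adm j d2
  have l1 := ((cl (i + 1)).inner (𝕜 := ℂ) (dl (i + 2))).sub
    ((cl (i + 2)).inner (𝕜 := ℂ) (dl (i + 1)))
  have l2 := ((c2.mulL fun ψ hψ => hardy_memLp h.adm hψ).inner (𝕜 := ℂ)
    (d2.mulL (h.mult i))).const_mul Complex.I
  rw [curvForm_eq h i hv hu]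
  refine tendsto_nhds_unique l1 (l2.congr fun n => ?_)
  rw [inner_magD_magD_of_smooth h i (c1 n) (d1 n), curvForm_eq h i (c2.mem n) (d2.mem n)]

/-! ### The free magnetic Dirac operator -/

/-- The operator `-i α·∇_A` on `H¹`. -/
def diracL (A : R3 → R3) (ψ : L2) : L2 := (-Complex.I) • ∑ j, actL (alpha j) (magD A j ψ)

lemma inner_self_ofReal (u : L2) : ⟪u, u⟫_ℂ = ((‖u‖ ^ 2 : ℝ) : ℂ) := by
  rw [inner_self_eq_norm_sq_to_K]; norm_cast

lemma norm_actL_alpha (j : Fin 3) (u : L2) : ‖actL (alpha j) u‖ = ‖u‖ := by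
  have h : ‖actL (alpha j) u‖ ^ 2 = ‖u‖ ^ 2 := by
    have : ((‖actL (alpha j) u‖ ^ 2 : ℝ) : ℂ) = ((‖u‖ ^ 2 : ℝ) : ℂ) := by
      rw [← inner_self_ofReal, ← inner_self_ofReal, inner_actL_left, alpha_conjTranspose,
        ← actL_mul, alpha_sq, actL_one]
    exact_mod_cast this
  exact (sq_eq_sq₀ (norm_nonneg _) (norm_nonneg _)).1 h

/-- Anticommutation of the `α`'s turns the symmetric sum of cross terms into an antisymmetric one,
hence into a commutator of magnetic derivatives. -/
lemma inner_actL_alpha_cross (h : CurvData A F) (i : Fin 3) {ψ : L2} (hψ : ψ ∈ H1) :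
    ⟪actL (alpha (i + 1)) (magD A (i + 1) ψ), actL (alpha (i + 2)) (magD A (i + 2) ψ)⟫_ℂ
      + ⟪actL (alpha (i + 2)) (magD A (i + 2) ψ), actL (alpha (i + 1)) (magD A (i + 1) ψ)⟫_ℂ
      = Complex.I * curvForm F i ψ (actL (alpha (i + 1) * alpha (i + 2)) ψ) := by
  have hne : i + 2 ≠ i + 1 := by fin_cases i <;> decide
  have hm := actL_mem_H1 (alpha (i + 1) * alpha (i + 2)) hψ
  rw [← inner_magD_magD h i hψ hm, inner_actL_left, inner_actL_left, alpha_conjTranspose,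
    alpha_conjTranspose, ← actL_mul, ← actL_mul, alpha_anticomm hne, actL_neg, inner_neg_right,
    magD_actL h.adm _ _ hψ, magD_actL h.adm _ _ hψ]
  ring

/-- `‖α·∇_A ψ‖² = ‖∇_A ψ‖²` up to the magnetic field. -/
lemma norm_diracL_sq (h : CurvData A F) {ψ : L2} (hψ : ψ ∈ H1) :
    ((‖diracL A ψ‖ ^ 2 : ℝ) : ℂ) = (gradSq A ψ : ℂ)
      + Complex.I * ∑ i, curvForm F i ψ (actL (alpha (i + 1) * alpha (i + 2)) ψ) := by
  have c0 := inner_actL_alpha_cross h 0 hψ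
  have c1 := inner_actL_alpha_cross h 1 hψ
  have c2 := inner_actL_alpha_cross h 2 hψ
  have s := fun j => inner_self_ofReal (actL (alpha j) (magD A j ψ))
  simp only [norm_actL_alpha] at s
  have e0 : (0 : Fin 3) + 1 = 1 := rfl
  have e1 : (0 : Fin 3) + 2 = 2 := rfl
  have e2 : (1 : Fin 3) + 1 = 2 := rfl
  have e3 : (1 : Fin 3) + 2 = 0 := rfl
  have e4 : (2 : Fin 3) + 1 = 0 := rfl
  have e5 : (2 : Fin 3) + 2 = 1 := rfl
  rw [e0, e1] at c0
  rw [e2, e3] at c1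
  rw [e4, e5] at c2
  rw [diracL, norm_smul, norm_neg, Complex.norm_I, one_mul, ← inner_self_ofReal, gradSq]
  simp only [Fin.sum_univ_three, inner_add_left, inner_add_right, e0, e1, e2, e3, e4, e5, s,
    mul_add, ← c0, ← c1, ← c2]
  push_cast
  ring

/-- Virial type commutator identity, one pair of indices at a time. -/
lemma inner_virial_pair (hA : Admissible A) {v u : L2} (hv : v ∈ H1) (hu : u ∈ H1)
    {w : R3 → ℝ} (hw : IsTest w) (j k : Fin 3) :
    ⟪(-Complex.I) • actL (alpha j) (magD A j v), mulL w (magD A k u)⟫_ℂ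
      + ⟪mulL w (magD A k v), (-Complex.I) • actL (alpha j) (magD A j u)⟫_ℂ
      = Complex.I * (⟪magD A j v, magD A k (mulL w (actL (alpha j) u))⟫_ℂ
          - ⟪magD A k v, magD A j (mulL w (actL (alpha j) u))⟫_ℂ)
        + Complex.I * ⟪v, mulL (partialD k w) (actL (alpha j) (magD A j u))⟫_ℂ
        - Complex.I * ⟪v, mulL (partialD j w) (actL (alpha j) (magD A k u))⟫_ℂ := by
  have hχ := actL_mem_H1 (alpha j) hu
  have b0 := hw.bddCont
  have tk := hw.partialD k
  have tj := hw.partialD j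
  -- Moving the derivatives off `v` creates second derivatives of `w` in both terms; they cancel by
  -- this symmetry, so only first derivatives of the multiplier survive.
  have hdd : partialD j (partialD k w) = partialD k (partialD j w) := by
    ext x; exact partialD_comm (hw.1.contDiffAt.of_le (by norm_cast)) j k
  have p1 : ⟪magD A j v, mulL (partialD k w) (actL (alpha j) u)⟫_ℂ
      = -⟪v, mulL (partialD k w) (actL (alpha j) (magD A j u))⟫_ℂ
        - ⟪v, mulL (partialD k (partialD j w)) (actL (alpha j) u)⟫_ℂ := by
    rw [inner_magD hA hv (tk.weight.mulL_mem_H1 hχ), magD_mulL hA tk.weight j hχ, inner_add_right,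
      magD_actL hA _ _ hu, hdd]
    ring
  have p2 : ⟪magD A k v, mulL (partialD j w) (actL (alpha j) u)⟫_ℂ
      = -⟪v, mulL (partialD j w) (actL (alpha j) (magD A k u))⟫_ℂ
        - ⟪v, mulL (partialD k (partialD j w)) (actL (alpha j) u)⟫_ℂ := by
    rw [inner_magD hA hv (tj.weight.mulL_mem_H1 hχ), magD_mulL hA tj.weight k hχ, inner_add_right,
      magD_actL hA _ _ hu]
    ring
  have l1 : ⟪(-Complex.I) • actL (alpha j) (magD A j v), mulL w (magD A k u)⟫_ℂ
      = Complex.I * ⟪magD A j v, mulL w (actL (alpha j) (magD A k u))⟫_ℂ := by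
    rw [inner_smul_left, inner_actL_left, alpha_conjTranspose, b0.mulL_actL]
    simp
  have l2 : ⟪mulL w (magD A k v), (-Complex.I) • actL (alpha j) (magD A j u)⟫_ℂ
      = -Complex.I * ⟪magD A k v, mulL w (actL (alpha j) (magD A j u))⟫_ℂ := by
    rw [inner_smul_right, b0.inner_left]
  rw [l1, l2, magD_mulL hA hw.weight k hχ, magD_mulL hA hw.weight j hχ, inner_add_right,
    inner_add_right, p1, p2, magD_actL hA _ _ hu, magD_actL hA _ _ hu]
  ring

/-- The virial identity for the magnetic Dirac operator and a test vector field `w`. -/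
theorem inner_virial (h : CurvData A F) {v u : L2} (hv : v ∈ H1) (hu : u ∈ H1)
    {w : Fin 3 → R3 → ℝ} (hw : ∀ k, IsTest (w k)) :
    (∑ k, ⟪diracL A v, mulL (w k) (magD A k u)⟫_ℂ)
      + ∑ k, ⟪mulL (w k) (magD A k v), diracL A u⟫_ℂ
      = -(∑ k, ⟪v, mulL (partialD k (w k)) (diracL A u)⟫_ℂ)
        - Complex.I * (∑ j, ∑ k, ⟪v, mulL (partialD j (w k)) (actL (alpha j) (magD A k u))⟫_ℂ)
        - ∑ i, (curvForm F i v (mulL (w (i + 2)) (actL (alpha (i + 1)) u))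
          - curvForm F i v (mulL (w (i + 1)) (actL (alpha (i + 2)) u))) := by
  have hχ := fun j k => (hw k).weight.mulL_mem_H1 (actL_mem_H1 (alpha j) hu)
  have P := fun j k => inner_virial_pair h.adm hv hu (hw k) j k
  -- Diagonal pairs `j = k` carry no field. The off-diagonal pairs split into the cyclic ones (`cA`)
  -- and the reversed ones (`cB`), which enter with opposite signs.
  have cA := fun i => inner_magD_magD h i hv (hχ (i + 1) (i + 2))
  have cB := fun i => inner_magD_magD h i hv (hχ (i + 2) (i + 1))
  have e0 : (0 : Fin 3) + 1 = 1 := rfl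
  have e1 : (0 : Fin 3) + 2 = 2 := rfl
  have e2 : (1 : Fin 3) + 1 = 2 := rfl
  have e3 : (1 : Fin 3) + 2 = 0 := rfl
  have e4 : (2 : Fin 3) + 1 = 0 := rfl
  have e5 : (2 : Fin 3) + 2 = 1 := rfl
  have cA0 := cA 0
  have cA1 := cA 1
  have cA2 := cA 2
  have cB0 := cB 0
  have cB1 := cB 1
  have cB2 := cB 2
  rw [e0, e1] at cA0 cB0
  rw [e2, e3] at cA1 cB1
  rw [e4, e5] at cA2 cB2
  have r : ∀ k, ⟪v, mulL (partialD k (w k)) (diracL A u)⟫_ℂ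
      = -Complex.I * ∑ j, ⟪v, mulL (partialD k (w k)) (actL (alpha j) (magD A j u))⟫_ℂ := by
    intro k
    rw [diracL, ((hw k).partialD k).bddCont.mulL_smul, inner_smul_right,
      ((hw k).partialD k).bddCont.mulL_sum, inner_sum]
  have l1 : ∀ k, ⟪diracL A v, mulL (w k) (magD A k u)⟫_ℂ
      = ∑ j, ⟪(-Complex.I) • actL (alpha j) (magD A j v), mulL (w k) (magD A k u)⟫_ℂ := by
    intro k
    rw [diracL, Finset.smul_sum, sum_inner]
  have l2 : ∀ k, ⟪mulL (w k) (magD A k v), diracL A u⟫_ℂ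
      = ∑ j, ⟪mulL (w k) (magD A k v), (-Complex.I) • actL (alpha j) (magD A j u)⟫_ℂ := by
    intro k
    rw [diracL, Finset.smul_sum, inner_sum]
  have I2 : Complex.I * Complex.I = -1 := Complex.I_mul_I
  simp only [r, l1, l2, Fin.sum_univ_three, e0, e1, e2, e3, e4, e5]
  linear_combination P 0 0 + P 0 1 + P 0 2 + P 1 0 + P 1 1 + P 1 2 + P 2 0 + P 2 1 + P 2 2
    + Complex.I * (cA0 + cA1 + cA2 - cB0 - cB1 - cB2)
    + (curvForm F 0 v (mulL (w 2) (actL (alpha 1) u)) + curvForm F 1 v (mulL (w 0) (actL (alpha 2) u))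
      + curvForm F 2 v (mulL (w 1) (actL (alpha 0) u)) - curvForm F 0 v (mulL (w 1) (actL (alpha 2) u))
      - curvForm F 1 v (mulL (w 2) (actL (alpha 0) u)) - curvForm F 2 v (mulL (w 0) (actL (alpha 1) u)))
      * I2

/-! ### Pointwise estimates for the Dirac matrices -/

lemma norm_act_of_conjTranspose_mul {M : Mat4} {r : ℝ} (hr : 0 ≤ r)
    (hM : M.conjTranspose * M = ((r ^ 2 : ℝ) : ℂ) • (1 : Mat4)) (u : Spinor) :
    ‖act M u‖ = r * ‖u‖ := by
  have h : ((‖act M u‖ ^ 2 : ℝ) : ℂ) = (((r * ‖u‖) ^ 2 : ℝ) : ℂ) := by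
    have self : ∀ y : Spinor, ⟪y, y⟫_ℂ = ((‖y‖ ^ 2 : ℝ) : ℂ) := fun y => by
      rw [inner_self_eq_norm_sq_to_K]; norm_cast
    rw [← self, inner_act_left, ← act_mul, hM, act_smul, act_one, inner_smul_right, self]
    push_cast; ring
  have h' : ‖act M u‖ ^ 2 = (r * ‖u‖) ^ 2 := by exact_mod_cast h
  exact (sq_eq_sq₀ (norm_nonneg _) (by positivity)).1 h'

/-- `σ·a`. -/
def pauliDot (a : R3) : Matrix (Fin 2) (Fin 2) ℂ := ∑ j, (a j : ℂ) • pauli j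

lemma pauliDot_conjTranspose (a : R3) : (pauliDot a).conjTranspose = pauliDot a := by
  simp [pauliDot, Matrix.conjTranspose_sum, Matrix.conjTranspose_smul, pauli_conjTranspose]

lemma pauliDot_sq (a : R3) : pauliDot a * pauliDot a = ((‖a‖ ^ 2 : ℝ) : ℂ) • 1 := by
  rw [← sum_coord_sq]
  ext i j
  fin_cases i <;> fin_cases j <;>
    simp [pauliDot, pauli, Fin.sum_univ_three, Matrix.mul_apply] <;>
    ring_nf <;> simp

/-- `α·a`. -/
def alphaDot (a : R3) : Mat4 := ∑ j, (a j : ℂ) • alpha j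

lemma alphaDot_eq (a : R3) : alphaDot a = Matrix.fromBlocks 0 (pauliDot a) (pauliDot a) 0 := by
  simp [alphaDot, pauliDot, alpha, Fin.sum_univ_three, Matrix.fromBlocks_smul,
    Matrix.fromBlocks_add]

/-- `S·a`. -/
def spinDot (a : R3) : Mat4 := ∑ j, (a j : ℂ) • spin j

lemma spinDot_eq (a : R3) :
    spinDot a = (1 / 2 : ℂ) • Matrix.fromBlocks (pauliDot a) 0 0 (pauliDot a) := by
  simp [spinDot, pauliDot, spin, Fin.sum_univ_three, Matrix.fromBlocks_smul,
    Matrix.fromBlocks_add, smul_smul, mul_comm]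
  ext i j
  simp
  ring

lemma norm_act_alphaDot (a : R3) (u : Spinor) : ‖act (alphaDot a) u‖ = ‖a‖ * ‖u‖ := by
  refine norm_act_of_conjTranspose_mul (norm_nonneg a) ?_ u
  rw [alphaDot_eq, Matrix.fromBlocks_conjTranspose, Matrix.fromBlocks_multiply,
    pauliDot_conjTranspose, ← Matrix.fromBlocks_one, Matrix.fromBlocks_smul]
  simp [pauliDot_sq]

lemma norm_act_spinDot (a : R3) (u : Spinor) : ‖act (spinDot a) u‖ = ‖a‖ / 2 * ‖u‖ := by
  refine norm_act_of_conjTranspose_mul (by positivity) ?_ u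
  rw [spinDot_eq, Matrix.conjTranspose_smul, Matrix.fromBlocks_conjTranspose, Matrix.smul_mul,
    Matrix.mul_smul, smul_smul, Matrix.fromBlocks_multiply,
    pauliDot_conjTranspose, ← Matrix.fromBlocks_one, Matrix.fromBlocks_smul,
    Matrix.fromBlocks_smul]
  have e : (star (1 / 2 : ℂ) * (1 / 2)) * ((‖a‖ ^ 2 : ℝ) : ℂ) = (((‖a‖ / 2) ^ 2 : ℝ) : ℂ) := by
    simp; ring
  simp only [pauliDot_sq, Matrix.conjTranspose_zero, zero_mul, mul_zero, add_zero, zero_add,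
    smul_smul, e, smul_zero]

lemma norm_act_beta (u : Spinor) : ‖act beta u‖ = ‖u‖ := by
  have := norm_act_of_conjTranspose_mul (M := beta) zero_le_one
    (by rw [beta_conjTranspose, beta_sq]; simp) u
  simpa using this

lemma norm_act_alpha (j : Fin 3) (u : Spinor) : ‖act (alpha j) u‖ = ‖u‖ := by
  have := norm_act_of_conjTranspose_mul (M := alpha j) zero_le_one
    (by rw [alpha_conjTranspose, alpha_sq]; simp) u
  simpa using this

lemma sum_smul_alpha_mul_alpha (a : R3) :
    ∑ i, (a i : ℂ) • (alpha (i + 1) * alpha (i + 2)) = Complex.I • (2 : ℂ) • spinDot a := by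
  have h : ∀ i, alpha (i + 1) * alpha (i + 2)
      = Complex.I • Matrix.fromBlocks (pauli i) 0 0 (pauli i) := by
    intro i
    simp [alpha, Matrix.fromBlocks_multiply, pauli_cyclic, Matrix.fromBlocks_smul]
  simp only [h, spinDot, spin, Fin.sum_univ_three, smul_add, smul_smul]
  congr 1
  · congr 1 <;> congr 1 <;> ring
  · congr 1; ring

lemma norm_act_sum_alpha_mul_alpha (a : R3) (u : Spinor) :
    ‖act (∑ i, (a i : ℂ) • (alpha (i + 1) * alpha (i + 2))) u‖ = ‖a‖ * ‖u‖ := by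
  rw [sum_smul_alpha_mul_alpha, act_smul, act_smul, norm_smul, norm_smul, norm_act_spinDot]
  simp
  ring

/-- The value of the potential `i β α·p - 2 β S·b`. -/
def potMat (p b : R3) : Mat4 := Complex.I • (beta * alphaDot p) - (2 : ℂ) • (beta * spinDot b)

lemma alphaDot_conjTranspose (a : R3) : (alphaDot a).conjTranspose = alphaDot a := by
  rw [alphaDot_eq, Matrix.fromBlocks_conjTranspose, pauliDot_conjTranspose]; simp

lemma spinDot_conjTranspose (a : R3) : (spinDot a).conjTranspose = spinDot a := by
  rw [spinDot_eq, Matrix.conjTranspose_smul, Matrix.fromBlocks_conjTranspose,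
    pauliDot_conjTranspose]
  simp

lemma alphaDot_beta (a : R3) : alphaDot a * beta = -(beta * alphaDot a) := by
  simp only [alphaDot, Finset.sum_mul, Finset.mul_sum, Matrix.smul_mul, Matrix.mul_smul, alpha_beta,
    smul_neg, Finset.sum_neg_distrib]

lemma spinDot_beta (a : R3) : spinDot a * beta = beta * spinDot a := by
  simp only [spinDot, Finset.sum_mul, Finset.mul_sum, Matrix.smul_mul, Matrix.mul_smul, spin_beta]

lemma potMat_conjTranspose (p b : R3) : (potMat p b).conjTranspose = potMat p b := by
  simp only [potMat, Matrix.conjTranspose_sub, Matrix.conjTranspose_smul,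
    Matrix.conjTranspose_mul, alphaDot_conjTranspose, beta_conjTranspose, spinDot_conjTranspose,
    alphaDot_beta, spinDot_beta]
  simp

lemma norm_act_potMat_le (p b : R3) (u : Spinor) :
    ‖act (potMat p b) u‖ ≤ (‖p‖ + ‖b‖) * ‖u‖ := by
  rw [potMat, act_sub, act_smul, act_smul, act_mul, act_mul]
  refine (norm_sub_le _ _).trans_eq ?_
  rw [norm_smul, norm_smul, norm_act_beta, norm_act_beta, norm_act_alphaDot, norm_act_spinDot]
  simp
  ring

/-- The `α·p` part anticommutes with `β` and the `S·b` part commutes with it, so in `βV + Vβ` the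
first cancels and the second doubles. Hence the mass multiplies only the magnetic field in the
squared equation. -/
lemma beta_mul_potMat_add (p b : R3) :
    beta * potMat p b + potMat p b * beta = -((4 : ℂ) • spinDot b) := by
  have h1 : beta * (beta * alphaDot p) = alphaDot p := by rw [← mul_assoc, beta_sq, one_mul]
  have h2 : beta * (beta * spinDot b) = spinDot b := by rw [← mul_assoc, beta_sq, one_mul]
  have h3 : beta * alphaDot p * beta = -alphaDot p := by
    rw [mul_assoc, alphaDot_beta, mul_neg, h1]
  have h4 : beta * spinDot b * beta = spinDot b := by rw [mul_assoc, spinDot_beta, h2]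
  rw [potMat, mul_sub, sub_mul, Matrix.mul_smul, Matrix.mul_smul, Matrix.smul_mul,
    Matrix.smul_mul, h1, h2, h3, h4]
  module

/-- The Laplacian type contraction of a symmetric tensor with `α_j β α_k`. -/
lemma sum_alpha_beta_alpha {h : Fin 3 → Fin 3 → ℝ} (hs : ∀ j k, h j k = h k j) :
    ∑ j, alpha j * (beta * ∑ k, (h j k : ℂ) • alpha k)
      = -(((∑ j, h j j : ℝ) : ℂ) • beta) := by
  have e : ∀ j k, alpha j * (beta * alpha k) = -(beta * (alpha j * alpha k)) := fun j k => by
    rw [← mul_assoc, alpha_beta, neg_mul, mul_assoc]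
  have a10 : alpha 1 * alpha 0 = -(alpha 0 * alpha 1) := alpha_anticomm (by decide)
  have a20 : alpha 2 * alpha 0 = -(alpha 0 * alpha 2) := alpha_anticomm (by decide)
  have a21 : alpha 2 * alpha 1 = -(alpha 1 * alpha 2) := alpha_anticomm (by decide)
  simp only [Fin.sum_univ_three, mul_add, Matrix.mul_smul, e, alpha_sq, a10, a20, a21, hs 1 0,
    hs 2 0, hs 2 1, mul_one, mul_neg]
  push_cast
  module

/-- The axial vector of the antisymmetric part of a tensor. -/
def axial (b : Fin 3 → Fin 3 → ℝ) : R3 :=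
  !₂[b 1 2 - b 2 1, b 2 0 - b 0 2, b 0 1 - b 1 0]

/-- The symmetric part of `σ_jσ_k` is `δ_jk`, which sees only the trace; what remains is the
antisymmetric part. For the Jacobian of `B` this is the curl. -/
lemma sum_pauli_mul_pauli {b : Fin 3 → Fin 3 → ℝ} (ht : ∑ j, b j j = 0) :
    ∑ j, ∑ k, (b j k : ℂ) • (pauli j * pauli k) = Complex.I • pauliDot (axial b) := by
  have p01 : pauli 0 * pauli 1 = Complex.I • pauli 2 := pauli_cyclic 2
  have p12 : pauli 1 * pauli 2 = Complex.I • pauli 0 := pauli_cyclic 0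
  have p20 : pauli 2 * pauli 0 = Complex.I • pauli 1 := pauli_cyclic 1
  have p10 : pauli 1 * pauli 0 = -(Complex.I • pauli 2) := by
    rw [pauli_anticomm (by decide), p01]
  have p21 : pauli 2 * pauli 1 = -(Complex.I • pauli 0) := by
    rw [pauli_anticomm (by decide), p12]
  have p02 : pauli 0 * pauli 2 = -(Complex.I • pauli 1) := by
    rw [pauli_anticomm (by decide), p20]
  have ht' : (b 2 2 : ℂ) = -(b 0 0 : ℂ) - (b 1 1 : ℂ) := by
    rw [Fin.sum_univ_three] at ht
    have : b 2 2 = -b 0 0 - b 1 1 := by linarith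
    rw [this]; push_cast; ring
  simp only [Fin.sum_univ_three, pauliDot, axial, pauli_sq, p01, p12, p20, p10, p21, p02, ht']
  simp
  module

lemma norm_sum_alpha_beta_spin {b : Fin 3 → Fin 3 → ℝ} (ht : ∑ j, b j j = 0) (u : Spinor) :
    ‖act ((2 : ℂ) • ∑ j, alpha j * (beta * ∑ k, (b j k : ℂ) • spin k)) u‖
      = ‖axial b‖ * ‖u‖ := by
  have e : (2 : ℂ) • ∑ j, alpha j * (beta * ∑ k, (b j k : ℂ) • spin k)
      = Matrix.fromBlocks 0 (-(Complex.I • pauliDot (axial b)))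
        (Complex.I • pauliDot (axial b)) 0 := by
    rw [← sum_pauli_mul_pauli ht]
    have e1 : ∀ j k, alpha j * (beta * spin k) = (1 / 2 : ℂ) • Matrix.fromBlocks 0
        (-(pauli j * pauli k)) (pauli j * pauli k) 0 := by
      intro j k
      simp [alpha, beta, spin, Matrix.fromBlocks_multiply, Matrix.fromBlocks_smul]
    simp only [Finset.mul_sum, Matrix.mul_smul, e1, Finset.smul_sum, smul_smul]
    have e2 : ∀ j k, ((2 : ℂ) * ((b j k : ℂ) * (1 / 2))) = b j k := fun j k => by ring
    simp only [e2, Fin.sum_univ_three, Matrix.fromBlocks_smul, Matrix.fromBlocks_add]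
    simp
    abel
  rw [e]
  refine norm_act_of_conjTranspose_mul (norm_nonneg _) ?_ u
  rw [Matrix.fromBlocks_conjTranspose, Matrix.fromBlocks_multiply, ← Matrix.fromBlocks_one,
    Matrix.fromBlocks_smul]
  simp [pauliDot_conjTranspose, pauliDot_sq, smul_smul]
  rw [← mul_assoc, Complex.I_mul_I, neg_one_mul, neg_smul, neg_neg]

/-- The antisymmetric part of `T` acts as a cross product with its axial vector `c`. For nonzero `y
⟂ c` and `z = c × y`, one has `⟪z, T y⟫ - ⟪y, T z⟫ = |c|²|y|²`, while the operator norm bounds the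
left side by `2‖T‖|c||y|²`. -/
lemma norm_axial_le (T : R3 →L[ℝ] R3) :
    ‖axial fun j k => T (EuclideanSpace.single j (1 : ℝ)) k‖ ≤ 2 * ‖T‖ := by
  set b : Fin 3 → Fin 3 → ℝ := fun j k => T (EuclideanSpace.single j (1 : ℝ)) k with hb
  set c := axial b with hc
  have expand : ∀ y : R3, ∀ k, T y k = ∑ j, y j * b j k := by
    intro y k
    have : y = ∑ j, y j • EuclideanSpace.single j (1 : ℝ) := by
      ext i
      simp [Fin.sum_univ_three]
      fin_cases i <;> simp
    conv_lhs => rw [this]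
    simp [map_sum, hb]
  have nsq : ∀ y : R3, ‖y‖ ^ 2 = y 0 ^ 2 + y 1 ^ 2 + y 2 ^ 2 := fun y => by
    rw [← sum_coord_sq, Fin.sum_univ_three]
  obtain ⟨y, hy0, hyc⟩ : ∃ y : R3, y ≠ 0 ∧ c 0 * y 0 + c 1 * y 1 + c 2 * y 2 = 0 := by
    by_cases h : c 0 = 0 ∧ c 1 = 0
    · refine ⟨EuclideanSpace.single 0 1, by simp, by simp [h.1]⟩
    · refine ⟨!₂[-c 1, c 0, 0], fun h0 => h ?_, ?_⟩
      · have h1 := congrArg (fun z : R3 => z 0) h0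
        have h2 := congrArg (fun z : R3 => z 1) h0
        simp at h1 h2
        exact ⟨h2, h1⟩
      · simp; ring
  set z : R3 := !₂[c 1 * y 2 - c 2 * y 1, c 2 * y 0 - c 0 * y 2, c 0 * y 1 - c 1 * y 0] with hz
  have z0 : z 0 = c 1 * y 2 - c 2 * y 1 := rfl
  have z1 : z 1 = c 2 * y 0 - c 0 * y 2 := rfl
  have z2 : z 2 = c 0 * y 1 - c 1 * y 0 := rfl
  have c0 : c 0 = b 1 2 - b 2 1 := rfl
  have c1 : c 1 = b 2 0 - b 0 2 := rfl
  have c2 : c 2 = b 0 1 - b 1 0 := rfl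
  have hzn : ‖z‖ ^ 2 = (‖c‖ * ‖y‖) ^ 2 := by
    rw [mul_pow, nsq, nsq, nsq, z0, z1, z2]
    linear_combination -(c 0 * y 0 + c 1 * y 1 + c 2 * y 2) * hyc
  have hzn' : ‖z‖ = ‖c‖ * ‖y‖ :=
    (sq_eq_sq₀ (norm_nonneg _) (by positivity)).1 hzn
  have key : ⟪z, T y⟫_ℝ - ⟪y, T z⟫_ℝ = ‖c‖ ^ 2 * ‖y‖ ^ 2 := by
    have i1 : ∀ p q : R3, ⟪p, q⟫_ℝ = p 0 * q 0 + p 1 * q 1 + p 2 * q 2 := fun p q => by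
      simp [PiLp.inner_apply, Fin.sum_univ_three]; ring
    have l : ⟪z, T y⟫_ℝ - ⟪y, T z⟫_ℝ = c 0 * (y 1 * z 2 - y 2 * z 1)
        + c 1 * (y 2 * z 0 - y 0 * z 2) + c 2 * (y 0 * z 1 - y 1 * z 0) := by
      simp only [i1, expand, Fin.sum_univ_three]
      rw [c0, c1, c2]
      ring
    rw [l, nsq, nsq, z0, z1, z2]
    linear_combination -(c 0 * y 0 + c 1 * y 1 + c 2 * y 2) * hyc
  have b1 : ⟪z, T y⟫_ℝ ≤ ‖z‖ * (‖T‖ * ‖y‖) :=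
    (real_inner_le_norm _ _).trans (mul_le_mul_of_nonneg_left (T.le_opNorm y) (norm_nonneg _))
  have b2 : -⟪y, T z⟫_ℝ ≤ ‖y‖ * (‖T‖ * ‖z‖) := by
    refine (neg_le_abs _).trans ((abs_real_inner_le_norm _ _).trans ?_)
    exact mul_le_mul_of_nonneg_left (T.le_opNorm z) (norm_nonneg _)
  have hy : 0 < ‖y‖ := norm_pos_iff.2 hy0
  rw [hzn'] at b1 b2
  by_cases hc0 : ‖c‖ = 0
  · rw [hc0]; positivity
  · have hcp : 0 < ‖c‖ := lt_of_le_of_ne (norm_nonneg _) (Ne.symm hc0)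
    have : (‖c‖ * ‖y‖ ^ 2) * ‖c‖ ≤ (‖c‖ * ‖y‖ ^ 2) * (2 * ‖T‖) := by nlinarith
    exact le_of_mul_le_mul_left this (by positivity)

/-- Differentiating the first order equation: the pointwise bound for the effective potential. -/
lemma norm_squared_equation_le (m : ℝ) (hm : 0 ≤ m) (μ : ℂ) (p b : R3) {h : Fin 3 → Fin 3 → ℝ}
    (hs : ∀ j k, h j k = h k j) (T : R3 →L[ℝ] R3)
    (hT : ∑ j, T (EuclideanSpace.single j (1 : ℝ)) j = 0) (y : Spinor) (q : Fin 3 → Spinor)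
    (V' : Fin 3 → Mat4)
    (hV' : ∀ j, V' j = Complex.I • (beta * ∑ k, (h j k : ℂ) • alpha k)
      - (2 : ℂ) • (beta * ∑ k, (T (EuclideanSpace.single j (1 : ℝ)) k : ℂ) • spin k))
    (heq : (-Complex.I) • ∑ j, act (alpha j) (q j) + (m : ℂ) • act beta y + act (potMat p b) y
      = μ • y) :
    ‖(-Complex.I) • ∑ j, act (alpha j) (μ • q j - (m : ℂ) • act beta (q j)
        - act (potMat p b) (q j) - act (V' j) y) - (μ ^ 2 - (m : ℂ) ^ 2) • y‖
      ≤ 2 * (‖p‖ + ‖b‖) * ∑ j, ‖q j‖ + |∑ j, h j j| * ‖y‖ + 2 * ‖T‖ * ‖y‖ + 2 * m * ‖b‖ * ‖y‖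
        + (‖p‖ + ‖b‖) ^ 2 * ‖y‖ := by
  set V := potMat p b with hV
  set d := (-Complex.I) • ∑ j, act (alpha j) (q j) with hd
  have hd' : d = μ • y - (m : ℂ) • act beta y - act V y := by rw [← heq]; abel
  -- Pull `-iα·∇_A` through `μ - mβ - V`: `β` changes sign, `V` leaves the anticommutator `α_jV +
  -- Vα_j`, and the product rule leaves `α_j ∂_jV`.
  have e1 : (-Complex.I) • ∑ j, act (alpha j) (μ • q j - (m : ℂ) • act beta (q j)
        - act V (q j) - act (V' j) y)
      = μ • d + (m : ℂ) • act beta d + act V d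
        + Complex.I • ∑ j, (act (alpha j) (act V (q j)) + act V (act (alpha j) (q j)))
        + Complex.I • act (∑ j, alpha j * V' j) y := by
    have ab : ∀ j, act (alpha j) (act beta (q j)) = -act beta (act (alpha j) (q j)) := fun j => by
      rw [← act_mul, alpha_beta, act_neg, act_mul]
    simp only [hd, map_sub, map_smul, map_add, ab, act_add, act_mul,
      Fin.sum_univ_three, smul_sub, smul_add, smul_neg]
    module
  -- The difference of squares `(μ + (mβ + V))(μ - (mβ + V))`, using `β² = 1`.
  have e2 : μ • d + (m : ℂ) • act beta d + act V d
      = (μ ^ 2 - (m : ℂ) ^ 2) • y - (m : ℂ) • act (beta * V + V * beta) y - act V (act V y) := by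
    have bb : act beta (act beta y) = y := by rw [← act_mul, beta_sq, act_one]
    rw [hd']
    simp only [map_sub, map_smul, bb, act_add, act_mul]
    module
  have e3 : ∑ j, alpha j * V' j = -((Complex.I * ((∑ j, h j j : ℝ) : ℂ)) • beta)
      - (2 : ℂ) • ∑ j, alpha j * (beta * ∑ k, (T (EuclideanSpace.single j (1 : ℝ)) k : ℂ) • spin k) := by
    have := sum_alpha_beta_alpha hs
    simp only [hV', mul_sub, Matrix.mul_smul, Finset.sum_sub_distrib, ← Finset.smul_sum]
    rw [this]
    module
  rw [e1, e2, e3]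
  have n1 : ‖Complex.I • ∑ j, (act (alpha j) (act V (q j)) + act V (act (alpha j) (q j)))‖
      ≤ 2 * (‖p‖ + ‖b‖) * ∑ j, ‖q j‖ := by
    rw [norm_smul, Complex.norm_I, one_mul, Finset.mul_sum]
    refine norm_sum_le_of_le _ fun j _ => (norm_add_le _ _).trans ?_
    have a1 : ‖act (alpha j) (act V (q j))‖ ≤ (‖p‖ + ‖b‖) * ‖q j‖ := by
      rw [norm_act_alpha]; exact norm_act_potMat_le p b _
    have a2 : ‖act V (act (alpha j) (q j))‖ ≤ (‖p‖ + ‖b‖) * ‖q j‖ := by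
      refine (norm_act_potMat_le p b _).trans_eq ?_
      rw [norm_act_alpha]
    linarith
  have n2 : ‖(Complex.I * ((∑ j, h j j : ℝ) : ℂ)) • act beta y‖ = |∑ j, h j j| * ‖y‖ := by
    rw [norm_smul, norm_mul, Complex.norm_I, one_mul, Complex.norm_real, norm_act_beta,
      Real.norm_eq_abs]
  have n3 : ‖act ((2 : ℂ) • ∑ j, alpha j * (beta * ∑ k,
      (T (EuclideanSpace.single j (1 : ℝ)) k : ℂ) • spin k)) y‖ ≤ 2 * ‖T‖ * ‖y‖ := by
    rw [norm_sum_alpha_beta_spin hT]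
    exact mul_le_mul_of_nonneg_right (norm_axial_le T) (norm_nonneg _)
  have n4 : ‖(m : ℂ) • act (beta * V + V * beta) y‖ = 2 * m * ‖b‖ * ‖y‖ := by
    rw [hV, beta_mul_potMat_add, act_neg, act_smul, norm_smul, norm_neg, norm_smul,
      norm_act_spinDot, Complex.norm_real, Real.norm_of_nonneg hm]
    norm_num
    ring
  have n5 : ‖act V (act V y)‖ ≤ (‖p‖ + ‖b‖) ^ 2 * ‖y‖ := by
    refine (norm_act_potMat_le p b _).trans ?_
    rw [sq, mul_assoc]
    exact mul_le_mul_of_nonneg_left (norm_act_potMat_le p b _) (by positivity)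
  rw [act_sub, act_neg, act_smul _ beta]
  set t1 := Complex.I • ∑ j, (act (alpha j) (act V (q j)) + act V (act (alpha j) (q j)))
  set t2 := (Complex.I * ((∑ j, h j j : ℝ) : ℂ)) • act beta y
  set t3 := act ((2 : ℂ) • ∑ j, alpha j * (beta * ∑ k,
      (T (EuclideanSpace.single j (1 : ℝ)) k : ℂ) • spin k)) y
  set t4 := (m : ℂ) • act (beta * V + V * beta) y
  set t5 := act V (act V y)
  have e : (μ ^ 2 - (m : ℂ) ^ 2) • y - t4 - t5 + t1 + Complex.I • (-t2 - t3)
      - (μ ^ 2 - (m : ℂ) ^ 2) • y = t1 + -(Complex.I • t2) + -(Complex.I • t3) + -t4 + -t5 := by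
    rw [smul_sub, smul_neg]; abel
  rw [e]
  have nI : ∀ t : Spinor, ‖-(Complex.I • t)‖ = ‖t‖ := fun t => by
    rw [norm_neg, norm_smul, Complex.norm_I, one_mul]
  refine (norm_add_le _ _).trans (add_le_add ((norm_add_le _ _).trans (add_le_add
    ((norm_add_le _ _).trans (add_le_add ((norm_add_le _ _).trans (add_le_add n1 ?_)) ?_)) ?_)) ?_)
  · rw [nI, n2]
  · rw [nI]; exact n3
  · rw [norm_neg, n4]
  · rw [norm_neg]; exact n5

/-! ### Products of weakly differentiable functions and `H¹` functions -/

section Leibniz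

variable {F : Type*} [NormedAddCommGroup F] [NormedSpace ℝ F]

lemma partialD_clm_comp {χ : R3 → F} (hχ : ContDiff ℝ ∞ χ) (T : F →L[ℝ] ℝ) (j : Fin 3) (x : R3) :
    partialD j (fun y => T (χ y)) x = T (dirDeriv j χ x) := by
  have := T.hasFDerivAt.comp x (hχ.differentiable (by simp) x).hasFDerivAt
  rw [partialD]
  erw [this.fderiv]
  rfl

/-- Here the smooth factor is vector valued, so `ηχ` is not an admissible scalar test function.
Applying a continuous functional `T` first makes `η T(χ)` one, and such functionals separate points.
-/
lemma HasWeakPartial.smul_smooth [CompleteSpace F] {j : Fin 3} {b db : R3 → ℝ} (h : HasWeakPartial j b db)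
    {χ : R3 → F} (hχ : ContDiff ℝ ∞ χ) :
    HasWeakPartial j (fun x => b x • χ x) (fun x => db x • χ x + b x • dirDeriv j χ x) := by
  have l1 := h.1.smul_continuous hχ.continuous
  have l2 := h.2.1.smul_continuous hχ.continuous
  have l3 := h.1.smul_continuous (contDiff_dirDeriv hχ j).continuous
  refine ⟨l1, l2.add l3, fun η hη => ?_⟩
  have i1 := l1.integrable_smul_left_of_hasCompactSupport (hη.partialD_cont j) (hη.partialD_supp j)
  have i2 : Integrable fun x => η x • (db x • χ x + b x • dirDeriv j χ x) :=
    (l2.add l3).integrable_smul_left_of_hasCompactSupport hη.1.continuous hη.2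
  rw [SeparatingDual.eq_iff_forall_dual_eq (R := ℝ)]
  intro T
  have hT : ContDiff ℝ ∞ fun x => T (χ x) := T.contDiff.comp hχ
  have ht := hη.mul_contDiff hT
  have e := h.2.2 _ ht
  have pd : ∀ x, partialD j (fun y => η y * T (χ y)) x
      = partialD j η x * T (χ x) + η x * T (dirDeriv j χ x) := fun x => by
    rw [partialD_mul j x (hη.1.differentiable (by simp) x) (hT.differentiable (by simp) x),
      partialD_clm_comp hχ]
  have j1 : Integrable fun x => partialD j η x * T (χ x) * b x := by
    refine (T.integrable_comp i1).congr (.of_forall fun x => ?_)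
    simp only [map_smul, smul_eq_mul]; ring
  have j3 : Integrable fun x => η x * T (dirDeriv j χ x) * b x := by
    refine (T.integrable_comp (l3.integrable_smul_left_of_hasCompactSupport
      hη.1.continuous hη.2)).congr (.of_forall fun x => ?_)
    simp only [map_smul, smul_eq_mul]; ring
  have j2 : Integrable fun x => η x * T (χ x) * db x := by
    refine (T.integrable_comp (l2.integrable_smul_left_of_hasCompactSupport
      hη.1.continuous hη.2)).congr (.of_forall fun x => ?_)
    simp only [map_smul, smul_eq_mul]; ring
  simp only [smul_eq_mul, pd, add_mul] at e
  rw [integral_add j1 j3] at e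
  rw [map_neg, ← T.integral_comp_comm i1, ← T.integral_comp_comm i2]
  have e1 : ∫ x, T (partialD j η x • b x • χ x) = ∫ x, partialD j η x * T (χ x) * b x := by
    refine integral_congr_ae (.of_forall fun x => ?_)
    simp only [map_smul, smul_eq_mul]; ring
  have e2 : ∫ x, T (η x • (db x • χ x + b x • dirDeriv j χ x))
      = (∫ x, η x * T (χ x) * db x) + ∫ x, η x * T (dirDeriv j χ x) * b x := by
    rw [← integral_add j2 j3]
    refine integral_congr_ae (.of_forall fun x => ?_)
    simp only [map_smul, smul_eq_mul, map_add]; ring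
  rw [e1, e2]
  linarith

end Leibniz

lemma memLp_of_ae_bdd {b : R3 → ℝ} (hm : AEStronglyMeasurable b) {C : ℝ}
    (hC : ∀ᵐ x, |b x| ≤ C) {f : R3 → Spinor} (hf : MemLp f 2) : MemLp (fun x => b x • f x) 2 := by
  refine MemLp.of_le_mul (c := C) hf (hm.smul hf.1) ?_
  filter_upwards [hC] with x hx
  rw [norm_smul]
  exact mul_le_mul_of_nonneg_right hx (norm_nonneg _)

lemma tendsto_mulL_of_bdd {b : R3 → ℝ} (hm : AEStronglyMeasurable b) {C : ℝ}
    (hC : ∀ᵐ x, |b x| ≤ C) {c : ℕ → L2} {ψ : L2} (h : Tendsto c atTop (𝓝 ψ)) :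
    Tendsto (fun n => mulL b (c n)) atTop (𝓝 (mulL b ψ)) := by
  have hmem : ∀ f : L2, MemLp (fun x => b x • f x) 2 := fun f => memLp_of_ae_bdd hm hC (Lp.memLp f)
  rw [tendsto_iff_norm_sub_tendsto_zero] at h ⊢
  have h' : Tendsto (fun n => C * ‖c n - ψ‖) atTop (𝓝 0) := by simpa using h.const_mul C
  refine squeeze_zero (fun _ => norm_nonneg _) (fun n => ?_) h'
  have e : c n = (c n - ψ) + ψ := by abel
  have e2 : mulL b (c n) - mulL b ψ = mulL b (c n - ψ) := by
    conv_lhs => rw [e]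
    rw [mulL_add (hmem _) (hmem _), add_sub_cancel_right]
  rw [e2]
  refine Lp.norm_le_mul_norm_of_ae_le_mul ?_
  filter_upwards [mulL_coe (hmem (c n - ψ)), hC] with x h1 h2
  rw [h1, norm_smul]
  exact mul_le_mul_of_nonneg_right h2 (norm_nonneg _)

/-- A bounded weakly differentiable function whose derivatives map `H¹` to `L²`. -/
structure WeakWeight (b : R3 → ℝ) (db : Fin 3 → R3 → ℝ) : Prop where
  weak : ∀ j, HasWeakPartial j b (db j)
  bdd : ∃ C : ℝ, ∀ᵐ x, |b x| ≤ C
  mult : ∀ j, ∀ ψ ∈ H1, MemLp (fun x => db j x • (ψ : L2) x) 2 volume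

section WeakWeight

variable {b : R3 → ℝ} {db : Fin 3 → R3 → ℝ} (hb : WeakWeight b db)

include hb

lemma WeakWeight.meas : AEStronglyMeasurable b volume := (hb.weak 0).1.aestronglyMeasurable

lemma WeakWeight.memLp {f : R3 → Spinor} (hf : MemLp f 2) : MemLp (fun x => b x • f x) 2 := by
  obtain ⟨C, hC⟩ := hb.bdd
  exact memLp_of_ae_bdd hb.meas hC hf

lemma WeakWeight.coe (ψ : L2) : mulL b ψ =ᵐ[volume] fun x => b x • ψ x :=
  mulL_coe (hb.memLp (Lp.memLp ψ))

/-- Approximate `ψ` by smooth functions. The term with `b` converges because `b` is bounded, the one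
with its derivative because multipliers from `H¹` to `L²` are automatically continuous. -/
lemma WeakWeight.hasWeakPartial {ψ : L2} (hψ : ψ ∈ H1) (j : Fin 3) :
    HasWeakPartial j (mulL b ψ : R3 → Spinor) (mulL (db j) ψ + mulL b (weakPartial j ψ) : L2) := by
  obtain ⟨C, hC⟩ := hb.bdd
  obtain ⟨c, c1, c2⟩ := exists_smooth_tendsto hψ
  refine hasWeakPartial_of_tendsto (tendsto_mulL_of_bdd hb.meas hC c2.tendsto)
    ((c2.mulL (hb.mult j)).add (tendsto_mulL_of_bdd hb.meas hC (c2.tendsto_partial j))) fun n => ?_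
  have hH := (c1 n).mem_H1
  obtain ⟨χ, h1, h2, h3⟩ := c1 n
  refine ((hb.weak j).smul_smooth h1).congr ?_ ?_
  · filter_upwards [hb.coe (c n), h3] with x a b
    rw [a, b]
  · filter_upwards [hb.coe (weakPartial j (c n)), h3, mulL_coe (hb.mult j (c n) hH),
      weakPartial_ae hH (hasWeakPartial_smooth h1 h3 j),
      Lp.coeFn_add (mulL (db j) (c n)) (mulL b (weakPartial j (c n)))] with x a b c d e
    rw [e, Pi.add_apply, a, c, d, b]

lemma WeakWeight.mulL_mem_H1 {ψ : L2} (hψ : ψ ∈ H1) : mulL b ψ ∈ H1 :=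
  fun j => ⟨_, hb.hasWeakPartial hψ j⟩

lemma WeakWeight.magD_coe {A : R3 → R3} (hA : Admissible A) {ψ : L2} (hψ : ψ ∈ H1) (j : Fin 3) :
    magD A j (mulL b ψ) =ᵐ[volume] fun x => db j x • ψ x + b x • magD A j ψ x := by
  have hv := hb.mulL_mem_H1 hψ
  filter_upwards [MagneticDirac.magD_coe hA j hv, MagneticDirac.magD_coe hA j hψ,
    weakPartial_ae hv (hb.hasWeakPartial hψ j), hb.coe ψ, hb.coe (weakPartial j ψ),
    mulL_coe (hb.mult j ψ hψ), Lp.coeFn_add (mulL (db j) ψ) (mulL b (weakPartial j ψ))]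
    with x a b' c d e f g
  rw [a, b', magPartial, magPartial, c, g, Pi.add_apply, d, e, f, smul_sub, smul_comm (b x),
    add_sub_assoc]

end WeakWeight

/-! ### Functions smooth away from the origin -/

lemma IsTest.mul_of_contDiffOn {ζ g : R3 → ℝ} (hζ : IsTest ζ) (h0 : (0 : R3) ∉ tsupport ζ)
    (hg : ContDiffOn ℝ ∞ g {0}ᶜ) : IsTest fun x => ζ x * g x := by
  refine ⟨contDiff_iff_contDiffAt.2 fun x => ?_, hζ.2.mul_right⟩
  by_cases hx : x = 0
  · have : (fun x => ζ x * g x) =ᶠ[𝓝 x] fun _ => 0 := by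
      rw [hx]
      filter_upwards [notMem_tsupport_iff_eventuallyEq.1 h0] with y hy
      simp [hy]
    exact contDiffAt_const.congr_of_eventuallyEq this
  · exact hζ.1.contDiffAt.mul (hg.contDiffAt (isOpen_compl_singleton.mem_nhds hx))

lemma contDiffOn_partialD {g : R3 → ℝ} (hg : ContDiffOn ℝ ∞ g {0}ᶜ) (k : Fin 3) :
    ContDiffOn ℝ ∞ (partialD k g) {0}ᶜ := by
  have := hg.fderiv_of_isOpen (m := ∞) isOpen_compl_singleton (by simp)
  exact this.clm_apply contDiffOn_const

lemma gradient_apply (g : R3 → ℝ) (x : R3) (j : Fin 3) : gradient g x j = partialD j g x := by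
  have h : ⟪gradient g x, EuclideanSpace.single j (1 : ℝ)⟫_ℝ = partialD j g x := by
    rw [gradient, InnerProductSpace.toDual_symm_apply]; rfl
  rw [← h, EuclideanSpace.inner_single_right]; simp

lemma laplacian_eq_sum {g : R3 → ℝ} {x : R3} (hg : ContDiffAt ℝ 2 g x) :
    Laplacian.laplacian g x = ∑ j, partialD j (partialD j g) x := by
  rw [InnerProductSpace.laplacian_eq_iteratedFDeriv_orthonormalBasis g
    (EuclideanSpace.basisFun (Fin 3) ℝ)]
  refine Finset.sum_congr rfl fun j _ => ?_
  have hd : DifferentiableAt ℝ (fderiv ℝ g) x :=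
    (hg.fderiv_right (m := 1) (by norm_num)).differentiableAt (by norm_num)
  rw [iteratedFDeriv_two_apply]
  show _ = fderiv ℝ (fun y => fderiv ℝ g y (EuclideanSpace.single j (1 : ℝ))) x _
  rw [fderiv_clm_apply hd (differentiableAt_const _)]
  simp

/-! ### The magnetic field is divergence free -/

/-- The divergence of a curl vanishes: tested against `η`, it is `A` paired with an antisymmetrized
Hessian of `η`. -/
lemma ae_trace_eq_zero {A B : R3 → R3} {DB : R3 → R3 →L[ℝ] R3}
    (hA : ∀ j, LocallyIntegrable fun x => A x j)
    (hcurl : IsWeakCurl A B) (hDB : IsWeakJacobian B DB) :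
    ∀ᵐ x, ∑ j, DB x (EuclideanSpace.single j (1 : ℝ)) j = 0 := by
  have hc : ∀ j, HasWeakPartial j (fun x => B x j)
      (fun x => DB x (EuclideanSpace.single j (1 : ℝ)) j) := fun j =>
    (hDB j).clm (EuclideanSpace.proj (𝕜 := ℝ) j : R3 →L[ℝ] ℝ)
  have hl : LocallyIntegrable fun x => ∑ j, DB x (EuclideanSpace.single j (1 : ℝ)) j := by
    simp only [Fin.sum_univ_three]
    exact ((hc 0).2.1.add (hc 1).2.1).add (hc 2).2.1
  refine ae_eq_zero_of_integral_contDiff_smul_eq_zero hl fun η h1 h2 => ?_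
  have hη : IsTest η := ⟨h1, h2⟩
  have int : ∀ j k l, Integrable fun x => A x j * partialD k (partialD l η) x := fun j k l => by
    have := (hA j).integrable_smul_right_of_hasCompactSupport
      (((hη.partialD l).partialD k).1.continuous) ((hη.partialD l).partialD k).2
    simpa using this
  have e : ∀ j, ∫ x, η x • DB x (EuclideanSpace.single j (1 : ℝ)) j
      = (∫ x, A x (j + 2) * partialD (j + 1) (partialD j η) x)
        - ∫ x, A x (j + 1) * partialD (j + 2) (partialD j η) x := by
    intro j
    have a := (hc j).2.2 η hη
    have b := hcurl _ (hη.partialD j) j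
    simp only [smul_eq_mul] at a ⊢
    rw [integral_sub (int _ _ _) (int _ _ _)] at b
    linarith
  have comm : ∀ k l, partialD k (partialD l η) = partialD l (partialD k η) := fun k l => by
    ext x; exact partialD_comm (h1.contDiffAt.of_le (by norm_cast)) k l
  have ii := fun j => (hc j).2.1.integrable_smul_left_of_hasCompactSupport h1.continuous h2
  simp only [Fin.sum_univ_three, smul_add]
  have s1 := ii 0
  have s2 := ii 1
  have s3 := ii 2
  rw [integral_add (f := fun x => η x • DB x (EuclideanSpace.single 0 (1 : ℝ)) 0
    + η x • DB x (EuclideanSpace.single 1 (1 : ℝ)) 1) (s1.add s2) s3, integral_add s1 s2, e, e, e]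
  have e0 : (0 : Fin 3) + 1 = 1 := rfl
  have e1 : (0 : Fin 3) + 2 = 2 := rfl
  have e2 : (1 : Fin 3) + 1 = 2 := rfl
  have e3 : (1 : Fin 3) + 2 = 0 := rfl
  have e4 : (2 : Fin 3) + 1 = 0 := rfl
  have e5 : (2 : Fin 3) + 2 = 1 := rfl
  simp only [e0, e1, e2, e3, e4, e5, comm 1 0, comm 2 0, comm 2 1]
  ring

/-! ### Admissibility and multiplier bounds -/

lemma L2Loc.locallyIntegrable {F : Type*} [NormedAddCommGroup F] {f : R3 → F} (h : L2Loc f) :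
    LocallyIntegrable f := by
  rw [locallyIntegrable_iff]
  intro K hK
  have : IsFiniteMeasure ((volume : Measure R3).restrict K) :=
    ⟨by rw [Measure.restrict_apply_univ]; exact hK.measure_lt_top⟩
  exact (h K hK).integrable (by norm_num)

lemma LocallyIntegrable.coord {f : R3 → R3} (h : LocallyIntegrable f) (j : Fin 3) :
    LocallyIntegrable fun x => f x j := by
  rw [locallyIntegrable_iff] at h ⊢
  exact fun K hK => (EuclideanSpace.proj (𝕜 := ℝ) j : R3 →L[ℝ] ℝ).integrable_comp (h K hK)

/-- The equation for `H_m(A,0)ψ` solved for `(α·A)ψ`, the one term not yet known to be square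
integrable. -/
lemma diracFun_zero (m : ℝ) (A : R3 → R3) (ψ : L2) (x : R3) :
    act (alphaDot (A x)) (ψ x) = (-Complex.I) • ∑ j, act (alpha j) (weakPartial j ψ x)
      + (m : ℂ) • act beta (ψ x) - diracFun m A 0 ψ x := by
  have h0 : act ((0 : R3 → Mat4) x) (ψ x) = 0 := act_zero _
  simp only [diracFun, magPartial, h0, alphaDot, map_sub, map_smul, act_sum, act_smul,
    Finset.sum_sub_distrib, smul_sub, mul_smul, ← Finset.smul_sum]
  rw [smul_smul (-Complex.I), neg_mul, Complex.I_mul_I, neg_neg, one_smul]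
  abel

/-- If all of `H¹` is the domain, then `(α·A)ψ` is a difference of `L²` functions. Its pointwise
norm is `|A||ψ|`, so each component of `A` is a multiplier. -/
lemma admissible_of_domain {m : ℝ} {A : R3 → R3} (hA : LocallyIntegrable A)
    (hdom : (diracOp m A 0).domain = H1) : Admissible A := by
  intro j ψ hψ
  have hd : ψ ∈ diracDomain m A 0 := by
    have : ψ ∈ (diracOp m A 0).domain := by rw [hdom]; exact hψ
    exact this
  have h1 : MemLp (fun x => act (alphaDot (A x)) (ψ x)) 2 volume := by
    simp only [diracFun_zero m A ψ]
    refine MemLp.sub (MemLp.add ?_ ?_) hd.2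
    · exact (memLp_finsetSum _ fun j _ => memLp_act (Lp.memLp (weakPartial j ψ)) _).const_smul
        (-Complex.I)
    · exact (memLp_act (Lp.memLp ψ) _).const_smul (m : ℂ)
  refine h1.of_le ?_ (.of_forall fun x => ?_)
  · exact (LocallyIntegrable.coord hA j).aestronglyMeasurable.smul (Lp.aestronglyMeasurable ψ)
  · rw [norm_act_alphaDot, norm_smul]
    exact mul_le_mul_of_nonneg_right (abs_coord_le _ _) (norm_nonneg _)

lemma magGradSq_eq {A : R3 → R3} (hA : Admissible A) {ψ : L2} (hψ : ψ ∈ H1) :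
    magGradSq A ψ = ENNReal.ofReal (gradSq A ψ) := by
  rw [magGradSq, gradSq, ENNReal.ofReal_sum_of_nonneg fun _ _ => sq_nonneg _]
  refine Finset.sum_congr rfl fun j _ => ?_
  rw [← lintegral_norm_sq]
  refine lintegral_congr_ae ?_
  filter_upwards [magD_coe hA j hψ] with x hx
  rw [hx]

section Multiplier

variable {E : Type*} [NormedAddCommGroup E] {A : R3 → R3} {K : R3 → E} {ε : ℝ} {ψ : L2}

lemma lintegral_multiplier_le (hA : Admissible A) (hψ : ψ ∈ H1)
    (h : ∫⁻ x, ‖x‖ₑ ^ 2 * ‖K x‖ₑ ^ 2 * ‖ψ x‖ₑ ^ 2 ≤ ENNReal.ofReal (ε ^ 2) * magGradSq A ψ) :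
    ∫⁻ x, ‖(‖x‖ * ‖K x‖) • ψ x‖ₑ ^ 2 ≤ ENNReal.ofReal (ε ^ 2 * gradSq A ψ) := by
  rw [ENNReal.ofReal_mul (sq_nonneg _), ← magGradSq_eq hA hψ]
  refine le_trans (le_of_eq (lintegral_congr fun x => ?_)) h
  rw [enorm_smul, enorm_mul, enorm_norm, enorm_norm, mul_pow, mul_pow]

lemma memLp_multiplier (hA : Admissible A) (hψ : ψ ∈ H1) (hK : AEStronglyMeasurable K)
    (h : ∫⁻ x, ‖x‖ₑ ^ 2 * ‖K x‖ₑ ^ 2 * ‖ψ x‖ₑ ^ 2 ≤ ENNReal.ofReal (ε ^ 2) * magGradSq A ψ) :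
    MemLp (fun x => (‖x‖ * ‖K x‖) • ψ x) 2 := by
  refine ⟨(continuous_norm.aestronglyMeasurable.mul hK.norm).smul (Lp.aestronglyMeasurable ψ), ?_⟩
  have h' := lintegral_multiplier_le hA hψ h
  rw [← eLpNorm_two_sq] at h'
  by_contra hc
  rw [not_lt, top_le_iff] at hc
  rw [hc, ENNReal.top_pow two_ne_zero, top_le_iff] at h'
  exact ENNReal.ofReal_ne_top h'

lemma norm_multiplier_le (hA : Admissible A) (hψ : ψ ∈ H1) (hK : AEStronglyMeasurable K)
    (hε : 0 ≤ ε)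
    (h : ∫⁻ x, ‖x‖ₑ ^ 2 * ‖K x‖ₑ ^ 2 * ‖ψ x‖ₑ ^ 2 ≤ ENNReal.ofReal (ε ^ 2) * magGradSq A ψ) :
    ‖mulL (fun x => ‖x‖ * ‖K x‖) ψ‖ ≤ ε * √(gradSq A ψ) := by
  have h0 := gradSq_nonneg A ψ
  have := norm_mulL_le_of_lintegral (memLp_multiplier hA hψ hK h) (by positivity)
    (lintegral_multiplier_le hA hψ h)
  refine abs_le_of_sq_le_sq' ?_ (by positivity) |>.2
  rw [mul_pow, Real.sq_sqrt h0]
  exact this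

lemma memLp_multiplier_comp (hA : Admissible A) (hψ : ψ ∈ H1) (hK : AEStronglyMeasurable K)
    (h : ∫⁻ x, ‖x‖ₑ ^ 2 * ‖K x‖ₑ ^ 2 * ‖ψ x‖ₑ ^ 2 ≤ ENNReal.ofReal (ε ^ 2) * magGradSq A ψ)
    {k : R3 → ℝ} (hk : AEStronglyMeasurable k) (hle : ∀ x, |k x| ≤ ‖K x‖) :
    MemLp (fun x => (‖x‖ * k x) • ψ x) 2 := by
  refine (memLp_multiplier hA hψ hK h).of_le
    ((continuous_norm.aestronglyMeasurable.mul hk).smul (Lp.aestronglyMeasurable ψ))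
    (.of_forall fun x => ?_)
  rw [norm_smul, norm_smul, norm_mul, norm_mul, norm_norm, norm_norm]
  have := hle x
  rw [← Real.norm_eq_abs] at this
  gcongr

end Multiplier

lemma curvData_of_field {A F : R3 → R3} {ε : ℝ} (hA : L2Loc A) (hadm : Admissible A) (hF : L2Loc F)
    (hcurl : IsWeakCurl A F)
    (h : ∀ ψ : L2, ψ ∈ H1 →
      ∫⁻ x, ‖x‖ₑ ^ 2 * ‖F x‖ₑ ^ 2 * ‖ψ x‖ₑ ^ 2 ≤ ENNReal.ofReal (ε ^ 2) * magGradSq A ψ) :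
    CurvData A F where
  adm := hadm
  curl := hcurl
  locA := fun j => LocallyIntegrable.coord hA.locallyIntegrable j
  locF := fun j => LocallyIntegrable.coord hF.locallyIntegrable j
  mult := fun j ψ hψ => memLp_multiplier_comp hadm hψ hF.locallyIntegrable.aestronglyMeasurable
    (h ψ hψ) (LocallyIntegrable.coord hF.locallyIntegrable j).aestronglyMeasurable
    fun _ => abs_coord_le _ _

/-- Only the columns of the Jacobian are known to be measurable; the operator is reassembled from
them so that its operator norm can serve as a weight. -/
lemma aestronglyMeasurable_jacobian {B : R3 → R3} {DB : R3 → R3 →L[ℝ] R3}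
    (hDB : IsWeakJacobian B DB) : AEStronglyMeasurable DB volume := by
  have e : DB = fun x => ∑ j, (EuclideanSpace.proj (𝕜 := ℝ) j : R3 →L[ℝ] ℝ).smulRight
      (DB x (EuclideanSpace.single j (1 : ℝ))) := by
    ext1 x
    refine ContinuousLinearMap.ext fun y => ?_
    have hy : y = ∑ j, y j • EuclideanSpace.single j (1 : ℝ) := by
      ext i
      fin_cases i <;> simp [Fin.sum_univ_three]
    conv_lhs => rw [hy]
    simp
  rw [e]
  refine Finset.aestronglyMeasurable_fun_sum _ fun j _ => ?_
  have c : Continuous fun y : R3 => (EuclideanSpace.proj (𝕜 := ℝ) j : R3 →L[ℝ] ℝ).smulRight y :=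
    (ContinuousLinearMap.smulRightL ℝ R3 R3 (EuclideanSpace.proj (𝕜 := ℝ) j)).continuous
  exact c.comp_aestronglyMeasurable (hDB j).2.1.aestronglyMeasurable

/-! ### Matrix-valued weights -/

lemma magD_sum {A : R3 → R3} (hA : Admissible A) (j : Fin 3) {ι : Type*} (s : Finset ι)
    {ψ : ι → L2} (h : ∀ i, ψ i ∈ H1) :
    magD A j (∑ i ∈ s, ψ i) = ∑ i ∈ s, magD A j (ψ i) := by
  classical
  induction s using Finset.induction_on with
  | empty =>
    have := magD_smul hA j 0 H1.zero_mem
    simpa using this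
  | insert a s ha ih =>
    rw [Finset.sum_insert ha, Finset.sum_insert ha,
      magD_add hA j (h a) (H1.sum_mem fun i _ => h i), ih]

lemma coe_sum_actL {ι : Type*} (s : Finset ι) (M : ι → Mat4) (ψ : ι → L2) :
    ((∑ i ∈ s, actL (M i) (ψ i) : L2) : R3 → Spinor)
      =ᵐ[volume] fun x => ∑ i ∈ s, act (M i) (ψ i x) := by
  classical
  induction s using Finset.induction_on with
  | empty =>
    simp only [Finset.sum_empty]
    exact Lp.coeFn_zero Spinor 2 (volume : Measure R3)
  | insert a s ha ih =>
    rw [Finset.sum_insert ha]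
    filter_upwards [Lp.coeFn_add (actL (M a) (ψ a)) (∑ i ∈ s, actL (M i) (ψ i)), ih,
      actL_coe (M a) (ψ a)] with x h1 h2 h3
    rw [h1, Pi.add_apply, h2, h3, Finset.sum_insert ha]

lemma diracL_coe (A : R3 → R3) (ψ : L2) :
    diracL A ψ =ᵐ[volume] fun x => (-Complex.I) • ∑ j, act (alpha j) (magD A j ψ x) := by
  filter_upwards [Lp.coeFn_smul (-Complex.I) (∑ j, actL (alpha j) (magD A j ψ)),
    coe_sum_actL Finset.univ alpha fun j => magD A j ψ] with x h1 h2
  rw [diracL, h1, Pi.smul_apply, h2]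

lemma inner_diracL {A : R3 → R3} (hA : Admissible A) {v u : L2} (hv : v ∈ H1) (hu : u ∈ H1) :
    ⟪diracL A v, u⟫_ℂ = ⟪v, diracL A u⟫_ℂ := by
  rw [diracL, diracL, inner_smul_left, inner_smul_right, sum_inner, inner_sum, Finset.mul_sum,
    Finset.mul_sum]
  refine Finset.sum_congr rfl fun j _ => ?_
  rw [inner_actL_left, alpha_conjTranspose, inner_magD hA hv (actL_mem_H1 _ hu),
    magD_actL hA j _ hu]
  simp

lemma IsTest.weakWeight {a : R3 → ℝ} (ha : IsTest a) :
    WeakWeight a (fun j => MagneticDirac.partialD j a) where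
  weak := fun j => hasWeakPartial_of_contDiff ha.1 j
  bdd := ⟨ha.bddCont.bdd.choose, .of_forall ha.bddCont.bdd.choose_spec⟩
  mult := fun j ψ _ => (ha.partialD j).bddCont.memLp (Lp.memLp ψ)

section MatrixWeight

variable {ι : Type*} [Fintype ι] {A : R3 → R3} {M : ι → Mat4} {b : ι → R3 → ℝ}
  {db : ι → Fin 3 → R3 → ℝ} (hb : ∀ i, WeakWeight (b i) (db i)) {ψ : L2} (hψ : ψ ∈ H1)

include hb hψ

lemma sum_actL_mulL_mem_H1 : ∑ i, actL (M i) (mulL (b i) ψ) ∈ H1 :=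
  H1.sum_mem fun i _ => actL_mem_H1 _ ((hb i).mulL_mem_H1 hψ)

omit hψ in
lemma sum_actL_mulL_coe : ((∑ i, actL (M i) (mulL (b i) ψ) : L2) : R3 → Spinor)
    =ᵐ[volume] fun x => ∑ i, act (M i) (b i x • ψ x) := by
  filter_upwards [coe_sum_actL Finset.univ M fun i => mulL (b i) ψ,
    ae_all_iff.2 fun i => (hb i).coe ψ] with x h1 h2
  rw [h1]
  simp only [h2]

lemma magD_sum_actL_mulL_coe (hA : Admissible A) (j : Fin 3) :
    magD A j (∑ i, actL (M i) (mulL (b i) ψ))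
      =ᵐ[volume] fun x => ∑ i, act (M i) (db i j x • ψ x + b i x • magD A j ψ x) := by
  rw [magD_sum hA j _ fun i => actL_mem_H1 _ ((hb i).mulL_mem_H1 hψ)]
  simp only [fun i => magD_actL hA j (M i) ((hb i).mulL_mem_H1 hψ)]
  filter_upwards [coe_sum_actL Finset.univ M fun i => magD A j (mulL (b i) ψ),
    ae_all_iff.2 fun i => (hb i).magD_coe hA hψ j] with x h1 h2
  rw [h1]
  simp only [h2]

end MatrixWeight

/-! ### Localizing away from the origin -/

lemma IsTest.mul_norm_inv {ζ : R3 → ℝ} (hζ : IsTest ζ) (h0 : (0 : R3) ∉ tsupport ζ) :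
    IsTest fun x => ζ x * ‖x‖⁻¹ :=
  hζ.mul_of_contDiffOn h0 fun _ hx =>
    ((contDiffAt_norm ℝ hx).inv (norm_ne_zero_iff.2 hx)).contDiffWithinAt

/-- Away from the origin `ζ/|x|` is a test function, so bounds on `|x| k` become bounds on `ζ k`. -/
lemma memLp_localize {ζ k : R3 → ℝ} (hζ : IsTest ζ) (h0 : (0 : R3) ∉ tsupport ζ) {ψ : L2}
    (h : MemLp (fun x => (‖x‖ * k x) • ψ x) 2) : MemLp (fun x => (ζ x * k x) • ψ x) 2 := by
  refine ((hζ.mul_norm_inv h0).bddCont.memLp h).ae_eq ?_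
  filter_upwards [ae_ne_zero] with x hx
  rw [smul_smul, mul_assoc, inv_mul_cancel_left₀ (norm_ne_zero_iff.2 hx)]

lemma weakWeight_localize {B : R3 → R3} {DB : R3 → R3 →L[ℝ] R3} (hDB : IsWeakJacobian B DB)
    {ε : ℝ} (hB : ∀ᵐ x : R3, ‖x‖ * ‖B x‖ ≤ ε) (k : Fin 3)
    (h1 : ∀ ψ ∈ H1, MemLp (fun x => (‖x‖ * B x k) • (ψ : L2) x) 2)
    (h2 : ∀ j, ∀ ψ ∈ H1,
      MemLp (fun x => (‖x‖ * DB x (EuclideanSpace.single j (1 : ℝ)) k) • (ψ : L2) x) 2)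
    {ζ : R3 → ℝ} (hζ : IsTest ζ) (h0 : (0 : R3) ∉ tsupport ζ) :
    WeakWeight (fun x => ζ x * B x k) fun j x =>
      partialD j ζ x * B x k + ζ x * DB x (EuclideanSpace.single j (1 : ℝ)) k where
  weak := fun j => ((hDB j).clm (EuclideanSpace.proj (𝕜 := ℝ) k : R3 →L[ℝ] ℝ)).smul_contDiff hζ.1
  bdd := by
    obtain ⟨C, hC⟩ := (hζ.mul_norm_inv h0).bddCont.bdd
    refine ⟨C * ε, ?_⟩
    filter_upwards [hB, ae_ne_zero] with x hx hx0
    have e : ζ x * B x k = (ζ x * ‖x‖⁻¹) * (‖x‖ * B x k) := by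
      rw [mul_assoc, inv_mul_cancel_left₀ (norm_ne_zero_iff.2 hx0)]
    have hC0 : 0 ≤ C := (abs_nonneg _).trans (hC x)
    rw [e, abs_mul]
    refine mul_le_mul (hC x) ?_ (abs_nonneg _) hC0
    rw [abs_mul, abs_norm]
    exact (mul_le_mul_of_nonneg_left (abs_coord_le _ _) (norm_nonneg _)).trans hx
  mult := fun j ψ hψ => by
    simp only [add_smul]
    exact (memLp_localize (hζ.partialD j)
      (fun h => h0 (tsupport_fderiv_apply_subset ℝ _ h)) (h1 ψ hψ)).add
      (memLp_localize hζ h0 (h2 j ψ hψ))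

/-! ### The eigenvalue equation -/

lemma anomalousPotential_eq (φ : R3 → ℝ) (B : R3 → R3) (x : R3) :
    anomalousPotential φ B x = potMat (gradient φ x) (B x) := by
  simp only [anomalousPotential, potMat, alphaDot, spinDot, gradient_apply]

lemma diracL_eq_of_eigen {m : ℝ} {A : R3 → R3} (hA : Admissible A) {V : R3 → Mat4} {u : L2}
    (hu : u ∈ H1) {μ : ℂ} (heq : diracFun m A V u =ᵐ[volume] fun x => μ • u x) :
    diracL A u =ᵐ[volume] fun x => μ • u x - (m : ℂ) • act beta (u x) - act (V x) (u x) := by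
  filter_upwards [diracL_coe A u, heq, ae_all_iff.2 fun j => magD_coe hA j hu] with x h1 h2 h3
  rw [h1, ← h2, diracFun]
  simp only [h3]
  abel

lemma conj_inner_act_self {M : Mat4} (hM : M.conjTranspose = M) (y : Spinor) :
    (⟪y, act M y⟫_ℂ).im = 0 := by
  have h := inner_act_left M y y
  rw [hM, ← inner_conj_symm] at h
  exact Complex.conj_eq_iff_im.1 h

/-- The form `⟨u, D u⟩` is real, and pointwise the Hermitian matrices `β` and `V` contribute nothing
imaginary. Taking imaginary parts before integrating avoids having to know that `V u` is square
integrable. -/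
lemma eigenvalue_im_eq_zero {m : ℝ} {A : R3 → R3} (hA : Admissible A) {V : R3 → Mat4}
    (hV : ∀ x, (V x).conjTranspose = V x) {u : L2} (hu : u ∈ H1) (hu0 : u ≠ 0) {μ : ℂ}
    (heq : diracFun m A V u =ᵐ[volume] fun x => μ • u x) : μ.im = 0 := by
  have h1 : (⟪u, diracL A u⟫_ℂ).im = 0 := by
    have h := inner_diracL hA hu hu
    rw [← inner_conj_symm] at h
    exact Complex.conj_eq_iff_im.1 h
  have h2 : (⟪u, diracL A u⟫_ℂ).im = ∫ x, μ.im * ‖u x‖ ^ 2 := by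
    have := (integral_im (𝕜 := ℂ) (integrable_inner u (diracL A u)))
    rw [L2.inner_def]
    refine this.symm.trans (integral_congr_ae ?_)
    filter_upwards [diracL_eq_of_eigen hA hu heq] with x hx
    have s : ⟪u x, u x⟫_ℂ = ((‖u x‖ ^ 2 : ℝ) : ℂ) := by
      rw [inner_self_eq_norm_sq_to_K]; norm_cast
    rw [hx, inner_sub_right, inner_sub_right, inner_smul_right, inner_smul_right, s]
    have b := conj_inner_act_self beta_conjTranspose (u x)
    have v := conj_inner_act_self (hV x) (u x)
    simp only [RCLike.im_to_complex, Complex.sub_im, Complex.im_ofReal_mul, b, v]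
    rw [mul_comm, Complex.im_ofReal_mul]
    ring
  rw [h2, integral_const_mul, ← norm_sq_eq_integral] at h1
  have : ‖u‖ ^ 2 ≠ 0 := pow_ne_zero 2 (norm_ne_zero_iff.2 hu0)
  exact (mul_eq_zero.1 h1).resolve_right this

/-- The matrices of the potential `μ - m β - i β α·p + 2 β S·b`, as a family indexed by its
scalar coefficients `1, p₁, p₂, p₃, b₁, b₂, b₃`. -/
def coeffMat (m : ℝ) (μ : ℂ) : Option (Fin 3 ⊕ Fin 3) → Mat4
  | none => μ • 1 - (m : ℂ) • beta
  | some (.inl k) => -(Complex.I • (beta * alpha k))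
  | some (.inr k) => (2 : ℂ) • (beta * spin k)

lemma sum_coeffMat (m : ℝ) (μ : ℂ) (c : Option (Fin 3 ⊕ Fin 3) → ℝ) :
    ∑ i, (c i : ℂ) • coeffMat m μ i = (c none : ℂ) • (μ • 1 - (m : ℂ) • beta)
      - (Complex.I • (beta * ∑ k, (c (some (.inl k)) : ℂ) • alpha k)
        - (2 : ℂ) • (beta * ∑ k, (c (some (.inr k)) : ℂ) • spin k)) := by
  rw [Fintype.sum_option, Fintype.sum_sum_type]
  simp only [coeffMat, Finset.mul_sum, Matrix.mul_smul, Finset.smul_sum, smul_neg,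
    Finset.sum_neg_distrib]
  simp only [smul_comm Complex.I, smul_comm (2 : ℂ)]
  abel

lemma sum_act_coeffMat (m : ℝ) (μ : ℂ) (c : Option (Fin 3 ⊕ Fin 3) → ℝ) (y : Spinor) :
    ∑ i, act (coeffMat m μ i) (c i • y) = (c none : ℂ) • (μ • y - (m : ℂ) • act beta y)
      - act (Complex.I • (beta * ∑ k, (c (some (.inl k)) : ℂ) • alpha k)
        - (2 : ℂ) • (beta * ∑ k, (c (some (.inr k)) : ℂ) • spin k)) y := by
  have e : ∀ i, act (coeffMat m μ i) (c i • y) = act ((c i : ℂ) • coeffMat m μ i) y := fun i => by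
    rw [act_smul, ← map_smul]
    rfl
  simp only [e]
  rw [← act_sum, sum_coeffMat, act_sub, act_smul, act_sub, act_smul, act_smul, act_one]

/-- The coefficients of the eigenvalue equation, multiplied by `ζ`. -/
def coeff (φ : R3 → ℝ) (B : R3 → R3) (ζ : R3 → ℝ) : Option (Fin 3 ⊕ Fin 3) → R3 → ℝ
  | none => ζ
  | some (.inl k) => fun x => ζ x * partialD k φ x
  | some (.inr k) => fun x => ζ x * B x k

/-- The partial derivatives of `coeff`. -/
def dcoeff (φ : R3 → ℝ) (B : R3 → R3) (DB : R3 → R3 →L[ℝ] R3) (ζ : R3 → ℝ) :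
    Option (Fin 3 ⊕ Fin 3) → Fin 3 → R3 → ℝ
  | none => fun j => partialD j ζ
  | some (.inl k) => fun j => partialD j fun x => ζ x * partialD k φ x
  | some (.inr k) => fun j x =>
      partialD j ζ x * B x k + ζ x * DB x (EuclideanSpace.single j (1 : ℝ)) k

/-- Where the cutoff is locally one its derivatives disappear, and what is left is the product rule
for `(μ - mβ - V)u`. -/
lemma sum_act_dcoeff (m : ℝ) (μ : ℂ) {φ : R3 → ℝ} (B : R3 → R3) (DB : R3 → R3 →L[ℝ] R3)
    {ζ : R3 → ℝ} {x : R3} (hζ : ζ =ᶠ[𝓝 x] fun _ => 1) (j : Fin 3) (y q : Spinor) :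
    ∑ i, act (coeffMat m μ i) (dcoeff φ B DB ζ i j x • y + coeff φ B ζ i x • q)
      = μ • q - (m : ℂ) • act beta q - act (potMat (gradient φ x) (B x)) q
        - act (Complex.I • (beta * ∑ k, (partialD j (partialD k φ) x : ℂ) • alpha k)
          - (2 : ℂ) • (beta * ∑ k, (DB x (EuclideanSpace.single j (1 : ℝ)) k : ℂ) • spin k)) y := by
  have z1 : ζ x = 1 := hζ.eq_of_nhds
  have z2 : partialD j ζ x = 0 := by
    rw [partialD, hζ.fderiv_eq]; simp
  have z3 : ∀ k, partialD j (fun x => ζ x * partialD k φ x) x = partialD j (partialD k φ) x := by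
    intro k
    have : (fun x => ζ x * partialD k φ x) =ᶠ[𝓝 x] partialD k φ := by
      filter_upwards [hζ] with y hy
      rw [hy, one_mul]
    rw [partialD, this.fderiv_eq, ← partialD]
  simp only [map_add, Finset.sum_add_distrib]
  rw [sum_act_coeffMat m μ (fun i => dcoeff φ B DB ζ i j x),
    sum_act_coeffMat m μ (fun i => coeff φ B ζ i x)]
  simp only [dcoeff, coeff, z1, z2, z3, zero_mul, zero_add, one_mul, Complex.ofReal_zero, zero_smul,
    Complex.ofReal_one, one_smul, potMat, alphaDot, spinDot, gradient_apply]
  abel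

/-- The hypotheses on the eigenfunction and on the fields. -/
structure EigenData (m : ℝ) (A B : R3 → R3) (DB : R3 → R3 →L[ℝ] R3) (φ : R3 → ℝ) (ε₂ ε₄ : ℝ)
    (μ : ℂ) (u : L2) : Prop where
  mass : 0 ≤ m
  adm : Admissible A
  jac : IsWeakJacobian B DB
  trace : ∀ᵐ x, ∑ j, DB x (EuclideanSpace.single j (1 : ℝ)) j = 0
  smooth : ContDiffOn ℝ ∞ φ {0}ᶜ
  grad_le : ∀ x : R3, x ≠ 0 → ‖x‖ * ‖gradient φ x‖ ≤ ε₂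
  field_le : ∀ᵐ x : R3, ‖x‖ * ‖B x‖ ≤ ε₄
  mult_field : ∀ k, ∀ ψ ∈ H1, MemLp (fun x => (‖x‖ * B x k) • (ψ : L2) x) 2
  mult_jac : ∀ k j, ∀ ψ ∈ H1,
      MemLp (fun x => (‖x‖ * DB x (EuclideanSpace.single j (1 : ℝ)) k) • (ψ : L2) x) 2
  mem : u ∈ H1
  eigen : diracFun m A (anomalousPotential φ B) u =ᵐ[volume] fun x => μ • u x

/-- The pointwise bound for the lower order part of the squared equation. -/
def squaredBound (m : ℝ) (A B : R3 → R3) (DB : R3 → R3 →L[ℝ] R3) (φ : R3 → ℝ) (ε₂ ε₄ : ℝ)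
    (u : L2) (x : R3) : ℝ :=
  2 * (ε₂ + ε₄) * ∑ j, ‖magD A j u x‖ + ‖x‖ * ‖Laplacian.laplacian φ x‖ * ‖u x‖
    + 2 * (‖x‖ * ‖DB x‖ * ‖u x‖) + 2 * m * (‖x‖ * ‖B x‖ * ‖u x‖)
    + (ε₂ + ε₄) ^ 2 * (‖x‖⁻¹ * ‖u x‖)

/-- The eigenvalue equation expresses `ζf` as a finite sum of constant matrices times scalar weights
times `u`. Each weight is bounded with multiplier derivatives once `ζ` avoids the origin, so `ζf ∈
H¹` and may be differentiated again. The factor `|x|` in the bound turns the assumptions on `∇φ` and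
`B` into constants. -/
lemma EigenData.exists_localized {m : ℝ} {A B : R3 → R3} {DB : R3 → R3 →L[ℝ] R3} {φ : R3 → ℝ}
    {ε₂ ε₄ : ℝ} {μ : ℂ} {u : L2} (h : EigenData m A B DB φ ε₂ ε₄ μ u) {ζ : R3 → ℝ}
    (hζ : IsTest ζ) (h0 : (0 : R3) ∉ tsupport ζ) :
    ∃ v ∈ H1, ((v : L2) =ᵐ[volume] fun x => ζ x • diracL A u x) ∧
      ∀ᵐ x, ζ =ᶠ[𝓝 x] (fun _ => 1) →
        ‖x‖ * ‖diracL A v x - (μ ^ 2 - (m : ℂ) ^ 2) • u x‖ ≤ squaredBound m A B DB φ ε₂ ε₄ u x := by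
  have hw : ∀ i, WeakWeight (coeff φ B ζ i) (dcoeff φ B DB ζ i) := by
    rintro (_ | (k | k))
    · exact hζ.weakWeight
    · exact (hζ.mul_of_contDiffOn h0 (contDiffOn_partialD h.smooth k)).weakWeight
    · exact weakWeight_localize h.jac h.field_le k (h.mult_field k) (h.mult_jac k) hζ h0
  have hf := diracL_eq_of_eigen h.adm h.mem h.eigen
  refine ⟨∑ i, actL (coeffMat m μ i) (mulL (coeff φ B ζ i) u),
    sum_actL_mulL_mem_H1 hw h.mem, ?_, ?_⟩
  · filter_upwards [sum_actL_mulL_coe (M := coeffMat m μ) hw (ψ := u), hf] with x h1 h2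
    rw [h1, h2, sum_act_coeffMat m μ (fun i => coeff φ B ζ i x)]
    simp only [coeff, anomalousPotential, Complex.ofReal_mul, mul_smul, ← Finset.smul_sum,
      Matrix.mul_smul, act_sub, act_smul, smul_comm Complex.I, smul_comm (2 : ℂ), smul_sub]
    simp only [← Complex.coe_smul]
  · filter_upwards [diracL_coe A (∑ i, actL (coeffMat m μ i) (mulL (coeff φ B ζ i) u)),
      ae_all_iff.2 fun j => magD_sum_actL_mulL_coe (M := coeffMat m μ) hw h.mem h.adm j,
      h.trace, h.field_le, ae_ne_zero, h.eigen,
      ae_all_iff.2 fun j => magD_coe h.adm j h.mem] with x h1 h2 ht hB hx heq hq hζx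
    have c2 : ContDiffAt ℝ 2 φ x :=
      (h.smooth.contDiffAt (isOpen_compl_singleton.mem_nhds hx)).of_le (by norm_cast)
    rw [h1]
    simp only [h2, sum_act_dcoeff m μ B DB hζx]
    have key := norm_squared_equation_le m h.mass μ (gradient φ x) (B x)
      (h := fun j k => partialD j (partialD k φ) x) (fun j k => partialD_comm c2 j k) (DB x) ht
      (u x) (fun j => magD A j u x) _ (fun j => rfl) (by
        rw [← heq, diracFun, anomalousPotential_eq]
        simp only [hq])
    rw [← laplacian_eq_sum c2] at key
    refine (mul_le_mul_of_nonneg_left key (norm_nonneg x)).trans ?_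
    have xp : 0 < ‖x‖ := norm_pos_iff.2 hx
    have hs : ‖x‖ * (‖gradient φ x‖ + ‖B x‖) ≤ ε₂ + ε₄ := by
      have := h.grad_le x hx
      linarith
    have hs0 : 0 ≤ ‖x‖ * (‖gradient φ x‖ + ‖B x‖) := by positivity
    have t1 : ‖x‖ * (‖gradient φ x‖ + ‖B x‖) * ∑ j, ‖magD A j u x‖
        ≤ (ε₂ + ε₄) * ∑ j, ‖magD A j u x‖ :=
      mul_le_mul_of_nonneg_right hs (Finset.sum_nonneg fun _ _ => norm_nonneg _)
    have t2 : (‖x‖ * (‖gradient φ x‖ + ‖B x‖)) ^ 2 * (‖x‖⁻¹ * ‖u x‖)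
        ≤ (ε₂ + ε₄) ^ 2 * (‖x‖⁻¹ * ‖u x‖) :=
      mul_le_mul_of_nonneg_right (pow_le_pow_left₀ hs0 hs 2) (by positivity)
    have t3 : (‖x‖ * (‖gradient φ x‖ + ‖B x‖)) ^ 2 * (‖x‖⁻¹ * ‖u x‖)
        = ‖x‖ * ((‖gradient φ x‖ + ‖B x‖) ^ 2 * ‖u x‖) := by
      field_simp
    rw [squaredBound, Real.norm_eq_abs]
    nlinarith [t1, t2, t3]

/-! ### The integrated virial identity -/

/-- `g` is integrable with integral `c`. -/
structure HasInt (g : R3 → ℂ) (c : ℂ) : Prop where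
  integrable : Integrable g
  integral : ∫ x, g x = c

namespace HasInt

variable {g g' : R3 → ℂ} {c c' : ℂ}

lemma add (h : HasInt g c) (h' : HasInt g' c') : HasInt (fun x => g x + g' x) (c + c') :=
  ⟨h.1.add h'.1, by rw [integral_add h.1 h'.1, h.2, h'.2]⟩

lemma sub (h : HasInt g c) (h' : HasInt g' c') : HasInt (fun x => g x - g' x) (c - c') :=
  ⟨h.1.sub h'.1, by rw [integral_sub h.1 h'.1, h.2, h'.2]⟩

lemma const_mul (a : ℂ) (h : HasInt g c) : HasInt (fun x => a * g x) (a * c) :=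
  ⟨h.1.const_mul a, by rw [integral_const_mul, h.2]⟩

lemma sum {ι : Type*} (s : Finset ι) {g : ι → R3 → ℂ} {c : ι → ℂ} (h : ∀ i, HasInt (g i) (c i)) :
    HasInt (fun x => ∑ i ∈ s, g i x) (∑ i ∈ s, c i) :=
  ⟨integrable_finsetSum _ fun i _ => (h i).1, by
    rw [integral_finsetSum _ fun i _ => (h i).1]
    exact Finset.sum_congr rfl fun i _ => (h i).2⟩

lemma congr (h : HasInt g c) (e : g =ᵐ[volume] g') : HasInt g' c :=
  ⟨h.1.congr e, by rw [← integral_congr_ae e, h.2]⟩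

end HasInt

lemma hasInt_inner (v u : L2) : HasInt (fun x => ⟪v x, u x⟫_ℂ) ⟪v, u⟫_ℂ :=
  ⟨integrable_inner v u, by rw [L2.inner_def]⟩

lemma BddCont.hasInt {a : R3 → ℝ} (ha : BddCont a) (v u : L2) :
    HasInt (fun x => (a x : ℂ) * ⟪v x, u x⟫_ℂ) ⟪v, mulL a u⟫_ℂ := by
  refine (hasInt_inner v (mulL a u)).congr ?_
  filter_upwards [ha.coe u] with x hx
  rw [hx, inner_real_smul_right]

lemma BddCont.hasInt_act {a : R3 → ℝ} (ha : BddCont a) (M : Mat4) (v u : L2) :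
    HasInt (fun x => (a x : ℂ) * ⟪v x, act M (u x)⟫_ℂ) ⟪v, mulL a (actL M u)⟫_ℂ := by
  refine (ha.hasInt v (actL M u)).congr ?_
  filter_upwards [actL_coe M u] with x hx
  rw [hx]

lemma CurvData.hasInt {A F : R3 → R3} (h : CurvData A F) {a : R3 → ℝ} (ha : IsTest a) (M : Mat4)
    (i : Fin 3) {v u : L2} (hv : v ∈ H1) (hu : u ∈ H1) :
    HasInt (fun x => (F x i : ℂ) * ((a x : ℂ) * ⟪v x, act M (u x)⟫_ℂ))
      (curvForm F i v (mulL a (actL M u))) := by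
  have hm := ha.weight.mulL_mem_H1 (actL_mem_H1 M hu)
  refine HasInt.congr ⟨integrable_curvForm h i hv hm, rfl⟩ ?_
  filter_upwards [ha.bddCont.coe (actL M u), actL_coe M u] with x h1 h2
  rw [h1, h2, inner_real_smul_right]

/-- The integrand of the virial identity, in terms of the values at a point. Here `w` is the
multiplier field, `W` its Jacobian, `ζ` the cutoff and `d` its gradient; `D = -iα·∇_A v`,
`r = ∇_A v`, `f = -iα·∇_A y` and `q = ∇_A y`. -/
def virialDensity (w : Fin 3 → ℝ) (W : Fin 3 → Fin 3 → ℝ) (ζ : ℝ) (d : Fin 3 → ℝ) (κ : ℝ)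
    (F : R3) (D v f y : Spinor) (q r : Fin 3 → Spinor) : ℂ :=
  (∑ k, (w k : ℂ) * ⟪D, q k⟫_ℂ) + (∑ k, (w k : ℂ) * ⟪r k, f⟫_ℂ)
    + (∑ k, (W k k : ℂ) * ⟪v, f⟫_ℂ)
    + Complex.I * (∑ j, ∑ k, (W j k : ℂ) * ⟪v, act (alpha j) (q k)⟫_ℂ)
    + (∑ i, ((F i : ℂ) * ((w (i + 2) : ℂ) * ⟪v, act (alpha (i + 1)) y⟫_ℂ)
        - (F i : ℂ) * ((w (i + 1) : ℂ) * ⟪v, act (alpha (i + 2)) y⟫_ℂ)))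
    - (∑ k, ((w k : ℂ) * ⟪v, r k⟫_ℂ + 1 / 2 * ((W k k : ℂ) * ⟪v, v⟫_ℂ)))
    + 3 / 2 * ((ζ : ℂ) * ⟪D, y⟫_ℂ - (ζ : ℂ) * ⟪v, f⟫_ℂ
        + Complex.I * (∑ j, (d j : ℂ) * ⟪v, act (alpha j) y⟫_ℂ))
    - (κ : ℂ) * (∑ k, ((w k : ℂ) * ⟪y, q k⟫_ℂ + 1 / 2 * ((W k k : ℂ) * ⟪y, y⟫_ℂ)))

/-- The operator `w·∇_A + (div w)/2` is skew-adjoint. This removes the `κ` term and the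
self-interaction of `v`. -/
lemma re_transport_eq_zero {A : R3 → R3} (hA : Admissible A) {w : Fin 3 → R3 → ℝ}
    (hw : ∀ k, IsTest (w k)) {v : L2} (hv : v ∈ H1) :
    (∑ k, (⟪v, mulL (w k) (magD A k v)⟫_ℂ
      + 1 / 2 * ⟪v, mulL (partialD k (w k)) v⟫_ℂ)).re = 0 := by
  rw [Complex.re_sum]
  refine Finset.sum_eq_zero fun k _ => ?_
  have h := re_inner_mulL_magD hA (hw k).weight hv k
  rw [(hw k).bddCont.inner_left] at h
  rw [((hw k).partialD k).bddCont.inner_self_mulL, Complex.add_re]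
  have e : (1 / 2 * ((∫ x, partialD k (w k) x * ‖v x‖ ^ 2 : ℝ) : ℂ)).re
      = 1 / 2 * ∫ x, partialD k (w k) x * ‖v x‖ ^ 2 := by
    rw [Complex.re_mul_ofReal]; norm_num
  rw [e]
  linarith

/-- Symmetry of `D` together with its commutator with `ζ`. It supplies the zeroth order part `3/2`
of the dilation generator. -/
lemma inner_diracL_mulL {A : R3 → R3} (hA : Admissible A) {ζ : R3 → ℝ} (hζ : IsTest ζ)
    {v u : L2} (hv : v ∈ H1) (hu : u ∈ H1) :
    ⟪diracL A v, mulL ζ u⟫_ℂ - ⟪v, mulL ζ (diracL A u)⟫_ℂ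
      + Complex.I * ∑ j, ⟪v, mulL (partialD j ζ) (actL (alpha j) u)⟫_ℂ = 0 := by
  rw [inner_diracL hA hv (hζ.weight.mulL_mem_H1 hu)]
  have e : diracL A (mulL ζ u) = mulL ζ (diracL A u)
      + (-Complex.I) • ∑ j, mulL (partialD j ζ) (actL (alpha j) u) := by
    rw [diracL, diracL, hζ.bddCont.mulL_smul, hζ.bddCont.mulL_sum, ← smul_add,
      ← Finset.sum_add_distrib]
    congr 1
    refine Finset.sum_congr rfl fun j _ => ?_
    rw [magD_mulL hA hζ.weight j hu, map_add, hζ.bddCont.mulL_actL,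
      (hζ.partialD j).bddCont.mulL_actL]
  rw [e, inner_add_right, inner_smul_right, inner_sum]
  ring

/-- Four identities are added: the virial one with weight `1`, skewness of the transport operator on
`v` with weight `-1` and on `u` with weight `-κ`, and the zeroth order identity with weight `3/2`.
Keeping them under one integral allows a pointwise estimate, so no separate integrability of the
unlocalized pieces is needed. -/
theorem integral_virialDensity {A F : R3 → R3} (h : CurvData A F) {v u : L2} (hv : v ∈ H1)
    (hu : u ∈ H1) {w : Fin 3 → R3 → ℝ} (hw : ∀ k, IsTest (w k)) {ζ : R3 → ℝ} (hζ : IsTest ζ)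
    (κ : ℝ) :
    ∃ c, c.re = 0 ∧ HasInt (fun x => virialDensity (fun k => w k x)
      (fun j k => partialD j (w k) x) (ζ x) (fun j => partialD j ζ x) κ (F x) (diracL A v x) (v x)
      (diracL A u x) (u x) (fun k => magD A k u x) (fun k => magD A k v x)) c := by
  have bw := fun k => (hw k).bddCont
  have bd := fun j k => ((hw k).partialD j).bddCont
  have t1 := HasInt.sum Finset.univ fun k => (bw k).hasInt (diracL A v) (magD A k u)
  have t2 := HasInt.sum Finset.univ fun k => (bw k).hasInt (magD A k v) (diracL A u)
  have t3 := HasInt.sum Finset.univ fun k => (bd k k).hasInt v (diracL A u)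
  have t4 := (HasInt.sum Finset.univ fun j => HasInt.sum Finset.univ fun k =>
    (bd j k).hasInt_act (alpha j) v (magD A k u)).const_mul Complex.I
  have t5 := HasInt.sum Finset.univ fun i =>
    (h.hasInt (hw (i + 2)) (alpha (i + 1)) i hv hu).sub
      (h.hasInt (hw (i + 1)) (alpha (i + 2)) i hv hu)
  have t6 := HasInt.sum Finset.univ fun k =>
    ((bw k).hasInt v (magD A k v)).add (((bd k k).hasInt v v).const_mul (1 / 2))
  have t7 := ((((hζ.bddCont.hasInt (diracL A v) u).sub (hζ.bddCont.hasInt v (diracL A u))).add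
    ((HasInt.sum Finset.univ fun j =>
      (hζ.partialD j).bddCont.hasInt_act (alpha j) v u).const_mul Complex.I))).const_mul (3 / 2)
  have t8 := (HasInt.sum Finset.univ fun k =>
    ((bw k).hasInt u (magD A k u)).add (((bd k k).hasInt u u).const_mul (1 / 2))).const_mul (κ : ℂ)
  refine ⟨_, ?_, (((((((t1.add t2).add t3).add t4).add t5).sub t6).add t7).sub t8)⟩
  have e1 := inner_virial h hv hu hw
  simp only [(bw _).inner_left] at e1
  rw [inner_diracL_mulL h.adm hζ hv hu, Complex.sub_re, Complex.re_ofReal_mul,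
    re_transport_eq_zero h.adm hw hu, Complex.add_re, Complex.sub_re,
    re_transport_eq_zero h.adm hw hv, e1]
  simp only [Complex.add_re, Complex.sub_re, Complex.neg_re, mul_zero, Complex.zero_re]
  ring

/-! ### Pointwise estimate of the virial density -/

lemma virialDensity_zero (κ : ℝ) (F : R3) (D v f y : Spinor) (q r : Fin 3 → Spinor) :
    virialDensity (fun _ => 0) (fun _ _ => 0) 0 (fun _ => 0) κ F D v f y q r = 0 := by
  simp [virialDensity]

/-- The cross product of two vectors. -/
def cross (a b : R3) : R3 :=
  !₂[a 1 * b 2 - a 2 * b 1, a 2 * b 0 - a 0 * b 2, a 0 * b 1 - a 1 * b 0]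

lemma norm_cross_le (a b : R3) : ‖cross a b‖ ≤ ‖a‖ * ‖b‖ := by
  have nsq : ∀ y : R3, ‖y‖ ^ 2 = y 0 ^ 2 + y 1 ^ 2 + y 2 ^ 2 := fun y => by
    rw [← sum_coord_sq, Fin.sum_univ_three]
  refine (abs_le_of_sq_le_sq' ?_ (by positivity)).2
  rw [mul_pow, nsq, nsq, nsq]
  simp only [cross]
  simp
  nlinarith [sq_nonneg (a 0 * b 0 + a 1 * b 1 + a 2 * b 2)]

lemma norm_sum_coord_smul_le (x : R3) (q : Fin 3 → Spinor) :
    ‖∑ k, (x k : ℂ) • q k‖ ≤ ‖x‖ * √(∑ k, ‖q k‖ ^ 2) := by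
  have h : ‖∑ k, (x k : ℂ) • q k‖ ≤ ∑ k, |x k| * ‖q k‖ :=
    norm_sum_le_of_le _ fun k _ => by rw [norm_smul, Complex.norm_real, Real.norm_eq_abs]
  refine h.trans ((Real.sum_mul_le_sqrt_mul_sqrt _ _ _).trans_eq ?_)
  simp only [sq_abs, sum_coord_sq, Real.sqrt_sq (norm_nonneg x)]

section Radial

variable (x F : R3) (ζ κ : ℝ) (d : Fin 3 → ℝ) (D f y : Spinor) (q r : Fin 3 → Spinor)

/-- For `w = ζx` and `v = f` the terms in `∇_A v` cancel in real part. The coefficient of `ζ|f|²` is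
`3/2` from half the divergence, `-1` from the commutator of `D` with dilations and `-3/2` from the
zeroth order identity: `-1` in total, which is the term moved to the left. The `κ` terms turn `D`
into `D - κy`. -/
lemma virialDensity_radial (hf : (-Complex.I) • ∑ j, act (alpha j) (q j) = f) :
    (virialDensity (fun k => ζ * x k) (fun j k => d j * x k + if k = j then ζ else 0) ζ d κ F D f f
      y q r).re + ζ * ‖f‖ ^ 2
      = (⟪D - (κ : ℂ) • y, (ζ : ℂ) • ((∑ k, (x k : ℂ) • q k) + (3 / 2 : ℂ) • y)⟫_ℂ).re
        + (⟪f, (ζ : ℂ) • act (alphaDot (cross x F)) y⟫_ℂ).re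
        + 1 / 2 * (∑ j, d j * x j) * ‖f‖ ^ 2
        + (Complex.I * ∑ j, (d j : ℂ) * ⟪f, act (alpha j) (∑ k, (x k : ℂ) • q k)⟫_ℂ).re
        + (3 / 2 * (Complex.I * ∑ j, (d j : ℂ) * ⟪f, act (alpha j) y⟫_ℂ)).re
        - κ / 2 * (∑ j, d j * x j) * ‖y‖ ^ 2 := by
  set Q := ∑ k, (x k : ℂ) • q k with hQ
  set R := ∑ k, (x k : ℂ) • r k with hR
  have s1 : ∀ z : Spinor, ∑ k, ((ζ * x k : ℝ) : ℂ) * ⟪z, q k⟫_ℂ = ζ * ⟪z, Q⟫_ℂ := fun z => by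
    rw [hQ, inner_sum, Finset.mul_sum]
    refine Finset.sum_congr rfl fun k _ => ?_
    rw [inner_smul_right]; push_cast; ring
  have s2 : ∑ k, ((ζ * x k : ℝ) : ℂ) * ⟪r k, f⟫_ℂ = ζ * ⟪R, f⟫_ℂ := by
    rw [hR, sum_inner, Finset.mul_sum]
    refine Finset.sum_congr rfl fun k _ => ?_
    rw [inner_smul_left, Complex.conj_ofReal]; push_cast; ring
  have s2' : ∑ k, ((ζ * x k : ℝ) : ℂ) * ⟪f, r k⟫_ℂ = ζ * ⟪f, R⟫_ℂ := by
    rw [hR, inner_sum, Finset.mul_sum]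
    refine Finset.sum_congr rfl fun k _ => ?_
    rw [inner_smul_right]; push_cast; ring
  have s3 : ∀ z : ℂ, ∑ k, ((d k * x k + ζ : ℝ) : ℂ) * z
      = ((3 * ζ + ∑ j, d j * x j : ℝ) : ℂ) * z := fun z => by
    simp only [Fin.sum_univ_three]; push_cast; ring
  have hff : Complex.I * ∑ j, ⟪f, act (alpha j) (q j)⟫_ℂ = -⟪f, f⟫_ℂ := by
    have e := congrArg (fun z => ⟪f, z⟫_ℂ) hf
    simp only [inner_smul_right] at e
    rw [← inner_sum, ← e]
    ring
  have s4 : Complex.I * ∑ j, ∑ k, ((d j * x k + (if k = j then ζ else 0) : ℝ) : ℂ)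
        * ⟪f, act (alpha j) (q k)⟫_ℂ
      = -(ζ * ⟪f, f⟫_ℂ) + Complex.I * ∑ j, (d j : ℂ) * ⟪f, act (alpha j) Q⟫_ℂ := by
    have : ∀ j, ∑ k, ((d j * x k + (if k = j then ζ else 0) : ℝ) : ℂ) * ⟪f, act (alpha j) (q k)⟫_ℂ
        = ζ * ⟪f, act (alpha j) (q j)⟫_ℂ + (d j : ℂ) * ⟪f, act (alpha j) Q⟫_ℂ := fun j => by
      have e : ∀ k, ((d j * x k + (if k = j then ζ else 0) : ℝ) : ℂ) * ⟪f, act (alpha j) (q k)⟫_ℂ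
          = (if k = j then (ζ : ℂ) * ⟪f, act (alpha j) (q k)⟫_ℂ else 0)
            + (d j : ℂ) * ((x k : ℂ) * ⟪f, act (alpha j) (q k)⟫_ℂ) := fun k => by
        split_ifs <;> push_cast <;> ring
      simp only [e, Finset.sum_add_distrib, Finset.sum_ite_eq', Finset.mem_univ, if_true]
      rw [← Finset.mul_sum, hQ, map_sum, inner_sum]
      simp only [map_smul, inner_smul_right]
    simp only [this, Finset.sum_add_distrib]
    rw [mul_add, ← Finset.mul_sum, ← mul_assoc, mul_comm Complex.I, mul_assoc, hff]
    ring
  have s5 : (∑ i, ((F i : ℂ) * (((ζ * x (i + 2) : ℝ) : ℂ) * ⟪f, act (alpha (i + 1)) y⟫_ℂ)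
        - (F i : ℂ) * (((ζ * x (i + 1) : ℝ) : ℂ) * ⟪f, act (alpha (i + 2)) y⟫_ℂ)))
      = ⟪f, (ζ : ℂ) • act (alphaDot (cross x F)) y⟫_ℂ := by
    rw [inner_smul_right, alphaDot, act_sum, inner_sum]
    simp only [act_smul, inner_smul_right, Fin.sum_univ_three]
    have e0 : (0 : Fin 3) + 1 = 1 := rfl
    have e1 : (0 : Fin 3) + 2 = 2 := rfl
    have e2 : (1 : Fin 3) + 1 = 2 := rfl
    have e3 : (1 : Fin 3) + 2 = 0 := rfl
    have e4 : (2 : Fin 3) + 1 = 0 := rfl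
    have e5 : (2 : Fin 3) + 2 = 1 := rfl
    have c0 : cross x F 0 = x 1 * F 2 - x 2 * F 1 := rfl
    have c1 : cross x F 1 = x 2 * F 0 - x 0 * F 2 := rfl
    have c2 : cross x F 2 = x 0 * F 1 - x 1 * F 0 := rfl
    simp only [e0, e1, e2, e3, e4, e5, c0, c1, c2]
    push_cast
    ring
  have n : ∀ z : Spinor, ⟪z, z⟫_ℂ = ((‖z‖ ^ 2 : ℝ) : ℂ) := fun z => by
    rw [inner_self_eq_norm_sq_to_K]; norm_cast
  have symm : (⟪R, f⟫_ℂ).re = (⟪f, R⟫_ℂ).re := by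
    rw [← inner_conj_symm, Complex.conj_re]
  have half : ∀ t : ℝ, (1 / 2 * (t : ℂ)) = ((t / 2 : ℝ) : ℂ) := fun t => by push_cast; ring
  have th : ∀ z : ℂ, (3 / 2 * z).re = 3 / 2 * z.re := fun z => by
    have : (3 / 2 : ℂ) = ((3 / 2 : ℝ) : ℂ) := by push_cast; rfl
    rw [this, Complex.re_ofReal_mul]
  rw [virialDensity, s4, s5]
  simp only [Finset.sum_add_distrib, ← Finset.mul_sum, s1, s2, s2', if_true, s3]
  rw [inner_smul_right _ _ (ζ : ℂ), inner_smul_right _ _ (ζ : ℂ), inner_sub_left, inner_smul_left,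
    Complex.conj_ofReal, inner_add_right, inner_add_right, inner_smul_right,
    inner_smul_right, n f, n y]
  simp only [Complex.add_re, Complex.sub_re, Complex.neg_re, th, Complex.re_ofReal_mul, symm,
    ← Complex.ofReal_mul, half, Complex.ofReal_re]
  ring

/-- Cauchy–Schwarz termwise. The factor `|x|` produced by `x·q` is given to `D - κy`, where the
bound `Y` absorbs it, and every cutoff error is collected behind the scale invariant quantity `|x| ∑
|d_j|`. -/
lemma virialDensity_radial_le (hf : (-Complex.I) • ∑ j, act (alpha j) (q j) = f) (h0 : 0 ≤ ζ)
    (h1 : ζ ≤ 1) (hx : x ≠ 0) {Y : ℝ} (hY : ‖x‖ * ‖D - (κ : ℂ) • y‖ ≤ Y) :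
    (virialDensity (fun k => ζ * x k) (fun j k => d j * x k + if k = j then ζ else 0) ζ d κ F D f f
      y q r).re + ζ * ‖f‖ ^ 2
      ≤ Y * (√(∑ k, ‖q k‖ ^ 2) + 3 / 2 * (‖x‖⁻¹ * ‖y‖)) + ‖x‖ * ‖F‖ * (‖f‖ * ‖y‖)
        + (‖x‖ * ∑ j, |d j|) * (1 / 2 * ‖f‖ ^ 2 + ‖f‖ * √(∑ k, ‖q k‖ ^ 2)
          + 3 / 2 * (‖f‖ * (‖x‖⁻¹ * ‖y‖)) + |κ| / 2 * ‖y‖ ^ 2) := by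
  rw [virialDensity_radial x F ζ κ d D f y q r hf]
  set Q := ∑ k, (x k : ℂ) • q k with hQ
  set S := √(∑ k, ‖q k‖ ^ 2) with hS
  set δ := ∑ j, |d j| with hδ
  have hQn : ‖Q‖ ≤ ‖x‖ * S := norm_sum_coord_smul_le x q
  have xp : 0 < ‖x‖ := norm_pos_iff.2 hx
  have hδ0 : 0 ≤ δ := Finset.sum_nonneg fun _ _ => abs_nonneg _
  have hY0 : 0 ≤ Y := le_trans (by positivity) hY
  have three : ‖(3 / 2 : ℂ)‖ = 3 / 2 := by norm_num
  have a1 : (⟪D - (κ : ℂ) • y, (ζ : ℂ) • (Q + (3 / 2 : ℂ) • y)⟫_ℂ).re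
      ≤ Y * (S + 3 / 2 * (‖x‖⁻¹ * ‖y‖)) := by
    refine (Complex.re_le_norm _).trans ((norm_inner_le_norm _ _).trans ?_)
    have b1 : ‖(ζ : ℂ) • (Q + (3 / 2 : ℂ) • y)‖ ≤ ‖x‖ * (S + 3 / 2 * (‖x‖⁻¹ * ‖y‖)) := by
      rw [norm_smul, Complex.norm_real, Real.norm_of_nonneg h0]
      have b2 : ‖Q + (3 / 2 : ℂ) • y‖ ≤ ‖x‖ * (S + 3 / 2 * (‖x‖⁻¹ * ‖y‖)) := by
        refine (norm_add_le _ _).trans ?_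
        rw [norm_smul, three]
        have : ‖x‖ * (S + 3 / 2 * (‖x‖⁻¹ * ‖y‖)) = ‖x‖ * S + 3 / 2 * ‖y‖ := by
          field_simp
        rw [this]
        linarith
      exact (mul_le_of_le_one_left (norm_nonneg _) h1).trans b2
    calc ‖D - (κ : ℂ) • y‖ * ‖(ζ : ℂ) • (Q + (3 / 2 : ℂ) • y)‖
        ≤ ‖D - (κ : ℂ) • y‖ * (‖x‖ * (S + 3 / 2 * (‖x‖⁻¹ * ‖y‖))) :=
          mul_le_mul_of_nonneg_left b1 (norm_nonneg _)
      _ = (‖x‖ * ‖D - (κ : ℂ) • y‖) * (S + 3 / 2 * (‖x‖⁻¹ * ‖y‖)) := by ring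
      _ ≤ _ := mul_le_mul_of_nonneg_right hY (by positivity)
  have a2 : (⟪f, (ζ : ℂ) • act (alphaDot (cross x F)) y⟫_ℂ).re ≤ ‖x‖ * ‖F‖ * (‖f‖ * ‖y‖) := by
    refine (Complex.re_le_norm _).trans ((norm_inner_le_norm _ _).trans ?_)
    rw [norm_smul, Complex.norm_real, Real.norm_of_nonneg h0, norm_act_alphaDot]
    have b1 : ζ * (‖cross x F‖ * ‖y‖) ≤ ‖x‖ * ‖F‖ * ‖y‖ :=
      (mul_le_of_le_one_left (by positivity) h1).trans
        (mul_le_mul_of_nonneg_right (norm_cross_le x F) (norm_nonneg _))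
    calc _ ≤ ‖f‖ * (‖x‖ * ‖F‖ * ‖y‖) := mul_le_mul_of_nonneg_left b1 (norm_nonneg _)
      _ = _ := by ring
  have hdx : |∑ j, d j * x j| ≤ ‖x‖ * δ := by
    rw [hδ, Finset.mul_sum]
    refine (Finset.abs_sum_le_sum_abs _ _).trans (Finset.sum_le_sum fun j _ => ?_)
    rw [abs_mul, mul_comm]
    exact mul_le_mul_of_nonneg_right (abs_coord_le x j) (abs_nonneg _)
  have a3 : 1 / 2 * (∑ j, d j * x j) * ‖f‖ ^ 2 ≤ (‖x‖ * δ) * (1 / 2 * ‖f‖ ^ 2) := by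
    have := mul_le_mul_of_nonneg_right ((le_abs_self _).trans hdx) (sq_nonneg ‖f‖)
    linarith
  have a6 : -(κ / 2 * (∑ j, d j * x j) * ‖y‖ ^ 2) ≤ (‖x‖ * δ) * (|κ| / 2 * ‖y‖ ^ 2) := by
    have e : -(κ / 2 * (∑ j, d j * x j)) ≤ |κ| / 2 * (‖x‖ * δ) := by
      refine (neg_le_abs _).trans ?_
      rw [abs_mul, abs_div, abs_two]
      exact mul_le_mul_of_nonneg_left hdx (by positivity)
    have := mul_le_mul_of_nonneg_right e (sq_nonneg ‖y‖)
    linarith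
  have a0 : ∀ z : Spinor, ‖Complex.I * ∑ j, (d j : ℂ) * ⟪f, act (alpha j) z⟫_ℂ‖
      ≤ δ * (‖f‖ * ‖z‖) := fun z => by
    rw [norm_mul, Complex.norm_I, one_mul, hδ, Finset.sum_mul]
    refine norm_sum_le_of_le _ fun j _ => ?_
    rw [norm_mul, Complex.norm_real, Real.norm_eq_abs]
    refine mul_le_mul_of_nonneg_left ((norm_inner_le_norm _ _).trans_eq ?_) (abs_nonneg _)
    rw [norm_act_alpha]
  have a4 : (Complex.I * ∑ j, (d j : ℂ) * ⟪f, act (alpha j) Q⟫_ℂ).re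
      ≤ (‖x‖ * δ) * (‖f‖ * S) := by
    refine (Complex.re_le_norm _).trans ((a0 Q).trans ?_)
    calc δ * (‖f‖ * ‖Q‖) ≤ δ * (‖f‖ * (‖x‖ * S)) := by gcongr
      _ = _ := by ring
  have a5 : (3 / 2 * (Complex.I * ∑ j, (d j : ℂ) * ⟪f, act (alpha j) y⟫_ℂ)).re
      ≤ (‖x‖ * δ) * (3 / 2 * (‖f‖ * (‖x‖⁻¹ * ‖y‖))) := by
    refine (Complex.re_le_norm _).trans ?_
    rw [norm_mul, three]
    refine (mul_le_mul_of_nonneg_left (a0 y) (by norm_num)).trans_eq ?_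
    field_simp
  linarith

end Radial

/-! ### Annular cutoffs -/

/-- A cutoff to the annulus `1 / R ≤ |x| ≤ 2 R`, equal to one for `2 / R ≤ |x| ≤ R`. -/
def annulus (R : ℝ) (x : R3) : ℝ := cutoff R⁻¹ x * (1 - cutoff R x)

section Annulus

variable {R : ℝ} (hR : 0 < R)

include hR

lemma isTest_annulus : IsTest (annulus R) :=
  (isTest_cutoff (inv_ne_zero hR.ne')).mul_contDiff (contDiff_const.sub (contDiff_cutoff R))

omit hR in
lemma annulus_nonneg (x : R3) : 0 ≤ annulus R x :=
  mul_nonneg (cutoff_nonneg _ _) (sub_nonneg.2 (cutoff_le_one _ _))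

omit hR in
lemma annulus_le_one (x : R3) : annulus R x ≤ 1 :=
  mul_le_one₀ (cutoff_le_one _ _) (sub_nonneg.2 (cutoff_le_one _ _))
    (sub_le_self _ (cutoff_nonneg _ _))

lemma annulus_eventuallyEq_zero {x : R3} (h : R * ‖x‖ < 1 ∨ 2 * R < ‖x‖) :
    annulus R =ᶠ[𝓝 x] fun _ => 0 := by
  rcases h with h | h
  · have o : ∀ᶠ y in 𝓝 x, R * ‖y‖ < 1 :=
      (isOpen_lt (by fun_prop) continuous_const).mem_nhds h
    filter_upwards [o] with y hy
    rw [annulus, cutoff_eq_one (r := R) (by rw [abs_of_pos hR]; exact hy.le), sub_self, mul_zero]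
  · have o : ∀ᶠ y : R3 in 𝓝 x, 2 * R < ‖y‖ :=
      (isOpen_lt continuous_const continuous_norm).mem_nhds h
    filter_upwards [o] with y hy
    rw [annulus, cutoff_eq_zero (r := R⁻¹), zero_mul]
    rw [abs_of_pos (inv_pos.2 hR), inv_mul_eq_div, le_div_iff₀ hR]
    exact hy.le

lemma annulus_eventuallyEq_one {x : R3} (h : 2 < R * ‖x‖) (h' : ‖x‖ < R) :
    annulus R =ᶠ[𝓝 x] fun _ => 1 := by
  have o : ∀ᶠ y in 𝓝 x, 2 < R * ‖y‖ := (isOpen_lt continuous_const (by fun_prop)).mem_nhds h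
  have o' : ∀ᶠ y : R3 in 𝓝 x, ‖y‖ < R :=
    (isOpen_lt continuous_norm continuous_const).mem_nhds h'
  filter_upwards [o, o'] with y hy hy'
  rw [annulus, cutoff_eq_zero (r := R) (by rw [abs_of_pos hR]; exact hy.le), sub_zero,
    cutoff_eq_one, mul_one]
  rw [abs_of_pos (inv_pos.2 hR), inv_mul_eq_div, div_le_one hR]
  exact hy'.le

lemma zero_notMem_tsupport_annulus : (0 : R3) ∉ tsupport (annulus R) := by
  rw [notMem_tsupport_iff_eventuallyEq]
  exact annulus_eventuallyEq_zero hR (.inl (by simp))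

end Annulus

/-- The quantity `|x||∇ζ|` is invariant under dilation: the factor `r` from the chain rule meets
`|x| ≤ 2/|r|` on the support. -/
lemma exists_norm_mul_partialD_cutoff_bound :
    ∃ C : ℝ, ∀ (r : ℝ) (j : Fin 3) (x : R3), ‖x‖ * |partialD j (cutoff r) x| ≤ C := by
  obtain ⟨C, hC⟩ := exists_partialD_cutoffBump_bound
  refine ⟨2 * C, fun r j x => ?_⟩
  have hC0 : 0 ≤ C := (abs_nonneg _).trans (hC 0 0)
  rw [partialD_cutoff, abs_mul, ← mul_assoc, mul_comm ‖x‖]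
  by_cases h : 2 < |r| * ‖x‖
  · have : partialD j cutoffBump (r • x) = 0 := by
      have e : (cutoffBump : R3 → ℝ) =ᶠ[𝓝 (r • x)] fun _ => 0 := by
        have o : ∀ᶠ y : R3 in 𝓝 (r • x), 2 < ‖y‖ := by
          refine (isOpen_lt continuous_const continuous_norm).mem_nhds ?_
          rw [Set.mem_ofPred_eq, norm_smul]; exact h
        filter_upwards [o] with y hy
        exact cutoffBump.zero_of_le_dist (by rw [dist_zero_right]; exact hy.le)
      rw [partialD, e.fderiv_eq]; simp
    rw [this, abs_zero, mul_zero]; positivity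
  · exact mul_le_mul (not_lt.1 h) (hC j _) (abs_nonneg _) (by norm_num)

/-- The scale invariant size `|x| |∇ζ|` of the gradient of a cutoff. -/
def scaledGrad (ζ : R3 → ℝ) (x : R3) : ℝ := ‖x‖ * ∑ j, |partialD j ζ x|

lemma scaledGrad_nonneg (ζ : R3 → ℝ) (x : R3) : 0 ≤ scaledGrad ζ x :=
  mul_nonneg (norm_nonneg _) (Finset.sum_nonneg fun _ _ => abs_nonneg _)

lemma IsTest.continuous_scaledGrad {ζ : R3 → ℝ} (h : IsTest ζ) : Continuous (scaledGrad ζ) :=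
  continuous_norm.mul (continuous_finsetSum _ fun j _ => (h.partialD_cont j).abs)

lemma scaledGrad_eq_zero {ζ : R3 → ℝ} {x : R3} {c : ℝ} (h : ζ =ᶠ[𝓝 x] fun _ => c) :
    scaledGrad ζ x = 0 := by
  have : ∀ j, partialD j ζ x = 0 := fun j => by rw [partialD, h.fderiv_eq]; simp
  simp [scaledGrad, this]

lemma exists_scaledGrad_annulus_bound : ∃ C : ℝ, ∀ (R : ℝ) (x : R3), scaledGrad (annulus R) x ≤ C := by
  obtain ⟨C, hC⟩ := exists_norm_mul_partialD_cutoff_bound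
  refine ⟨∑ _j : Fin 3, (C + C), fun R x => ?_⟩
  rw [scaledGrad, Finset.mul_sum]
  refine Finset.sum_le_sum fun j _ => ?_
  have hd : ∀ r, DifferentiableAt ℝ (cutoff r) x := fun r =>
    (contDiff_cutoff r).differentiable (by simp) x
  have e : partialD j (annulus R) x = partialD j (cutoff R⁻¹) x * (1 - cutoff R x)
      + cutoff R⁻¹ x * -partialD j (cutoff R) x := by
    have e1 : partialD j (fun y => 1 - cutoff R y) x = -partialD j (cutoff R) x := by
      rw [partialD, fderiv_const_sub]; rfl
    rw [← e1]
    exact partialD_mul j x (hd _) ((hd R).const_sub 1)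
  have b1 : |1 - cutoff R x| ≤ 1 :=
    abs_le.2 ⟨by linarith [cutoff_le_one R x], by linarith [cutoff_nonneg R x]⟩
  have b2 : |cutoff R⁻¹ x| ≤ 1 := by
    rw [abs_of_nonneg (cutoff_nonneg _ _)]; exact cutoff_le_one _ _
  have b3 : |partialD j (annulus R) x| ≤ |partialD j (cutoff R⁻¹) x| + |partialD j (cutoff R) x| := by
    rw [e]
    refine (abs_add_le _ _).trans (add_le_add ?_ ?_)
    · rw [abs_mul]; exact mul_le_of_le_one_right (abs_nonneg _) b1
    · rw [abs_mul, abs_neg]; exact mul_le_of_le_one_left (abs_nonneg _) b2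
  calc ‖x‖ * |partialD j (annulus R) x|
      ≤ ‖x‖ * (|partialD j (cutoff R⁻¹) x| + |partialD j (cutoff R) x|) :=
        mul_le_mul_of_nonneg_left b3 (norm_nonneg _)
    _ = _ := mul_add _ _ _
    _ ≤ C + C := add_le_add (hC _ _ _) (hC _ _ _)

/-! ### The global inequality -/

/-- The pointwise length of the magnetic gradient. -/
def gradLen (A : R3 → R3) (u : L2) (x : R3) : ℝ := √(∑ k, ‖magD A k u x‖ ^ 2)

lemma memLp_norm (u : L2) : MemLp (fun x => ‖u x‖) 2 volume := (Lp.memLp u).norm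

lemma memLp_gradLen (A : R3 → R3) (u : L2) : MemLp (gradLen A u) 2 volume := by
  have hs : MemLp (fun x => ∑ k, ‖magD A k u x‖) 2 volume :=
    memLp_finsetSum _ fun k _ => memLp_norm _
  refine hs.of_le ?_ (.of_forall fun x => ?_)
  · refine Real.continuous_sqrt.comp_aestronglyMeasurable ?_
    exact Finset.aestronglyMeasurable_fun_sum _ fun k _ => ((memLp_norm (magD A k u)).1.pow 2)
  · have h0 : 0 ≤ ∑ k, ‖magD A k u x‖ := Finset.sum_nonneg fun _ _ => norm_nonneg _
    rw [gradLen, Real.norm_of_nonneg (Real.sqrt_nonneg _), Real.norm_of_nonneg h0]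
    refine Real.sqrt_le_iff.2 ⟨h0, Finset.sum_sq_le_sq_sum_of_nonneg ?_⟩
    exact fun _ _ => norm_nonneg _

lemma memLp_norm_inv_mul {A : R3 → R3} (hA : Admissible A) {u : L2} (hu : u ∈ H1) :
    MemLp (fun x => ‖x‖⁻¹ * ‖u x‖) 2 volume := by
  refine (hardy_memLp hA hu).norm.congr_norm (hardy_memLp hA hu).norm.1 ?_ |>.ae_eq ?_
  all_goals exact .of_forall fun x => by simp [norm_smul]

lemma memLp_mul_norm {a : R3 → ℝ} (ha : ∀ x, 0 ≤ a x) {u : L2} (h : MemLp (fun x => a x • u x) 2) :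
    MemLp (fun x => a x * ‖u x‖) 2 volume :=
  h.norm.ae_eq (.of_forall fun x => by simp [norm_smul, abs_of_nonneg (ha x)])

section Global

variable {A F : R3 → R3} (h : CurvData A F) {u : L2} (hu : u ∈ H1) {κ : ℝ} {Y : R3 → ℝ}
  (hY0 : ∀ x, 0 ≤ Y x) (hY : MemLp Y 2 volume)
  (hF : MemLp (fun x => (‖x‖ * ‖F x‖) • u x) 2)
  (hloc : ∀ ζ : R3 → ℝ, IsTest ζ → (0 : R3) ∉ tsupport ζ →
    ∃ v ∈ H1, ((v : L2) =ᵐ[volume] fun x => ζ x • diracL A u x) ∧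
      ∀ᵐ x, ζ =ᶠ[𝓝 x] (fun _ => 1) → ‖x‖ * ‖diracL A v x - (κ : ℂ) • u x‖ ≤ Y x)

/-- The main part of the right hand side. -/
def virialMain (A F : R3 → R3) (u : L2) (Y : R3 → ℝ) (x : R3) : ℝ :=
  Y x * (gradLen A u x + 3 / 2 * (‖x‖⁻¹ * ‖u x‖)) + ‖x‖ * ‖F x‖ * (‖diracL A u x‖ * ‖u x‖)

/-- The weight of the gradient of the cutoff. -/
def virialError (A : R3 → R3) (u : L2) (κ : ℝ) (x : R3) : ℝ :=
  1 / 2 * ‖diracL A u x‖ ^ 2 + ‖diracL A u x‖ * gradLen A u x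
    + 3 / 2 * (‖diracL A u x‖ * (‖x‖⁻¹ * ‖u x‖)) + |κ| / 2 * ‖u x‖ ^ 2

lemma virialError_nonneg (x : R3) : 0 ≤ virialError A u κ x := by
  have : 0 ≤ gradLen A u x := Real.sqrt_nonneg _
  unfold virialError; positivity

include h hu in
lemma integrable_virialError : Integrable (virialError A u κ) := by
  have f := memLp_norm (diracL A u)
  exact ((((integrable_norm_sq (diracL A u)).const_mul (1 / 2)).add
    (f.integrable_mul (memLp_gradLen A u))).add
    ((f.integrable_mul (memLp_norm_inv_mul h.adm hu)).const_mul (3 / 2))).add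
    ((integrable_norm_sq u).const_mul (|κ| / 2))

include h hu hY hF in
lemma integrable_virialMain : Integrable (virialMain A F u Y) := by
  have hF' : MemLp (fun x => (‖x‖ * ‖F x‖) * ‖u x‖) 2 volume :=
    memLp_mul_norm (fun x => by positivity) hF
  refine (hY.integrable_mul ((memLp_gradLen A u).add
    ((memLp_norm_inv_mul h.adm hu).const_mul (3 / 2)))).add
    (((memLp_norm (diracL A u)).integrable_mul hF').congr (.of_forall fun x => ?_))
  simp only [Pi.mul_apply]
  ring

include h hu hY0 hY hF hloc in
lemma integral_annulus_le {R : ℝ} (hR : 0 < R) :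
    ∫ x, annulus R x * ‖diracL A u x‖ ^ 2 ≤ (∫ x, virialMain A F u Y x)
      + ∫ x, scaledGrad (annulus R) x * virialError A u κ x := by
  set ζ := annulus R with hζdef
  have hζ : IsTest ζ := isTest_annulus hR
  have hR4 : 0 < 4 * R := by linarith
  -- This larger cutoff is identically one near every point of `1/R ≤ |x| ≤ 2R`, so there `v`
  -- coincides with `f` and the squared equation holds without cutoff errors.
  obtain ⟨v, hv, v1, v2⟩ := hloc (annulus (4 * R)) (isTest_annulus hR4)
    (zero_notMem_tsupport_annulus hR4)
  have hw : ∀ k : Fin 3, IsTest fun x => ζ x * x k := fun k => hζ.mul_contDiff (contDiff_coord k)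
  obtain ⟨c, hc, G⟩ := integral_virialDensity h hv hu hw hζ κ
  have iζ := hζ.bddCont.integrable_mul_norm_sq (diracL A u)
  have iM := integrable_virialMain h hu hY hF
  obtain ⟨C, hC⟩ := exists_scaledGrad_annulus_bound
  have iE : Integrable fun x => scaledGrad ζ x * virialError A u κ x :=
    (integrable_virialError h hu).bdd_mul (c := C)
      hζ.continuous_scaledGrad.aestronglyMeasurable (.of_forall fun x => by
        rw [Real.norm_of_nonneg (scaledGrad_nonneg _ _)]; exact hC R x)
  have iG := G.integrable.re
  have zG : ∫ x, RCLike.re (virialDensity (fun k => ζ x * x k)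
      (fun j k => partialD j (fun x => ζ x * x k) x) (ζ x) (fun j => partialD j ζ x) κ (F x)
      (diracL A v x) (v x) (diracL A u x) (u x) (fun k => magD A k u x)
      (fun k => magD A k v x)) = 0 := by
    rw [integral_re G.integrable, G.integral]; exact hc
  have sum := integral_add iG iζ
  rw [zG, zero_add] at sum
  rw [← sum, ← integral_add iM iE]
  refine integral_mono_ae (iG.add iζ) (iM.add iE) ?_
  filter_upwards [v1, v2, ae_ne_zero, diracL_coe A u] with x x1 x2 hx xf
  have pW : ∀ j k, partialD j (fun x => ζ x * x k) x
      = partialD j ζ x * x k + if k = j then ζ x else 0 := fun j k => by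
    rw [partialD_mul j x (hζ.1.differentiable (by simp) x)
      ((contDiff_coord k).differentiable (by simp) x), partialD_coord]
    split_ifs <;> simp
  have hM0 : 0 ≤ virialMain A F u Y x := by
    have g0 : 0 ≤ gradLen A u x := Real.sqrt_nonneg _
    have y0 := hY0 x
    unfold virialMain; positivity
  have hE0 : 0 ≤ scaledGrad ζ x * virialError A u κ x :=
    mul_nonneg (scaledGrad_nonneg _ _) (virialError_nonneg x)
  simp only [pW]
  by_cases hin : R * ‖x‖ < 1 ∨ 2 * R < ‖x‖
  · have hz := annulus_eventuallyEq_zero hR hin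
    have z0 : ζ x = 0 := hz.eq_of_nhds
    have d0 : ∀ j, partialD j ζ x = 0 := fun j => by rw [partialD, hz.fderiv_eq]; simp
    -- Outside the annulus the multiplier vanishes together with its derivatives, and the right hand
    -- side is nonnegative.
    simp only [z0, d0, zero_mul, ite_self, add_zero, virialDensity_zero, map_zero]
    exact add_nonneg hM0 hE0
  · push Not at hin
    have ho : annulus (4 * R) =ᶠ[𝓝 x] fun _ => 1 :=
      annulus_eventuallyEq_one hR4 (by linarith [hin.1]) (by linarith [hin.2])
    have vx : v x = diracL A u x := by rw [x1, ho.eq_of_nhds, one_smul]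
    rw [vx]
    exact virialDensity_radial_le x (F x) (ζ x) κ (fun j => partialD j ζ x) (diracL A v x)
      (diracL A u x) (u x) (fun k => magD A k u x) (fun k => magD A k v x) xf.symm
      (annulus_nonneg x) (annulus_le_one x) hx (x2 ho)

include h hu hY0 hY hF hloc in
-- Dominated convergence as the annuli exhaust the space: the scaled gradient of the cutoff is
-- bounded uniformly in the radius and is eventually zero at each nonzero point, while `virialError`
-- is integrable.
theorem norm_diracL_sq_le_integral : ‖diracL A u‖ ^ 2 ≤ ∫ x, virialMain A F u Y x := by
  obtain ⟨C, hC⟩ := exists_scaledGrad_annulus_bound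
  set ρ : ℕ → ℝ := fun n => n + 1
  have hρ : ∀ n, 0 < ρ n := fun n => by positivity
  have hρl : Tendsto ρ atTop atTop := tendsto_atTop_add_const_right _ _ tendsto_natCast_atTop_atTop
  have ev : ∀ x : R3, x ≠ 0 → ∀ᶠ n in atTop, annulus (ρ n) =ᶠ[𝓝 x] fun _ => 1 := fun x hx => by
    have xp : 0 < ‖x‖ := norm_pos_iff.2 hx
    filter_upwards [hρl.eventually_gt_atTop ‖x‖, hρl.eventually_gt_atTop (2 / ‖x‖)] with n h1 h2
    exact annulus_eventuallyEq_one (hρ n) ((div_lt_iff₀ xp).1 h2) h1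
  have l1 : Tendsto (fun n => ∫ x, annulus (ρ n) x * ‖diracL A u x‖ ^ 2) atTop
      (𝓝 (∫ x, ‖diracL A u x‖ ^ 2)) := by
    refine tendsto_integral_of_dominated_convergence (fun x => ‖diracL A u x‖ ^ 2)
      (fun n => ((isTest_annulus (hρ n)).bddCont.integrable_mul_norm_sq _).1)
      (integrable_norm_sq _) (fun n => .of_forall fun x => ?_) ?_
    · rw [Real.norm_of_nonneg (mul_nonneg (annulus_nonneg _) (sq_nonneg _))]
      exact mul_le_of_le_one_left (sq_nonneg _) (annulus_le_one _)
    · filter_upwards [ae_ne_zero] with x hx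
      refine tendsto_const_nhds.congr' ?_
      filter_upwards [ev x hx] with n hn
      rw [hn.eq_of_nhds, one_mul]
  have l2 : Tendsto (fun n => ∫ x, scaledGrad (annulus (ρ n)) x * virialError A u κ x) atTop
      (𝓝 (∫ _x : R3, (0 : ℝ))) := by
    refine tendsto_integral_of_dominated_convergence (fun x => C * virialError A u κ x)
      (fun n => ((isTest_annulus (hρ n)).continuous_scaledGrad.aestronglyMeasurable.mul
        (integrable_virialError h hu).1))
      ((integrable_virialError h hu).const_mul C) (fun n => .of_forall fun x => ?_) ?_
    · rw [Real.norm_of_nonneg (mul_nonneg (scaledGrad_nonneg _ _) (virialError_nonneg x))]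
      exact mul_le_mul_of_nonneg_right (hC _ _) (virialError_nonneg x)
    · filter_upwards [ae_ne_zero] with x hx
      refine tendsto_const_nhds.congr' ?_
      filter_upwards [ev x hx] with n hn
      rw [scaledGrad_eq_zero hn, zero_mul]
  rw [norm_sq_eq_integral]
  have := le_of_tendsto_of_tendsto' l1 (l2.const_add (∫ x, virialMain A F u Y x))
    fun n => integral_annulus_le h hu hY0 hY hF hloc (hρ n)
  simpa using this

end Global

/-! ### `L²` norms of real functions -/

/-- The `L²` norm of a real function. -/
def l2norm (g : R3 → ℝ) : ℝ := (eLpNorm g 2 volume).toReal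

lemma l2norm_nonneg (g : R3 → ℝ) : 0 ≤ l2norm g := ENNReal.toReal_nonneg

lemma l2norm_add_le {f g : R3 → ℝ} (hf : MemLp f 2 volume) (hg : MemLp g 2 volume) :
    l2norm (fun x => f x + g x) ≤ l2norm f + l2norm g := by
  rw [l2norm, l2norm, l2norm, ← ENNReal.toReal_add hf.2.ne hg.2.ne]
  exact ENNReal.toReal_mono (ENNReal.add_ne_top.2 ⟨hf.2.ne, hg.2.ne⟩)
    (eLpNorm_add_le hf.1 hg.1 (by norm_num))

lemma l2norm_const_mul {c : ℝ} (hc : 0 ≤ c) (f : R3 → ℝ) :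
    l2norm (fun x => c * f x) = c * l2norm f := by
  have := eLpNorm_const_smul c f 2 (volume : Measure R3)
  rw [l2norm, l2norm, show (fun x => c * f x) = c • f from rfl, this, ENNReal.toReal_mul]
  simp [abs_of_nonneg hc]

lemma l2norm_mono {f g : R3 → ℝ} (hg : MemLp g 2 volume) (h0 : ∀ x, 0 ≤ f x)
    (h : ∀ x, f x ≤ g x) : l2norm f ≤ l2norm g :=
  ENNReal.toReal_mono hg.2.ne (eLpNorm_mono_real fun x => by
    rw [Real.norm_of_nonneg (h0 x)]; exact h x)

lemma l2norm_mul_norm {a : R3 → ℝ} {u : L2} (h : MemLp (fun x => a x • u x) 2)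
    (ha : ∀ x, 0 ≤ a x) : l2norm (fun x => a x * ‖u x‖) = ‖mulL a u‖ := by
  rw [l2norm, Lp.norm_def, ← eLpNorm_norm (mulL a u : R3 → Spinor)]
  congr 1
  refine eLpNorm_congr_ae ?_
  filter_upwards [mulL_coe h] with x hx
  rw [hx, norm_smul, Real.norm_of_nonneg (ha x)]

lemma l2norm_norm (u : L2) : l2norm (fun x => ‖u x‖) = ‖u‖ := by
  rw [l2norm, Lp.norm_def, eLpNorm_norm]

lemma l2norm_sq {g : R3 → ℝ} (hg : MemLp g 2 volume) : l2norm g ^ 2 = ∫ x, g x ^ 2 := by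
  have e : l2norm g = ‖hg.toLp g‖ := (Lp.norm_toLp g hg).symm
  rw [e, ← real_inner_self_eq_norm_sq, MeasureTheory.L2.inner_def]
  refine integral_congr_ae ?_
  filter_upwards [hg.coeFn_toLp] with x hx
  rw [hx]
  simp [sq]

lemma integral_mul_le {f g : R3 → ℝ} (hf : MemLp f 2 volume) (hg : MemLp g 2 volume) :
    ∫ x, f x * g x ≤ l2norm f * l2norm g := by
  have e : ∫ x, f x * g x = ⟪hf.toLp f, hg.toLp g⟫_ℝ := by
    rw [MeasureTheory.L2.inner_def]
    refine integral_congr_ae ?_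
    filter_upwards [hf.coeFn_toLp, hg.coeFn_toLp] with x h1 h2
    rw [h1, h2]
    simp [mul_comm]
  rw [e, l2norm, l2norm, ← Lp.norm_toLp f hf, ← Lp.norm_toLp g hg]
  exact real_inner_le_norm _ _

lemma gradLen_sq (A : R3 → R3) (u : L2) (x : R3) :
    gradLen A u x ^ 2 = ∑ k, ‖magD A k u x‖ ^ 2 :=
  Real.sq_sqrt (Finset.sum_nonneg fun _ _ => sq_nonneg _)

lemma l2norm_gradLen (A : R3 → R3) (u : L2) : l2norm (gradLen A u) = √(gradSq A u) := by
  have h : l2norm (gradLen A u) ^ 2 = gradSq A u := by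
    rw [l2norm_sq (memLp_gradLen A u), gradSq]
    simp only [gradLen_sq]
    rw [integral_finsetSum _ fun k _ => integrable_norm_sq _]
    exact Finset.sum_congr rfl fun k _ => (norm_sq_eq_integral _).symm
  rw [← h, Real.sqrt_sq (l2norm_nonneg _)]

lemma l2norm_norm_inv_mul_le {A : R3 → R3} (hA : Admissible A) {u : L2} (hu : u ∈ H1) :
    l2norm (fun x => ‖x‖⁻¹ * ‖u x‖) ≤ 2 * √(gradSq A u) := by
  rw [l2norm_mul_norm (hardy_memLp hA hu) fun x => by positivity]
  refine (abs_le_of_sq_le_sq' ?_ (by positivity)).2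
  rw [mul_pow, Real.sq_sqrt (gradSq_nonneg A u)]
  exact (hardy hA hu).trans_eq (by ring)

/-! ### The lower bound for the Dirac operator -/

/-- The field term has density at most `|F||u|²`, since `∑ F_i α_{i+1}α_{i+2}` is `|F|` times an
isometry. Writing it as `(|u|/|x|)(|x||F||u|)`, Hardy gives the factor `2` and the hypothesis gives
`ε`. -/
lemma gradSq_le {A F : R3 → R3} (h : CurvData A F) {u : L2} (hu : u ∈ H1) {ε : ℝ}
    (hF : MemLp (fun x => (‖x‖ * ‖F x‖) • u x) 2)
    (hε : ‖mulL (fun x => ‖x‖ * ‖F x‖) u‖ ≤ ε * √(gradSq A u)) :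
    gradSq A u ≤ ‖diracL A u‖ ^ 2 + 2 * ε * gradSq A u := by
  have e := norm_diracL_sq h hu
  have c := HasInt.sum Finset.univ fun i : Fin 3 => (⟨integrable_curvForm h i hu
    (actL_mem_H1 (alpha (i + 1) * alpha (i + 2)) hu), rfl⟩ :
      HasInt _ (curvForm F i u (actL (alpha (i + 1) * alpha (i + 2)) u)))
  have hF' := memLp_mul_norm (fun x => by positivity) hF
  have hh := memLp_norm_inv_mul h.adm hu
  have b : ‖∑ i, curvForm F i u (actL (alpha (i + 1) * alpha (i + 2)) u)‖
      ≤ ∫ x, (‖x‖⁻¹ * ‖u x‖) * (‖x‖ * ‖F x‖ * ‖u x‖) := by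
    rw [← c.integral]
    refine norm_integral_le_of_norm_le (hh.integrable_mul hF') ?_
    filter_upwards [ae_ne_zero, ae_all_iff.2 fun i : Fin 3 =>
      actL_coe (alpha (i + 1) * alpha (i + 2)) u] with x hx h1
    have e : ∑ i, (F x i : ℂ) * ⟪u x, actL (alpha (i + 1) * alpha (i + 2)) u x⟫_ℂ
        = ⟪u x, act (∑ i, (F x i : ℂ) • (alpha (i + 1) * alpha (i + 2))) (u x)⟫_ℂ := by
      rw [act_sum, inner_sum]
      refine Finset.sum_congr rfl fun i _ => ?_
      rw [act_smul, inner_smul_right, h1]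
    rw [e]
    refine (norm_inner_le_norm _ _).trans_eq ?_
    rw [norm_act_sum_alpha_mul_alpha]
    have := norm_ne_zero_iff.2 hx
    field_simp
  have b2 := b.trans (integral_mul_le hh hF')
  rw [l2norm_mul_norm hF fun x => by positivity] at b2
  have b3 : l2norm (fun x => ‖x‖⁻¹ * ‖u x‖) * ‖mulL (fun x => ‖x‖ * ‖F x‖) u‖
      ≤ (2 * √(gradSq A u)) * (ε * √(gradSq A u)) :=
    mul_le_mul (l2norm_norm_inv_mul_le h.adm hu) hε (norm_nonneg _) (by positivity)
  have s := Real.mul_self_sqrt (gradSq_nonneg A u)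
  have re := congrArg Complex.re e
  rw [Complex.add_re, Complex.ofReal_re, Complex.ofReal_re] at re
  have n : -(Complex.I * ∑ i, curvForm F i u (actL (alpha (i + 1) * alpha (i + 2)) u)).re
      ≤ ‖∑ i, curvForm F i u (actL (alpha (i + 1) * alpha (i + 2)) u)‖ := by
    refine (neg_le_abs _).trans ((Complex.abs_re_le_norm _).trans_eq ?_)
    rw [norm_mul, Complex.norm_I, one_mul]
  have s2 : (2 * √(gradSq A u)) * (ε * √(gradSq A u)) = 2 * ε * gradSq A u := by
    linear_combination 2 * ε * s
  linarith

/-! ### Bounds of the right hand side -/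

section Bounds

variable {m : ℝ} {A B : R3 → R3} {DB : R3 → R3 →L[ℝ] R3} {φ : R3 → ℝ} {ε₁ ε₂ ε₃ ε₄ ε₅ : ℝ} {u : L2}

lemma squaredBound_nonneg (hm : 0 ≤ m) (h₂ : 0 ≤ ε₂) (h₄ : 0 ≤ ε₄) (x : R3) :
    0 ≤ squaredBound m A B DB φ ε₂ ε₄ u x := by
  unfold squaredBound; positivity

lemma squaredBound_norm_le (hm : 0 ≤ m) (h₂ : 0 ≤ ε₂) (h₄ : 0 ≤ ε₄) (hA : Admissible A)
    (hu : u ∈ H1)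
    (m1 : MemLp (fun x => (‖x‖ * ‖B x‖) • u x) 2)
    (m3 : MemLp (fun x => (‖x‖ * ‖Laplacian.laplacian φ x‖) • u x) 2)
    (m5 : MemLp (fun x => (‖x‖ * ‖DB x‖) • u x) 2)
    (n1 : ‖mulL (fun x => ‖x‖ * ‖B x‖) u‖ ≤ ε₁ * √(gradSq A u))
    (n3 : ‖mulL (fun x => ‖x‖ * ‖Laplacian.laplacian φ x‖) u‖ ≤ ε₃ * √(gradSq A u))
    (n5 : ‖mulL (fun x => ‖x‖ * ‖DB x‖) u‖ ≤ ε₅ * √(gradSq A u)) :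
    MemLp (squaredBound m A B DB φ ε₂ ε₄ u) 2 volume ∧
      l2norm (squaredBound m A B DB φ ε₂ ε₄ u)
        ≤ (4 * (ε₂ + ε₄) + ε₃ + 2 * ε₅ + 2 * m * ε₁ + 2 * (ε₂ + ε₄) ^ 2) * √(gradSq A u) := by
  have s0 : ∀ x, 0 ≤ ∑ j, ‖magD A j u x‖ := fun x => Finset.sum_nonneg fun _ _ => norm_nonneg _
  have ms : MemLp (fun x => ∑ j, ‖magD A j u x‖) 2 volume :=
    memLp_finsetSum _ fun k _ => memLp_norm _
  -- Cauchy–Schwarz gives `√3`; rounding up to `2` matches the constants of the theorem.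
  have ns : l2norm (fun x => ∑ j, ‖magD A j u x‖) ≤ 2 * √(gradSq A u) := by
    rw [← l2norm_gradLen, ← l2norm_const_mul (by norm_num)]
    refine l2norm_mono ((memLp_gradLen A u).const_mul 2) s0 fun x => ?_
    refine (abs_le_of_sq_le_sq' ?_ (mul_nonneg (by norm_num) (Real.sqrt_nonneg _))).2
    rw [mul_pow, Real.sq_sqrt (Finset.sum_nonneg fun _ _ => sq_nonneg _)]
    have hc := sq_sum_le_card_mul_sum_sq (s := Finset.univ) (f := fun j => ‖magD A j u x‖)
    have hp : 0 ≤ ∑ k, ‖magD A k u x‖ ^ 2 := Finset.sum_nonneg fun _ _ => sq_nonneg _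
    simp only [Finset.card_univ, Fintype.card_fin] at hc
    push_cast at hc
    linarith
  have p1 := memLp_mul_norm (fun x => by positivity) m1
  have p3 := memLp_mul_norm (fun x => by positivity) m3
  have p5 := memLp_mul_norm (fun x => by positivity) m5
  rw [← l2norm_mul_norm m1 fun x => by positivity] at n1
  rw [← l2norm_mul_norm m3 fun x => by positivity] at n3
  rw [← l2norm_mul_norm m5 fun x => by positivity] at n5
  have ph := memLp_norm_inv_mul hA hu
  have nh := l2norm_norm_inv_mul_le hA hu
  have q1 := ms.const_mul (2 * (ε₂ + ε₄))
  have q2 := q1.add p3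
  have q3 := q2.add (p5.const_mul 2)
  have q4 := q3.add (p1.const_mul (2 * m))
  have q5 := ph.const_mul ((ε₂ + ε₄) ^ 2)
  refine ⟨q4.add q5, ?_⟩
  have l4 : l2norm (squaredBound m A B DB φ ε₂ ε₄ u) ≤ _ := l2norm_add_le q4 q5
  have l3 := l2norm_add_le q3 (p1.const_mul (2 * m))
  have l2 := l2norm_add_le q2 (p5.const_mul 2)
  have l1 := l2norm_add_le q1 p3
  have c1 := l2norm_const_mul (show 0 ≤ 2 * (ε₂ + ε₄) by positivity)
    fun x => ∑ j, ‖magD A j u x‖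
  have c2 := l2norm_const_mul (zero_le_two (α := ℝ)) fun x => ‖x‖ * ‖DB x‖ * ‖u x‖
  have c3 := l2norm_const_mul (show 0 ≤ 2 * m by positivity) fun x => ‖x‖ * ‖B x‖ * ‖u x‖
  have c4 := l2norm_const_mul (show 0 ≤ (ε₂ + ε₄) ^ 2 by positivity) fun x => ‖x‖⁻¹ * ‖u x‖
  have t1 := mul_le_mul_of_nonneg_left ns (show 0 ≤ 2 * (ε₂ + ε₄) by positivity)
  have t2 := mul_le_mul_of_nonneg_left n1 (show 0 ≤ 2 * m by positivity)
  have t3 := mul_le_mul_of_nonneg_left nh (show 0 ≤ (ε₂ + ε₄) ^ 2 by positivity)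
  calc l2norm (squaredBound m A B DB φ ε₂ ε₄ u) ≤ _ := l4
    _ ≤ _ := add_le_add_left l3 _
    _ ≤ _ := add_le_add_left (add_le_add_left l2 _) _
    _ ≤ _ := add_le_add_left (add_le_add_left (add_le_add_left l1 _) _) _
    _ ≤ _ := by
      rw [c1, c2, c3, c4]
      linarith

/-- The factor `4` is `1 + (3/2)·2`: the gradient itself, and the zeroth order term estimated by
Hardy. -/
lemma integral_virialMain_le {F : R3 → R3} {Y : R3 → ℝ} {K : ℝ} (hA : Admissible A) (hu : u ∈ H1)
    (hY : MemLp Y 2 volume) (hK : l2norm Y ≤ K * √(gradSq A u))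
    (m1 : MemLp (fun x => (‖x‖ * ‖F x‖) • u x) 2)
    (n1 : ‖mulL (fun x => ‖x‖ * ‖F x‖) u‖ ≤ ε₁ * √(gradSq A u)) :
    ∫ x, virialMain A F u Y x
      ≤ 4 * K * gradSq A u + ‖diracL A u‖ * (ε₁ * √(gradSq A u)) := by
  have p1 := memLp_mul_norm (fun x => by positivity) m1
  have ph := (memLp_norm_inv_mul hA hu).const_mul (3 / 2)
  have pf := memLp_norm (diracL A u)
  have pg := (memLp_gradLen A u).add ph
  have e : ∀ x, virialMain A F u Y x = Y x * (gradLen A u x + 3 / 2 * (‖x‖⁻¹ * ‖u x‖))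
      + ‖diracL A u x‖ * (‖x‖ * ‖F x‖ * ‖u x‖) := fun x => by
    rw [virialMain]; ring
  simp only [e]
  have i1 := integral_mul_le hY pg
  have i2 := integral_mul_le pf p1
  rw [l2norm_norm, l2norm_mul_norm m1 fun x => by positivity] at i2
  have s := Real.mul_self_sqrt (gradSq_nonneg A u)
  have lg : l2norm (gradLen A u + fun x => 3 / 2 * (‖x‖⁻¹ * ‖u x‖)) ≤ 4 * √(gradSq A u) := by
    refine (l2norm_add_le (memLp_gradLen A u) ph).trans ?_
    rw [l2norm_gradLen, l2norm_const_mul (by norm_num)]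
    linarith [l2norm_norm_inv_mul_le hA hu]
  have t1 : l2norm Y * l2norm (gradLen A u + fun x => 3 / 2 * (‖x‖⁻¹ * ‖u x‖))
      ≤ (K * √(gradSq A u)) * (4 * √(gradSq A u)) :=
    mul_le_mul hK lg (l2norm_nonneg _) ((l2norm_nonneg _).trans hK)
  have t2 := mul_le_mul_of_nonneg_left n1 (norm_nonneg (diracL A u))
  have t3 : (K * √(gradSq A u)) * (4 * √(gradSq A u)) = 4 * K * gradSq A u := by
    linear_combination 4 * K * s
  rw [← t3]
  exact (integral_add (hY.integrable_mul pg) (pf.integrable_mul p1)).le.trans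
    (add_le_add (i1.trans t1) (i2.trans t2))

end Bounds

/-! ### Absence of eigenvalues -/

lemma IsWeakCurl.of_neg {A B : R3 → R3} (h : IsWeakCurl A fun x => -B x) :
    IsWeakCurl (fun x => -A x) B := fun η hη j => by
  have e := h η hη j
  have e1 : ∀ x, η x * (-B x) j = -(η x * B x j) := fun x => by simp
  have e2 : ∀ x, (-A x) (j + 1) * partialD (j + 2) η x - (-A x) (j + 2) * partialD (j + 1) η x
      = -(A x (j + 1) * partialD (j + 2) η x - A x (j + 2) * partialD (j + 1) η x) := fun x => by
    simp; ring
  simp only [e1, integral_neg] at e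
  simp only [e2, integral_neg]
  linarith

lemma aestronglyMeasurable_laplacian {φ : R3 → ℝ} (hφ : ContDiffOn ℝ ∞ φ {0}ᶜ) :
    AEStronglyMeasurable (Laplacian.laplacian φ) volume := by
  have hs : MeasurableSet ({0}ᶜ : Set R3) := (measurableSet_singleton 0).compl
  have hr : (volume : Measure R3).restrict {0}ᶜ = volume :=
    Measure.restrict_eq_self_of_ae_mem ae_ne_zero
  have hc : ContinuousOn (fun x => ∑ j, partialD j (partialD j φ) x) {0}ᶜ :=
    continuousOn_finsetSum _ fun j _ => (contDiffOn_partialD (contDiffOn_partialD hφ j) j).continuousOn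
  have hm := hc.aestronglyMeasurable (μ := volume) hs
  rw [hr] at hm
  refine hm.congr ?_
  filter_upwards [ae_ne_zero] with x hx
  exact (laplacian_eq_sum ((hφ.contDiffAt (isOpen_compl_singleton.mem_nhds hx)).of_le
    (by norm_cast))).symm

lemma eq_zero_of_gradSq_eq_zero {A : R3 → R3} (hA : Admissible A) {u : L2} (hu : u ∈ H1)
    (h : gradSq A u = 0) : u = 0 := by
  have hh := hardy hA hu
  rw [h, mul_zero] at hh
  have h0 : mulL (fun x : R3 => ‖x‖⁻¹) u = 0 :=
    norm_eq_zero.1 (pow_eq_zero_iff two_ne_zero |>.1 (le_antisymm hh (sq_nonneg _)))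
  refine Lp.ext ?_
  have hc := mulL_coe (hardy_memLp hA hu)
  rw [h0] at hc
  filter_upwards [hc, Lp.coeFn_zero Spinor 2 (volume : Measure R3), ae_ne_zero] with x h1 h2 hx
  rw [h2, Pi.zero_apply] at h1 ⊢
  exact (smul_eq_zero.1 h1.symm).resolve_left (inv_ne_zero (norm_ne_zero_iff.2 hx))

/-- If `n ≤ N`, inserting the second inequality into the first gives `N² ≤ (3a + b)N²`. If `n ≥ N`,
monotonicity of `n(n - aN)` in the second alone gives `(1 - a)N² ≤ bN²`. Either is impossible for `N
> 0`. -/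
lemma eq_zero_of_virial_inequalities {N n a b : ℝ} (hN : 0 ≤ N) (hn : 0 ≤ n) (ha : 0 ≤ a)
    (hb : 0 ≤ b) (h1 : N ^ 2 ≤ n ^ 2 + 2 * a * N ^ 2) (h2 : n ^ 2 ≤ b * N ^ 2 + n * (a * N))
    (hab : 3 * a + b < 1) : N = 0 := by
  by_contra h0
  have hp : 0 < N := lt_of_le_of_ne hN (Ne.symm h0)
  have hp2 : 0 < N ^ 2 := by positivity
  rcases le_total n N with h | h
  · have : n * (a * N) ≤ a * N ^ 2 := by
      have := mul_le_mul_of_nonneg_right h (mul_nonneg ha hN)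
      linarith [this]
    nlinarith
  · have : N * (N - a * N) ≤ n * (n - a * N) := by
      refine mul_le_mul h (by linarith) ?_ hn
      have : a * N ≤ 1 * N := mul_le_mul_of_nonneg_right (by linarith) hN
      linarith
    nlinarith

theorem eigenvector_eq_zero {m : ℝ} {A B F : R3 → R3} {DB : R3 → R3 →L[ℝ] R3} {φ : R3 → ℝ}
    {ε₁ ε₂ ε₃ ε₄ ε₅ : ℝ} {μ : ℂ} {u : L2} (h : EigenData m A B DB φ ε₂ ε₄ μ u)
    (hF : CurvData A F) (hFB : ∀ x, ‖F x‖ = ‖B x‖)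
    (h₁ : 0 ≤ ε₁) (h₂ : 0 ≤ ε₂) (h₃ : 0 ≤ ε₃) (h₄ : 0 ≤ ε₄) (h₅ : 0 ≤ ε₅)
    (hsmall : 3 * ε₁ + 4 * (4 * (ε₂ + ε₄) + ε₃ + 2 * ε₅ + 2 * m * ε₁ + 2 * (ε₂ + ε₄) ^ 2) < 1)
    (hμ : μ.im = 0)
    (m1 : MemLp (fun x => (‖x‖ * ‖B x‖) • u x) 2)
    (m3 : MemLp (fun x => (‖x‖ * ‖Laplacian.laplacian φ x‖) • u x) 2)
    (m5 : MemLp (fun x => (‖x‖ * ‖DB x‖) • u x) 2)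
    (n1 : ‖mulL (fun x => ‖x‖ * ‖B x‖) u‖ ≤ ε₁ * √(gradSq A u))
    (n3 : ‖mulL (fun x => ‖x‖ * ‖Laplacian.laplacian φ x‖) u‖ ≤ ε₃ * √(gradSq A u))
    (n5 : ‖mulL (fun x => ‖x‖ * ‖DB x‖) u‖ ≤ ε₅ * √(gradSq A u)) : u = 0 := by
  have hm := h.mass
  obtain ⟨hY, hK⟩ := squaredBound_norm_le hm h₂ h₄ h.adm h.mem m1 m3 m5 n1 n3 n5
  -- Reality of `κ` is what allows `κ⟨u, G u⟩` to be dropped after taking real parts.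
  have hκ : μ ^ 2 - (m : ℂ) ^ 2 = ((μ.re ^ 2 - m ^ 2 : ℝ) : ℂ) := by
    have : μ = (μ.re : ℂ) := Complex.ext (by simp) (by simp [hμ])
    conv_lhs => rw [this]
    push_cast; ring
  simp only [← hFB] at m1 n1
  have key := norm_diracL_sq_le_integral hF h.mem (κ := μ.re ^ 2 - m ^ 2)
    (squaredBound_nonneg hm h₂ h₄) hY m1 fun ζ hζ h0 => by
      rw [← hκ]; exact h.exists_localized hζ h0
  have up := key.trans (integral_virialMain_le h.adm h.mem hY hK m1 n1)
  have low := gradSq_le hF h.mem m1 n1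
  have s := Real.sq_sqrt (gradSq_nonneg A u)
  rw [← s] at up low
  rw [Real.sqrt_sq (Real.sqrt_nonneg _)] at up
  have hN := eq_zero_of_virial_inequalities (Real.sqrt_nonneg _) (norm_nonneg _) h₁
    (by positivity) low up hsmall
  rw [hN] at s
  exact eq_zero_of_gradSq_eq_zero h.adm h.mem (by linarith)

end

end MagneticDirac

open MagneticDirac in
theorem theorem1p11
    (m : ℝ) (hm : 0 ≤ m)
    -- the magnetic potential, its magnetic field and the Jacobian of the field
    (A B : R3 → R3) (DB : R3 → R3 →L[ℝ] R3)
    (hA : L2Loc A) (hB : L2Loc B)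
    -- either orientation convention for the magnetic field vector
    (hAB : IsWeakCurl A B ∨ IsWeakCurl A (fun x => -B x))
    (hDB : IsWeakJacobian B DB)
    -- `H_m(A)` is self-adjoint with domain `H¹`
    (hsa : IsSelfAdjoint (diracOp m A 0)) (hdom : (diracOp m A 0).domain = H1)
    (φ : R3 → ℝ) (hφ : L2Loc φ) (hφs : ContDiffOn ℝ ∞ φ {0}ᶜ)
    (hφb : ∀ r : ℝ, 0 < r → ∃ C : ℝ, ∀ x : R3, r ≤ ‖x‖ → |φ x| ≤ C)
    (ε₁ ε₂ ε₃ ε₄ ε₅ : ℝ)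
    (h₁ : 0 ≤ ε₁) (h₂ : 0 ≤ ε₂) (h₃ : 0 ≤ ε₃) (h₄ : 0 ≤ ε₄) (h₅ : 0 ≤ ε₅)
    (hsmall : 6 * ε₁ + 16 * ε₂ ^ 2 + 16 * ε₄ ^ 2 + 32 * ε₂ * ε₄ + m * 32 * ε₁
      + 32 * ε₂ + 48 * ε₄ + 8 * ε₃ + 16 * ε₅ < 2)
    (hBε : ∀ ψ : L2, ψ ∈ H1 →
      ∫⁻ x, ‖x‖ₑ ^ 2 * ‖B x‖ₑ ^ 2 * ‖ψ x‖ₑ ^ 2 ≤ ENNReal.ofReal (ε₁ ^ 2) * magGradSq A ψ)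
    (hφ₁ : ∀ x : R3, x ≠ 0 → ‖x‖ * ‖gradient φ x‖ ≤ ε₂)
    (hφ₂ : ∀ ψ : L2, ψ ∈ H1 →
      ∫⁻ x, ‖x‖ₑ ^ 2 * ‖Laplacian.laplacian φ x‖ₑ ^ 2 * ‖ψ x‖ₑ ^ 2
        ≤ ENNReal.ofReal (ε₃ ^ 2) * magGradSq A ψ)
    (hB₁ : ∀ᵐ x : R3, ‖x‖ * ‖B x‖ ≤ ε₄)
    (hB₂ : ∀ ψ : L2, ψ ∈ H1 →
      ∫⁻ x, ‖x‖ₑ ^ 2 * ‖DB x‖ₑ ^ 2 * ‖ψ x‖ₑ ^ 2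
        ≤ ENNReal.ofReal (ε₅ ^ 2) * magGradSq A ψ) :
    pointSpectrum (diracOp m A (anomalousPotential φ B)) = ∅ := by
  have adm : Admissible A := admissible_of_domain hA.locallyIntegrable hdom
  have mB := hB.locallyIntegrable.aestronglyMeasurable
  have mD := aestronglyMeasurable_jacobian hDB
  have mL := aestronglyMeasurable_laplacian hφs
  have locA : ∀ j, LocallyIntegrable fun x => A x j :=
    fun j => LocallyIntegrable.coord hA.locallyIntegrable j
  have trace : ∀ᵐ x, ∑ j, DB x (EuclideanSpace.single j (1 : ℝ)) j = 0 := by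
    rcases hAB with hc | hc
    · exact ae_trace_eq_zero locA hc hDB
    · exact ae_trace_eq_zero (fun j => (locA j).neg) hc.of_neg hDB
  -- The curl of `A` is `B` or `-B`; the estimates use only its length, so both orientations are
  -- treated at once.
  obtain ⟨F, hF, hFB⟩ : ∃ F, CurvData A F ∧ ∀ x, ‖F x‖ = ‖B x‖ := by
    rcases hAB with hc | hc
    · exact ⟨B, curvData_of_field hA adm hB hc hBε, fun _ => rfl⟩
    · refine ⟨fun x => -B x, curvData_of_field (ε := ε₁) hA adm (fun K hK => (hB K hK).neg) hc
        fun ψ hψ => ?_, fun _ => norm_neg _⟩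
      simp only [enorm_neg]
      exact hBε ψ hψ
  refine Set.eq_empty_iff_forall_notMem.2 ?_
  rintro μ ⟨ψ, hψ0, hψ⟩
  have hu : (ψ : L2) ∈ H1 := ψ.2.1
  have heq : diracFun m A (anomalousPotential φ B) (ψ : L2)
      =ᵐ[volume] fun x => μ • (ψ : L2) x := by
    have e : diracImage m A (anomalousPotential φ B) ψ = μ • (ψ : L2) := hψ
    refine (diracImage_coe m A (anomalousPotential φ B) ψ).symm.trans ?_
    rw [e]
    exact Lp.coeFn_smul μ (ψ : L2)
  have data : EigenData m A B DB φ ε₂ ε₄ μ ψ :=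
    { mass := hm
      adm := adm
      jac := hDB
      trace := trace
      smooth := hφs
      grad_le := hφ₁
      field_le := hB₁
      mult_field := fun k χ hχ => memLp_multiplier_comp adm hχ mB (hBε χ hχ)
        (LocallyIntegrable.coord hB.locallyIntegrable k).aestronglyMeasurable
        fun x => abs_coord_le _ _
      mult_jac := fun k j χ hχ => memLp_multiplier_comp adm hχ mD (hB₂ χ hχ)
        (LocallyIntegrable.coord (hDB j).2.1 k).aestronglyMeasurable fun x =>
          (abs_coord_le _ _).trans ((DB x).le_opNorm _ |>.trans_eq (by simp))
      mem := hu
      eigen := heq }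
  refine hψ0 (eigenvector_eq_zero data hF hFB h₁ h₂ h₃ h₄ h₅ ?_
    (eigenvalue_im_eq_zero adm (fun x => ?_) hu hψ0 heq)
    (memLp_multiplier adm hu mB (hBε _ hu)) (memLp_multiplier adm hu mL (hφ₂ _ hu))
    (memLp_multiplier adm hu mD (hB₂ _ hu)) (norm_multiplier_le adm hu mB h₁ (hBε _ hu))
    (norm_multiplier_le adm hu mL h₃ (hφ₂ _ hu)) (norm_multiplier_le adm hu mD h₅ (hB₂ _ hu)))
  -- Twice the required left side has `32ε₄` and `16mε₁` where the hypothesis has `48ε₄` and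
  -- `32mε₁`; the other terms agree, so nonnegativity of `mε₁` and `ε₄` is enough.
  · nlinarith [mul_nonneg hm h₁]
  · rw [anomalousPotential_eq]; exact potMat_conjTranspose _ _
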